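/- **Conventions.** For a finite set $S$ let $C_2(S)$, $C_3(S)$ be the sets of ordered pairs and triples of distinct elements of $S$, let $I=[0,\infty]$ (a smooth manifold with boundary, with coordinate $1/r$ near $\infty$), and let $C_S(X)\subset X^S$ be the space of injective maps $S\to X$. Let $M$ be a smooth $d$-dimensional manifold without boundary, smoothly embedded in $\mathbb R^m$. Put $\tilde A_S[\mathbb R^m]=(S^{m-1})^{C_2(S)}\times I^{C_3(S)}$ and $A_S[M]=M^S\times\tilde A_S[\mathbb R^m]$. Let $C_S[M]$ be the closure in $A_S[M]$ of the image of $$C_S(M)\to A_S[M],\qquad (x_i)\mapsto\Big((x_i),\Big(\tfrac{x_i-x_j}{|x_i-x_j|}\Big),\Big(\tfrac{|x_i-x_j|}{|x_i-x_k|}\Big)\Big).$$ Let $\tilde C_S(\mathbb R^d)$ be the quotient of $C_S(\mathbb R^d)$ by translations and positive scalings, and let $\tilde C_S[\mathbb R^d]$ be the closure of its image in $\tilde A_S[\mathbb R^d]$ under directions and ratios of distances. A linear isomorphism $g$ of $\mathbb R^d$ acts on $\tilde C_S[\mathbb R^d]$ by the continuous extension $\tilde C_S[g]$ of $[(x_i)]\mapsto[(g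 x_i)]$. Let $IC_S[M]$ be the fiber bundle over $M$ with fiber $\tilde C_S[\mathbb R^d]$ that has the same charts as $TM$ and the coordinate transformations $\tilde C_S[\phi_{ij}]$, where $\phi_{ij}$ are the coordinate transformations of $TM$. An $f$-tree $T$ with $n$ leaves is a finite rooted tree without bivalent vertices other than possibly the root $v_0$, whose leaves (the univalent vertices other than the root) are labelled bijectively by $\{1,\dots,n\}$. Let $V(T)$ be the set of its non-leaf vertices, $V^i(T)=V(T)\setminus\{v_0\}$ the set of internal vertices, $E(v)$ the set of edges that leave $v$ away from the root, and $E_0=E(v_0)$. For $e\in E_0$ let $V(e)\subset V^i(T)$ be the set of internal vertices over $e$. Up to isomorphism, $T$ is determined by the nested family of the sets $A_v$ ($v\in V^i(T)$) of labels of leaves over $v$. For $x=((x_i),(u_{ij}),(d_{ijk}))\in C_n[M]$ let $T(x)$ be the $f$-tree whose nested family consists of the sets $\{i\}\cup\{j: d_{ijk}=0\}$, for those $(i,k)$ for which some $d_{ijk}$ is $0$, together with $\{1,\dots,n\}$ if $n\ge2$ and all $x_i$ are equal. Let $C_T(M)=\{x\in C_n[M]:T(x)\cong T\}$, and let $C_T[M]$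 be its closure in $C_n[M]$. Let $\tilde C_T(\mathbb R^d)\subset\tilde C_n[\mathbb R^d]$ be the subspace of the points for which the sets $\{i\}\cup\{j:d_{ijk}=0\}$ as above are exactly the sets $A_v\ne\{1,\dots,n\}$, $v\in V^i(T)$. For $e\in E_0$ let $IC_e[M]$ be the space of a point $p\in M$ together with a point of $IC_{E(v)}[M]$ over $p$ for each $v\in V(e)$. Let $D_T[M]$ be the pull-back $$D_T[M]=C_{E_0}[M]\times_{M^{E_0}}\prod_{e\in E_0}IC_e[M].$$ All these spaces carry the smooth structure inherited from the manifolds with corners (or the bundles of such) in which they lie; a map between them is smooth if it is continuous and, in local coordinates, locally extends to a $C^\infty$ map. A diffeomorphism is a homeomorphism that is smooth in both directions. **Theorem.** Let $T$ be an $f$-tree with $n$ leaves. 1. For every smooth manifold $M$ without boundary, smoothly embedded in some $\mathbb R^m$, $C_T[M]$ is diffeomorphic to $D_T[M]$. 2. For every $d\ge0$, $\tilde C_T(\mathbb R^d)$ is diffeomorphic to $\prod_{v\in V(T)}\tilde C_{E(v)}(\mathbb R^d)$. -/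

import Mathlib

open Set Function Topology
open scoped ENNReal ContDiff Manifold

noncomputable section

namespace ConfSpace

/-! ## Smooth maps between spaces with local coordinates -/

/-- Local coordinate systems on a space `X`: maps `coord i`, defined on `dom i ⊆ X`, with values in
a normed space.  A coordinate map identifies its domain with an *arbitrary* subset of the normed
space (for a manifold with corners: with an open subset of a closed quadrant, suitably embedded). -/
structure LocalCoords (X : Type*) where
  Index : Type*
  Model : Type*
  [normed : NormedAddCommGroup Model]
  [space : NormedSpace ℝ Model]
  dom : Index → Set X
  coord : Index → X → Model
  cover : ∀ x, ∃ i, x ∈ dom i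

attribute [instance] LocalCoords.normed LocalCoords.space

namespace LocalCoords

/-- A continuous map is smooth when, in all local coordinates around all points, it is the
restriction of a `C^∞` map defined on a neighbourhood in the model normed space. -/
def IsSmooth {X Y : Type*} [TopologicalSpace X] [TopologicalSpace Y]
    (a : LocalCoords X) (b : LocalCoords Y) (f : X → Y) : Prop :=
  Continuous f ∧ ∀ x : X, ∀ i, x ∈ a.dom i → ∀ j, f x ∈ b.dom j →
    ∃ N ∈ 𝓝 (a.coord i x), ∃ F : a.Model → b.Model, ContDiffOn ℝ ∞ F N ∧
      ∀ᶠ x' in 𝓝 x, b.coord j (f x') = F (a.coord i x')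

/-- Existence of a diffeomorphism: a homeomorphism that is smooth in both directions. -/
def Diffeomorphic {X Y : Type*} [TopologicalSpace X] [TopologicalSpace Y]
    (a : LocalCoords X) (b : LocalCoords Y) : Prop :=
  ∃ Φ : X ≃ₜ Y, IsSmooth a b Φ ∧ IsSmooth b a Φ.symm

/-- A single global coordinate map. -/
def ofMap {X V : Type*} [NormedAddCommGroup V] [NormedSpace ℝ V] (f : X → V) :
    LocalCoords X where
  Index := Unit
  Model := V
  dom _ := univ
  coord _ := f
  cover _ := ⟨(), mem_univ _⟩

/-- The charts of a manifold without boundary. -/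
def ofCharts (d : ℕ) (M : Type*) [TopologicalSpace M]
    [ChartedSpace (EuclideanSpace ℝ (Fin d)) M] : LocalCoords M where
  Index := atlas (EuclideanSpace ℝ (Fin d)) M
  Model := EuclideanSpace ℝ (Fin d)
  dom i := i.1.source
  coord i := i.1
  cover x := ⟨achart _ x, mem_chart_source _ x⟩

/-- Restriction of coordinates to a subspace. -/
def sub {X : Type*} (a : LocalCoords X) (p : X → Prop) : LocalCoords {x // p x} where
  Index := a.Index
  Model := a.Model
  dom i := Subtype.val ⁻¹' a.dom i
  coord i x := a.coord i x.1
  cover x := a.cover x.1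

/-- Product coordinates. -/
def prod {X Y : Type*} (a : LocalCoords X) (b : LocalCoords Y) : LocalCoords (X × Y) where
  Index := a.Index × b.Index
  Model := a.Model × b.Model
  dom i := a.dom i.1 ×ˢ b.dom i.2
  coord i x := (a.coord i.1 x.1, b.coord i.2 x.2)
  cover x := by
    obtain ⟨i, hi⟩ := a.cover x.1
    obtain ⟨j, hj⟩ := b.cover x.2
    exact ⟨(i, j), hi, hj⟩

/-- Product coordinates on a finite product. -/
def pi {S : Type*} [Finite S] {X : S → Type*} (a : ∀ s, LocalCoords (X s)) :
    LocalCoords (∀ s, X s) :=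
  letI := Fintype.ofFinite S
  { Index := ∀ s, (a s).Index
    Model := ∀ s, (a s).Model
    dom := fun i => {x | ∀ s, x s ∈ (a s).dom (i s)}
    coord := fun i x s => (a s).coord (i s) (x s)
    cover := fun x => by
      choose i hi using fun s => (a s).cover (x s)
      exact ⟨i, hi⟩ }

/-- The unit sphere of a normed space, as a subspace of that normed space. -/
def sphere (E : Type*) [NormedAddCommGroup E] [NormedSpace ℝ E] :
    LocalCoords (Metric.sphere (0 : E) 1) :=
  ofMap Subtype.val

/-- The interval `[0, ∞]` with its structure of smooth manifold with boundary, in which `r` is a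
coordinate near `0` and `1 / r` is a coordinate near `∞`: the function `r ↦ 1 / (1 + r)` is a
diffeomorphism onto `[0, 1]`. -/
def interval : LocalCoords ℝ≥0∞ :=
  ofMap fun r => ((1 + r)⁻¹).toReal

end LocalCoords

/-! ## Configuration spaces and their compactifications -/

section Config

/-- Ordered pairs of distinct elements. -/
abbrev C₂ (S : Type*) := {p : S × S // p.1 ≠ p.2}

/-- Ordered triples of pairwise distinct elements. -/
abbrev C₃ (S : Type*) := {p : S × S × S // p.1 ≠ p.2.1 ∧ p.1 ≠ p.2.2 ∧ p.2.1 ≠ p.2.2}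

/-- From `(i, j, k)` to `(i, j)`. -/
def C₃.fst {S : Type*} (t : C₃ S) : C₂ S := ⟨(t.1.1, t.1.2.1), t.2.1⟩

/-- From `(i, j, k)` to `(i, k)`. -/
def C₃.snd {S : Type*} (t : C₃ S) : C₂ S := ⟨(t.1.1, t.1.2.2), t.2.2.1⟩

/-- The open configuration space of points of `X` indexed by `S`. -/
abbrev Conf (S X : Type*) := {x : S → X // Injective x}

variable (S : Type*) (M : Type*) (E : Type*) [NormedAddCommGroup E] [NormedSpace ℝ E]

/-- The space of pairwise directions and of ratios of distances. -/
abbrev Atilde := (C₂ S → Metric.sphere (0 : E) 1) × (C₃ S → ℝ≥0∞)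

/-- The ambient space of the compactification. -/
abbrev A := (S → M) × Atilde S E

variable {S M E}

/-- The unit vector in the direction of `x - y`. -/
def direction (x y : E) (h : x ≠ y) : Metric.sphere (0 : E) 1 :=
  ⟨‖x - y‖⁻¹ • (x - y), by
    have : ‖x - y‖ ≠ 0 := norm_ne_zero_iff.2 (sub_ne_zero.2 h)
    simp [norm_smul, this]⟩

/-- The directions `π_ij` and the ratios of distances `s_ijk` of a configuration of vectors. -/
def invariants (x : Conf S E) : Atilde S E :=
  (fun p => direction (x.1 p.1.1) (x.1 p.1.2) (x.2.ne p.2),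
   fun t => ENNReal.ofReal (‖x.1 t.1.1 - x.1 t.1.2.1‖ / ‖x.1 t.1.1 - x.1 t.1.2.2‖))

/-- The map `α` from the configuration space of `M ⊆ E` to the ambient space. -/
def alpha (ε : M → E) (hε : Injective ε) (x : Conf S M) : A S M E :=
  (x.1, invariants ⟨ε ∘ x.1, hε.comp x.2⟩)

/-- The compactified configuration space `C_S[M]` of `M ⊆ E`. -/
def CompConf (S : Type*) [TopologicalSpace M] (ε : M → E) (hε : Injective ε) : Set (A S M E) :=
  closure (range (alpha (S := S) ε hε))

/-- Configurations of vectors agree up to a translation and a scaling by a positive factor. -/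
def simSetoid (S E : Type*) [NormedAddCommGroup E] [NormedSpace ℝ E] : Setoid (Conf S E) where
  r x y := ∃ t : ℝ, 0 < t ∧ ∃ b : E, ∀ i, y.1 i = t • x.1 i + b
  iseqv :=
    { refl := fun x => ⟨1, one_pos, 0, fun i => by simp⟩
      symm := by
        rintro x y ⟨t, ht, b, h⟩
        refine ⟨t⁻¹, inv_pos.2 ht, -(t⁻¹ • b), fun i => ?_⟩
        rw [h i, smul_add, smul_smul, inv_mul_cancel₀ ht.ne', one_smul]
        abel
      trans := by
        rintro x y z ⟨t, ht, b, h⟩ ⟨s, hs, c, h'⟩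
        refine ⟨s * t, mul_pos hs ht, s • b + c, fun i => ?_⟩
        rw [h' i, h i, smul_add, smul_smul]
        abel }

/-- Configurations of vectors modulo translations and positive scalings. -/
def ConfModSim (S E : Type*) [NormedAddCommGroup E] [NormedSpace ℝ E] : Type _ :=
  Quotient (simSetoid S E)

instance : TopologicalSpace (ConfModSim S E) :=
  inferInstanceAs (TopologicalSpace (Quotient (simSetoid S E)))

theorem sub_of_sim {x y : Conf S E} {t : ℝ} {b : E}
    (h : ∀ i, y.1 i = t • x.1 i + b) (i j : S) : y.1 i - y.1 j = t • (x.1 i - x.1 j) := by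
  rw [h i, h j, smul_sub]
  abel

theorem invariants_eq_of_sim {x y : Conf S E} (h : (simSetoid S E).r x y) :
    invariants x = invariants y := by
  obtain ⟨t, ht, b, h⟩ := h
  have key := sub_of_sim h
  refine Prod.ext (funext fun p => Subtype.ext ?_) (funext fun p => ?_)
  · simp only [invariants, direction]
    rw [key, norm_smul, smul_smul, Real.norm_of_nonneg ht.le]
    congr 1
    field_simp
  · simp only [invariants]
    rw [key, key, norm_smul, norm_smul, mul_div_mul_left]
    simpa using ht.ne'

/-- The map `ι` induced by directions and ratios of distances. -/
def iota : ConfModSim S E → Atilde S E :=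
  Quotient.lift invariants fun _ _ h => invariants_eq_of_sim h

/-- The compactification of the space of configurations of vectors modulo translations and positive
scalings. -/
def CompModSim (S E : Type*) [NormedAddCommGroup E] [NormedSpace ℝ E] : Set (Atilde S E) :=
  closure (range (iota (S := S) (E := E)))

/-- The representative of a configuration of vectors modulo translations and positive scalings
that has barycenter `0` and for which the sum of the squared norms is `1` (if `S` has at least two
elements). -/
def normalize [Finite S] (x : Conf S E) : S → E :=
  letI := Fintype.ofFinite S
  let c : E := (Fintype.card S : ℝ)⁻¹ • ∑ j, x.1 j
  fun i => (√(∑ j, ‖x.1 j - c‖ ^ 2))⁻¹ • (x.1 i - c)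

theorem normalize_eq_of_sim [Finite S] {x y : Conf S E} (h : (simSetoid S E).r x y) :
    normalize x = normalize y := by
  obtain ⟨t, ht, b, h⟩ := h
  let _ := Fintype.ofFinite S
  funext i
  have hS : (Fintype.card S : ℝ) ≠ 0 := by
    have : Nonempty S := ⟨i⟩
    exact_mod_cast Fintype.card_ne_zero
  have hc : (Fintype.card S : ℝ)⁻¹ • ∑ j, y.1 j
      = t • ((Fintype.card S : ℝ)⁻¹ • ∑ j, x.1 j) + b := by
    simp_rw [h, Finset.sum_add_distrib, ← Finset.smul_sum, Finset.sum_const, Finset.card_univ,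
      smul_add, ← Nat.cast_smul_eq_nsmul ℝ, smul_smul, inv_mul_cancel₀ hS, one_smul, mul_comm]
  have hd : ∀ j, y.1 j - (Fintype.card S : ℝ)⁻¹ • ∑ j, y.1 j
      = t • (x.1 j - (Fintype.card S : ℝ)⁻¹ • ∑ j, x.1 j) := by
    intro j
    rw [hc, h j, smul_sub]
    abel
  simp only [normalize]
  simp_rw [hd, norm_smul, mul_pow, ← Finset.mul_sum, Real.norm_of_nonneg ht.le]
  rw [Real.sqrt_mul (sq_nonneg t), Real.sqrt_sq ht.le, smul_smul, mul_inv]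
  congr 1
  field_simp

/-! ### Coordinates on these spaces -/

/-- Coordinates on the space of directions and ratios. -/
def coordsAtilde (S E : Type*) [Finite S] [NormedAddCommGroup E] [NormedSpace ℝ E] :
    LocalCoords (Atilde S E) :=
  (LocalCoords.pi fun _ => LocalCoords.sphere E).prod (LocalCoords.pi fun _ => LocalCoords.interval)

/-- Coordinates on the ambient space. -/
def coordsA (d : ℕ) (S M E : Type*) [Finite S] [TopologicalSpace M]
    [ChartedSpace (EuclideanSpace ℝ (Fin d)) M] [NormedAddCommGroup E] [NormedSpace ℝ E] :
    LocalCoords (A S M E) :=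
  (LocalCoords.pi fun _ => LocalCoords.ofCharts d M).prod (coordsAtilde S E)

/-- Coordinates on the quotient by translations and positive scalings: the smooth structure of
the space of normalized configurations. -/
def coordsConfModSim (S E : Type*) [Finite S] [NormedAddCommGroup E] [NormedSpace ℝ E] :
    LocalCoords (ConfModSim S E) :=
  letI := Fintype.ofFinite S
  LocalCoords.ofMap (V := S → E)
    (Quotient.lift normalize fun _ _ h => normalize_eq_of_sim h : ConfModSim S E → S → E)

end Config

/-! ## Action of linear isomorphisms on compactified configurations -/

section Action

variable {S E : Type*} [NormedAddCommGroup E] [NormedSpace ℝ E]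

/-- The action on directions and ratios of an injective linear map. -/
def actAtilde (g : E →L[ℝ] E) (hg : Injective g) (a : Atilde S E) : Atilde S E :=
  (fun p => ⟨‖g (a.1 p)‖⁻¹ • g (a.1 p), by
      have h1 : (a.1 p : E) ≠ 0 := ne_zero_of_mem_unit_sphere _
      have h2 : ‖g (a.1 p)‖ ≠ 0 := norm_ne_zero_iff.2 ((map_ne_zero_iff g hg).2 h1)
      simp [norm_smul, h2]⟩,
   fun t => a.2 t * ENNReal.ofReal (‖g (a.1 t.fst)‖ / ‖g (a.1 t.snd)‖))

theorem norm_apply_pos {g : E →L[ℝ] E} (hg : Injective g) (u : Metric.sphere (0 : E) 1) :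
    0 < ‖g u‖ :=
  norm_pos_iff.2 ((map_ne_zero_iff g hg).2 (ne_zero_of_mem_unit_sphere _))

/-- On an actual configuration the action is the one induced by applying `g` to every point. -/
theorem actAtilde_invariants (g : E →L[ℝ] E) (hg : Injective g) (x : Conf S E) :
    actAtilde g hg (invariants x) = invariants ⟨g ∘ x.1, hg.comp x.2⟩ := by
  refine Prod.ext (funext fun p => Subtype.ext ?_) (funext fun t => ?_)
  · have h1 : ‖x.1 p.1.1 - x.1 p.1.2‖ ≠ 0 :=
      norm_ne_zero_iff.2 (sub_ne_zero.2 (x.2.ne p.2))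
    simp only [actAtilde, invariants, direction, map_smul, norm_smul, norm_inv, norm_norm,
      smul_smul, comp_apply, ← map_sub]
    congr 1
    field_simp
  · have h1 : 0 < ‖x.1 t.1.1 - x.1 t.1.2.1‖ :=
      norm_pos_iff.2 (sub_ne_zero.2 (x.2.ne t.2.1))
    have h2 : 0 < ‖x.1 t.1.1 - x.1 t.1.2.2‖ :=
      norm_pos_iff.2 (sub_ne_zero.2 (x.2.ne t.2.2.1))
    simp only [actAtilde, invariants, direction, map_smul, norm_smul, norm_inv, norm_norm,
      comp_apply, ← map_sub, C₃.fst, C₃.snd]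
    rw [← ENNReal.ofReal_mul (by positivity)]
    congr 1
    field_simp

theorem continuousOn_actAtilde {B : Type*} [TopologicalSpace B] {s : Set B}
    {φ : B → E →L[ℝ] E} (hφ : ContinuousOn φ s) (hinj : ∀ b ∈ s, Injective (φ b))
    {f : B × Atilde S E → Atilde S E}
    (hf : ∀ b (hb : b ∈ s) a, f (b, a) = actAtilde (φ b) (hinj b hb) a) :
    ContinuousOn f (s ×ˢ univ) := by
  have hev : ∀ p : C₂ S, ContinuousOn
      (fun z : B × Atilde S E => φ z.1 (z.2.1 p : E)) (s ×ˢ univ) := by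
    intro p
    refine (hφ.comp continuousOn_fst fun z hz => hz.1).clm_apply ?_
    exact Continuous.continuousOn (by fun_prop)
  have hpos : ∀ p : C₂ S, ∀ z ∈ s ×ˢ (univ : Set (Atilde S E)), ‖φ z.1 (z.2.1 p : E)‖ ≠ 0 :=
    fun p z hz => (norm_apply_pos (hinj _ hz.1) _).ne'
  have hfst : ContinuousOn (fun z => (f z).1) (s ×ˢ univ) := by
    refine continuousOn_pi.2 fun p => ?_
    rw [Topology.IsInducing.subtypeVal.continuousOn_iff]
    refine (((hev p).norm.inv₀ (hpos p)).smul (hev p)).congr ?_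
    rintro ⟨b, a⟩ hz
    simp [hf b hz.1 a, actAtilde]
  have hsnd : ContinuousOn (fun z => (f z).2) (s ×ˢ univ) := by
    refine continuousOn_pi.2 fun t => ?_
    have h1 : ContinuousOn (fun z : B × Atilde S E =>
        ENNReal.ofReal (‖φ z.1 (z.2.1 t.fst : E)‖ / ‖φ z.1 (z.2.1 t.snd : E)‖)) (s ×ˢ univ) :=
      ENNReal.continuous_ofReal.comp_continuousOn
        ((hev _).norm.div (hev _).norm (hpos _))
    have h2 : ContinuousOn (fun z : B × Atilde S E => z.2.2 t) (s ×ˢ univ) :=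
      Continuous.continuousOn (by fun_prop)
    have h3 : ContinuousOn (fun z : B × Atilde S E => z.2.2 t *
        ENNReal.ofReal (‖φ z.1 (z.2.1 t.fst : E)‖ / ‖φ z.1 (z.2.1 t.snd : E)‖)) (s ×ˢ univ) := by
      intro z hz
      refine ENNReal.Tendsto.mul (h2 z hz) (Or.inr ENNReal.ofReal_ne_top) (h1 z hz) (Or.inl ?_)
      have := div_pos (norm_apply_pos (hinj _ hz.1) (z.2.1 t.fst))
        (norm_apply_pos (hinj _ hz.1) (z.2.1 t.snd))
      simpa using this
    refine h3.congr ?_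
    rintro ⟨b, a⟩ hz
    simp [hf b hz.1 a, actAtilde]
  exact hfst.prodMk hsnd

theorem continuous_actAtilde (g : E →L[ℝ] E) (hg : Injective g) :
    Continuous (actAtilde (S := S) g hg) := by
  have h := continuousOn_actAtilde (S := S) (B := Unit) (s := univ) (φ := fun _ => g)
    continuousOn_const (fun _ _ => hg) (f := fun z => actAtilde g hg z.2) (fun _ _ _ => rfl)
  rw [univ_prod_univ, continuousOn_univ] at h
  exact h.comp (Continuous.prodMk_right ())

theorem actAtilde_mem (g : E →L[ℝ] E) (hg : Injective g) {a : Atilde S E}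
    (ha : a ∈ CompModSim S E) : actAtilde g hg a ∈ CompModSim S E := by
  refine map_mem_closure (continuous_actAtilde g hg) ha ?_
  rintro _ ⟨q, rfl⟩
  induction q using Quotient.inductionOn with
  | h x => exact ⟨Quotient.mk _ ⟨g ∘ x.1, hg.comp x.2⟩, (actAtilde_invariants g hg x).symm⟩

theorem actAtilde_id (hg : Injective (ContinuousLinearMap.id ℝ E)) (a : Atilde S E) :
    actAtilde (ContinuousLinearMap.id ℝ E) hg a = a := by
  refine Prod.ext (funext fun p => Subtype.ext ?_) (funext fun t => ?_) <;> simp [actAtilde]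

theorem actAtilde_comp (g h : E →L[ℝ] E) (hg : Injective g) (hh : Injective h)
    (hgh : Injective (g.comp h)) (a : Atilde S E) :
    actAtilde g hg (actAtilde h hh a) = actAtilde (g.comp h) hgh a := by
  have hp := fun p => norm_apply_pos hh (a.1 p)
  have hq := fun p => norm_apply_pos hgh (a.1 p)
  simp only [ContinuousLinearMap.comp_apply] at hq
  refine Prod.ext (funext fun p => Subtype.ext ?_) (funext fun t => ?_)
  · have h1 := hp p
    simp only [actAtilde, map_smul, norm_smul, norm_inv, norm_norm, smul_smul,
      ContinuousLinearMap.comp_apply]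
    congr 1
    field_simp
  · have h1 := hp t.fst
    have h2 := hp t.snd
    have h3 := hq t.fst
    have h4 := hq t.snd
    simp only [actAtilde, map_smul, norm_smul, norm_inv, norm_norm,
      ContinuousLinearMap.comp_apply]
    rw [mul_assoc, ← ENNReal.ofReal_mul (by positivity)]
    congr 2
    field_simp

open Classical in
/-- The self-map of the compactification of the space of configurations modulo translations and
positive scalings induced by a linear isomorphism `g`: the unique continuous extension of
`[(x_i)] ↦ [(g x_i)]`. (For maps that are not injective it is the identity, by convention.) -/
def actComp (g : E →L[ℝ] E) (a : CompModSim S E) : CompModSim S E :=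
  if hg : Injective g then ⟨actAtilde g hg a.1, actAtilde_mem g hg a.2⟩ else a

theorem actComp_of_injective {g : E →L[ℝ] E} (hg : Injective g) (a : CompModSim S E) :
    (actComp g a).1 = actAtilde g hg a.1 := by
  simp [actComp, hg]

end Action

/-! ## The bundles of compactified infinitesimal configurations -/

section Bundle

variable (d : ℕ) (S M : Type*) [TopologicalSpace M] [ChartedSpace (EuclideanSpace ℝ (Fin d)) M]
  [IsManifold (𝓡 d) ∞ M]

theorem injective_tangentCoordChange (i j : atlas (EuclideanSpace ℝ (Fin d)) M) {x : M}
    (hx : x ∈ i.1.source ∩ j.1.source) :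
    Injective ((tangentBundleCore (𝓡 d) M).coordChange i j x) := by
  refine LeftInverse.injective (g := (tangentBundleCore (𝓡 d) M).coordChange j i x) fun v => ?_
  rw [(tangentBundleCore (𝓡 d) M).coordChange_comp i j i x ⟨hx, hx.1⟩,
    (tangentBundleCore (𝓡 d) M).coordChange_self i x hx.1]

/-- The fiber bundle over `M` with fiber the compactification of the space of configurations of
vectors of `ℝ^d` modulo translations and positive scalings, which has the same charts as the
tangent bundle and whose coordinate transformations are induced by those of the tangent bundle. -/
def infConfCore : FiberBundleCore (atlas (EuclideanSpace ℝ (Fin d)) M) M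
    (CompModSim S (EuclideanSpace ℝ (Fin d))) where
  baseSet i := i.1.source
  isOpen_baseSet i := i.1.open_source
  indexAt := achart _
  mem_baseSet_at := mem_chart_source _
  coordChange i j x := actComp ((tangentBundleCore (𝓡 d) M).coordChange i j x)
  coordChange_self i x hx a := by
    have h : (tangentBundleCore (𝓡 d) M).coordChange i i x = ContinuousLinearMap.id ℝ _ :=
      ContinuousLinearMap.ext fun v => (tangentBundleCore (𝓡 d) M).coordChange_self i x hx v
    rw [h]
    exact Subtype.ext ((actComp_of_injective injective_id a).trans (actAtilde_id _ _))
  continuousOn_coordChange i j := by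
    rw [Topology.IsInducing.subtypeVal.continuousOn_iff]
    have hφ := (tangentBundleCore (𝓡 d) M).continuousOn_coordChange i j
    classical
    have h := continuousOn_actAtilde (S := S) hφ
      (fun x hx => injective_tangentCoordChange d M i j hx)
      (f := fun z => if hz : z.1 ∈ i.1.source ∩ j.1.source then
        actAtilde _ (injective_tangentCoordChange d M i j hz) z.2 else z.2)
      (fun b hb a => dif_pos hb)
    have h' := h.comp (s := (i.1.source ∩ j.1.source) ×ˢ (univ : Set (CompModSim S _)))
      (f := fun z : M × CompModSim S (EuclideanSpace ℝ (Fin d)) => (z.1, z.2.1))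
      (Continuous.continuousOn (by fun_prop)) (fun z hz => ⟨hz.1, mem_univ _⟩)
    refine h'.congr ?_
    rintro ⟨x, a⟩ hx
    have hx' : x ∈ i.1.source ∩ j.1.source := hx.1
    simp only [comp_apply, dif_pos hx']
    exact actComp_of_injective _ a
  coordChange_comp i j k x hx a := by
    have hij := injective_tangentCoordChange d M i j (x := x) hx.1
    have hjk := injective_tangentCoordChange d M j k (x := x) ⟨hx.1.2, hx.2⟩
    have h : (tangentBundleCore (𝓡 d) M).coordChange i k x =
        ((tangentBundleCore (𝓡 d) M).coordChange j k x).comp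
          ((tangentBundleCore (𝓡 d) M).coordChange i j x) :=
      ContinuousLinearMap.ext fun v =>
        ((tangentBundleCore (𝓡 d) M).coordChange_comp i j k x hx v).symm
    rw [h]
    refine Subtype.ext ?_
    have hcomp : Injective (((tangentBundleCore (𝓡 d) M).coordChange j k x).comp
        ((tangentBundleCore (𝓡 d) M).coordChange i j x)) := by
      rw [ContinuousLinearMap.coe_comp]
      exact hjk.comp hij
    rw [actComp_of_injective hjk, actComp_of_injective hij, actComp_of_injective hcomp]
    exact actAtilde_comp _ _ hjk hij hcomp _

/-- The total space of the bundle of compactified infinitesimal configurations. -/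
abbrev InfConf : Type _ := (infConfCore d S M).TotalSpace

/-- Local coordinates on the total space: those of the local trivializations. -/
def coordsInfConf [Finite S] : LocalCoords (InfConf d S M) where
  Index := atlas (EuclideanSpace ℝ (Fin d)) M × (coordsAtilde S (EuclideanSpace ℝ (Fin d))).Index
  Model := EuclideanSpace ℝ (Fin d) × (coordsAtilde S (EuclideanSpace ℝ (Fin d))).Model
  dom i := {p | p.proj ∈ i.1.1.source ∧
    ((infConfCore d S M).localTriv i.1 p).2.1 ∈
      (coordsAtilde S (EuclideanSpace ℝ (Fin d))).dom i.2}
  coord i p := (i.1.1 p.proj, (coordsAtilde S (EuclideanSpace ℝ (Fin d))).coord i.2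
    ((infConfCore d S M).localTriv i.1 p).2.1)
  cover p := by
    obtain ⟨j, hj⟩ := (coordsAtilde S (EuclideanSpace ℝ (Fin d))).cover
      ((infConfCore d S M).localTriv (achart _ p.proj) p).2.1
    exact ⟨(achart _ p.proj, j), mem_chart_source _ p.proj, hj⟩

end Bundle

/-! ## Trees -/

/-- A rooted tree with vertex set `V`, without bivalent vertices except possibly the root, whose
leaves (the univalent vertices other than the root) are labelled bijectively by `Fin n`. -/
structure FTree (V : Type*) (n : ℕ) where
  graph : SimpleGraph V
  isTree : graph.IsTree
  root : V
  not_bivalent : ∀ v, v ≠ root → (graph.neighborSet v).ncard ≠ 2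
  leaf : Fin n ≃ {v : V // v ≠ root ∧ (graph.neighborSet v).ncard = 1}

namespace FTree

variable {V : Type*} {n : ℕ} (T : FTree V n)

/-- `w` lies over `v`: the vertex `v` is on the path from `w` to the root. -/
def Over (w v : V) : Prop := ∃ p : T.graph.Walk w T.root, p.IsPath ∧ v ∈ p.support

/-- Non-leaf vertices. -/
def IsNode (v : V) : Prop := ¬ (v ≠ T.root ∧ (T.graph.neighborSet v).ncard = 1)

/-- Internal vertices: neither a leaf nor the root. -/
def IsInternal (v : V) : Prop := T.IsNode v ∧ v ≠ T.root

/-- The edges with initial vertex `v`, each recorded by its terminal vertex. -/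
abbrev Out (v : V) := {w : V // T.graph.Adj v w ∧ T.Over w v}

/-- The internal vertices that lie over a root edge. -/
abbrev InternalOver (e : T.Out T.root) := {v : V // T.IsInternal v ∧ T.Over v e.1}

/-- The sets of labels of the leaves over the internal vertices. They determine the tree up to
isomorphism. -/
def leafSets : Set (Set (Fin n)) :=
  {A | ∃ v, T.IsInternal v ∧ A = {i | T.Over (T.leaf i).1 v}}

end FTree

/-- The nested family of subsets that is associated to an exclusion relation `R`, where `R i j k`
stands for `(i, j), k ∈ R`. -/
def parens {n : ℕ} (R : Fin n → Fin n → Fin n → Prop) : Set (Set (Fin n)) :=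
  {A | ∃ i k, (∃ j, R i j k) ∧ A = {j | j = i ∨ R i j k}}

/-- The exclusion relation of a family of ratios. -/
def excl {n : ℕ} (r : C₃ (Fin n) → ℝ≥0∞) (i j k : Fin n) : Prop :=
  ∃ h, r ⟨(i, j, k), h⟩ = 0

section Strata

variable {V : Type*} [Finite V] {n : ℕ} (T : FTree V n)

/-! ## Strata and their closures -/

/-- The stratum of `T`: the points whose associated tree is `T`. The tree associated to a point is
the one of its exclusion relation, with a new root added if (`n ≥ 2` and) all points coincide; adding
a new root means adding the set of all labels to the sets of labels of leaves over internal
vertices. -/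
def stratum {M E : Type*} [TopologicalSpace M] [NormedAddCommGroup E] [NormedSpace ℝ E]
    (ε : M → E) (hε : Injective ε) : Set (CompConf (Fin n) ε hε) :=
  {x | T.leafSets = parens (excl x.1.2.2) ∪
    {A | A = univ ∧ 2 ≤ n ∧ ∀ i j, x.1.1 i = x.1.1 j}}

/-- The closed stratum `C_T[M]`. -/
abbrev ClosedStratum {M E : Type*} [TopologicalSpace M] [NormedAddCommGroup E] [NormedSpace ℝ E]
    (ε : M → E) (hε : Injective ε) : Type _ :=
  {x : CompConf (Fin n) ε hε // x ∈ closure (stratum T ε hε)}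

/-- Coordinates on the closed stratum, as a subspace of the ambient space. -/
def coordsClosedStratum (d : ℕ) {M E : Type*} [TopologicalSpace M]
    [ChartedSpace (EuclideanSpace ℝ (Fin d)) M] [NormedAddCommGroup E] [NormedSpace ℝ E]
    (ε : M → E) (hε : Injective ε) : LocalCoords (ClosedStratum T ε hε) :=
  ((coordsA d (Fin n) M E).sub _).sub _

/-- The stratum of `T` in the compactification of the space of configurations of vectors modulo
translations and positive scalings: the points with the exclusion relation of `T`, whether or not
the root of `T` is univalent. -/
def simStratum (E : Type*) [NormedAddCommGroup E] [NormedSpace ℝ E] :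
    Set (CompModSim (Fin n) E) :=
  {y | T.leafSets \ {univ} = parens (excl y.1.2)}

/-- Coordinates on this stratum, as a subspace of the space of directions and ratios. -/
def coordsSimStratum (E : Type*) [NormedAddCommGroup E] [NormedSpace ℝ E] :
    LocalCoords (simStratum T E) :=
  ((coordsAtilde (Fin n) E).sub (· ∈ CompModSim (Fin n) E)).sub (· ∈ simStratum T E)

/-! ## The model for the closed stratum -/

section Model

variable (d : ℕ) (M : Type*) [TopologicalSpace M]
  [ChartedSpace (EuclideanSpace ℝ (Fin d)) M] [IsManifold (𝓡 d) ∞ M]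

/-- For a root edge `e`, the space `IC_e[M]` of a point of `M` with, for every internal vertex `v`
over `e`, a compactified infinitesimal configuration at that point, indexed by the edges with
initial vertex `v`. -/
abbrev InfConfEdge (e : T.Out T.root) : Type _ :=
  {p : M × (∀ v : T.InternalOver e, InfConf d (T.Out v.1) M) // ∀ v, (p.2 v).proj = p.1}

/-- The space `D_T[M]`: the pull-back of the product over the root edges `e` of the `IC_e[M]` along
the map from the compactified configuration space indexed by the root edges. -/
abbrev ModelStratum {M} [TopologicalSpace M]
    [ChartedSpace (EuclideanSpace ℝ (Fin d)) M] [IsManifold (𝓡 d) ∞ M]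
    {E : Type*} [NormedAddCommGroup E] [NormedSpace ℝ E]
    (ε : M → E) (hε : Injective ε) : Type _ :=
  {p : CompConf (T.Out T.root) ε hε × (∀ e : T.Out T.root, InfConfEdge T d M e) //
    ∀ e, p.1.1.1 e = (p.2 e).1.1}

/-- Coordinates on `IC_e[M]`. -/
def coordsInfConfEdge (e : T.Out T.root) : LocalCoords (InfConfEdge T d M e) :=
  ((LocalCoords.ofCharts d M).prod (LocalCoords.pi fun _ => coordsInfConf d _ M)).sub _

/-- Coordinates on `D_T[M]`. -/
def coordsModelStratum {M} [TopologicalSpace M]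
    [ChartedSpace (EuclideanSpace ℝ (Fin d)) M] [IsManifold (𝓡 d) ∞ M]
    {E : Type*} [NormedAddCommGroup E] [NormedSpace ℝ E]
    (ε : M → E) (hε : Injective ε) : LocalCoords (ModelStratum T d ε hε) :=
  (((coordsA d (T.Out T.root) M E).sub _).prod
    (LocalCoords.pi fun e => coordsInfConfEdge T d M e)).sub _

end Model

end Strata

end ConfSpace

end

/-!
The theorem rests on two mutually inverse operations. A point of the compactification assigns
directions to pairs and ratios of distances to triples of labels. *Restriction* (`resOut`) to one
leaf over each edge at a vertex `v` yields directions and ratios for the edges at `v`; *grafting*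
(`glue`) reads the direction of two leaves off at the vertex where their branches separate, and
compares two distances at that vertex, or declares the one that is separated at the higher vertex to
be infinitely smaller. Every component of `resOut` and `glue` is a component of the argument or
constant, so both are smooth. Restriction undoes grafting for all families (`resOut_glue`), and
grafting undoes restriction at the points of the compactification that satisfy the relations
`Nested` imposed by the tree (`glue_resOut`): near such a point, replacing a leaf by another one
over the same edge changes the difference vectors only by vectors of smaller order.

*Configurations modulo similarity.* A point of the stratum has no degenerate ratio at any vertex
(`resOut_ne_zero`), hence comes from a configuration at each vertex (`mem_range_iota`); conversely,
nondegenerate configurations are grafted to points with exactly the parentheses of the tree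
(`parens_excl_glue`). Such a point is a limit of configurations by *inflation*: the sum of the
vectors along the branch of a leaf, with the vectors at height `k` scaled by `t ^ k`, defines
configurations that converge to the grafted point as `t → 0` (`exists_tendsto_glue`). That the
directions and ratios `iota` form a diffeomorphism onto their image follows from the explicit
reconstruction of a configuration from them (`isSmooth_iota`, `isSmooth_confModSim`).

*The closed stratum.* In an embedded manifold `ε : M → E`, the derivative of `ε` embeds the bundle
of infinitesimal configurations into the product of `M` with the directions and ratios in `E`
(`ambient`, `isSmooth_infConf`); smoothness of the inverse comes from left inverses of the
derivative that depend smoothly on the point. Its image contains all limits of configurations whose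
points all converge to one point, because `ε` is strictly differentiable (`exists_ambient_eq`). In
the closed stratum, the relations `Nested` hold and the points over an internal vertex coincide,
since both are closed conditions satisfied in the stratum (`nested_of_mem_closure`,
`eq_of_mem_closure`). So restriction maps the closed stratum to the model. Conversely, a
nondegenerate point of the model is grafted to a point of the stratum, a limit of configurations
inflated in charts (`exists_mem_stratum`). Every point of the model is approximated by nondegenerate
ones: in trivializations of the bundles, the model is locally a product of closures. By continuity,
grafting maps the model to the closed stratum (`graft_mem_closure`).
-/

noncomputable section

namespace ConfSpace

/-! ### Combinatorics of rooted trees -/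

namespace FTree

variable {V : Type*} {n : ℕ} (T : FTree V n)

/-- The path from a vertex to the root. -/
def path (w : V) : T.graph.Walk w T.root := (T.isTree.existsUnique_path w T.root).choose

theorem isPath_path (w : V) : (T.path w).IsPath :=
  (T.isTree.existsUnique_path w T.root).choose_spec.1

theorem eq_path {w : V} {p : T.graph.Walk w T.root} (hp : p.IsPath) : p = T.path w :=
  (T.isTree.existsUnique_path w T.root).choose_spec.2 p hp

theorem over_iff {w v : V} : T.Over w v ↔ v ∈ (T.path w).support :=
  ⟨fun ⟨_, hp, hv⟩ => T.eq_path hp ▸ hv, fun h => ⟨_, T.isPath_path w, h⟩⟩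

/-- The height of a vertex above the root. -/
def depth (w : V) : ℕ := (T.path w).length

/-- A neighbour of `p` that is not below `p` is a child of `p`. -/
theorem path_of_adj {p w : V} (h : T.graph.Adj p w) (hpw : ¬ T.Over p w) :
    (∀ u, T.Over w u ↔ u = w ∨ T.Over p u) ∧ T.depth w = T.depth p + 1 := by
  have hp : (SimpleGraph.Walk.cons h.symm (T.path p)).IsPath := by
    rw [SimpleGraph.Walk.cons_isPath_iff]
    exact ⟨T.isPath_path p, fun h' => hpw (T.over_iff.2 h')⟩
  have e := T.eq_path hp
  refine ⟨fun u => ?_, ?_⟩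
  · rw [over_iff, over_iff, ← e, SimpleGraph.Walk.support_cons, List.mem_cons]
  · rw [depth, depth, ← e, SimpleGraph.Walk.length_cons]

theorem exists_parent {w : V} (hw : w ≠ T.root) : ∃ p, T.graph.Adj p w ∧ ¬ T.Over p w := by
  have hpath := T.isPath_path w
  rcases h : T.path w with _ | ⟨hadj, q⟩
  · exact absurd rfl hw
  · rw [h, SimpleGraph.Walk.cons_isPath_iff] at hpath
    refine ⟨_, hadj.symm, fun h' => hpath.2 ?_⟩
    rw [T.eq_path hpath.1]
    exact T.over_iff.1 h'

theorem over_root_iff {u : V} : T.Over T.root u ↔ u = T.root := by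
  have : (SimpleGraph.Walk.nil : T.graph.Walk T.root T.root) = T.path T.root :=
    T.eq_path SimpleGraph.Walk.IsPath.nil
  rw [over_iff, ← this]
  simp

/-- Induction along the paths that lead away from the root. -/
theorem parent_induction {P : V → Prop} (hroot : P T.root)
    (step : ∀ p w, (∀ u, T.Over w u ↔ u = w ∨ T.Over p u) → T.depth w = T.depth p + 1 →
      P p → P w) (w : V) : P w := by
  induction h : T.depth w using Nat.strong_induction_on generalizing w with
  | _ m ih =>
    by_cases hw : w = T.root
    · exact hw ▸ hroot
    · obtain ⟨p, hadj, hp⟩ := T.exists_parent hw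
      obtain ⟨h1, h2⟩ := T.path_of_adj hadj hp
      exact step p w h1 h2 (ih _ (by omega) p rfl)

theorem over_refl (w : V) : T.Over w w :=
  ⟨_, T.isPath_path w, SimpleGraph.Walk.start_mem_support _⟩

theorem over_root (w : V) : T.Over w T.root :=
  ⟨_, T.isPath_path w, SimpleGraph.Walk.end_mem_support _⟩

variable {T}

theorem Over.trans {w v u : V} (h : T.Over w v) (h' : T.Over v u) : T.Over w u := by
  induction w using T.parent_induction with
  | hroot => rw [T.over_root_iff] at h; exact h ▸ h'
  | step p w hw _ ih =>
    rcases (hw _).1 h with rfl | h1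
    · exact h'
    · exact (hw _).2 (Or.inr (ih h1))

theorem Over.depth_lt {w v : V} (h : T.Over w v) (hne : w ≠ v) : T.depth v < T.depth w := by
  induction w using T.parent_induction with
  | hroot => exact absurd (T.over_root_iff.1 h).symm hne
  | step p w hw hd ih =>
    rcases (hw _).1 h with rfl | h1
    · exact absurd rfl hne
    · by_cases hpv : p = v
      · subst hpv; omega
      · have := ih h1 hpv; omega

/-- The vertices below a given vertex are linearly ordered. -/
theorem Over.total {w v v' : V} (h : T.Over w v) (h' : T.Over w v') :
    T.Over v v' ∨ T.Over v' v := by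
  induction w using T.parent_induction with
  | hroot => rw [T.over_root_iff] at h h'; subst h h'; exact Or.inl (T.over_refl _)
  | step p w hw _ ih =>
    rcases (hw _).1 h with rfl | h1
    · exact Or.inl h'
    · rcases (hw _).1 h' with rfl | h2
      · exact Or.inr h
      · exact ih h1 h2

theorem Over.antisymm {w v : V} (h : T.Over w v) (h' : T.Over v w) : w = v := by
  by_contra hne
  exact lt_asymm (h.depth_lt hne) (h'.depth_lt (Ne.symm hne))

theorem Over.eq_of_depth_eq {w v v' : V} (h : T.Over w v) (h' : T.Over w v')
    (hd : T.depth v = T.depth v') : v = v' := by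
  by_contra hne
  rcases h.total h' with h1 | h1
  · exact absurd hd (h1.depth_lt hne).ne'
  · exact absurd hd (h1.depth_lt (Ne.symm hne)).ne

theorem Over.over_of_depth_le {w v v' : V} (h : T.Over w v) (h' : T.Over w v')
    (hd : T.depth v' ≤ T.depth v) : T.Over v v' := by
  rcases h.total h' with h1 | h1
  · exact h1
  · by_cases hne : v' = v
    · exact hne ▸ T.over_refl _
    · exact absurd (h1.depth_lt hne) hd.not_gt

variable (T) in
theorem out_iff {v c : V} : (T.graph.Adj v c ∧ T.Over c v) ↔ (T.graph.Adj v c ∧ ¬ T.Over v c) := by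
  refine ⟨fun h => ⟨h.1, fun h' => h.1.ne (h'.antisymm h.2)⟩, fun h => ⟨h.1, ?_⟩⟩
  exact ((T.path_of_adj h.1 h.2).1 v).2 (Or.inr (T.over_refl v))

theorem Out.depth {v : V} (c : T.Out v) : T.depth c.1 = T.depth v + 1 :=
  (T.path_of_adj c.2.1 (T.out_iff.1 c.2).2).2

theorem Out.ne_root {v : V} (c : T.Out v) : c.1 ≠ T.root := by
  intro h
  have := c.2.2
  rw [h, T.over_root_iff] at this
  exact c.2.1.ne (this.trans h.symm)

/-- If `w` lies strictly over `v`, it lies over an edge with initial vertex `v`. -/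
theorem Over.exists_out {w v : V} (h : T.Over w v) (hne : w ≠ v) :
    ∃ c : T.Out v, T.Over w c.1 := by
  induction hm : T.depth w using Nat.strong_induction_on generalizing w with
  | _ m ih =>
    have hw : w ≠ T.root := by
      rintro rfl
      exact hne (T.over_root_iff.1 h).symm
    obtain ⟨p, hadj, hp⟩ := T.exists_parent hw
    obtain ⟨h1, h2⟩ := T.path_of_adj hadj hp
    have hpv : T.Over p v := ((h1 v).1 h).resolve_left (Ne.symm hne)
    by_cases hpe : p = v
    · subst hpe
      exact ⟨⟨w, T.out_iff.2 ⟨hadj, hp⟩⟩, T.over_refl w⟩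
    · obtain ⟨c, hc⟩ := ih (T.depth p) (by omega) hpv hpe rfl
      exact ⟨c, (h1 _).2 (Or.inr hc)⟩

theorem Out.eq_of_over {v w : V} {c c' : T.Out v} (h : T.Over w c.1) (h' : T.Over w c'.1) :
    c = c' :=
  Subtype.ext (h.eq_of_depth_eq h' (c.depth.trans c'.depth.symm))

/-- The leaf labelled `i` lies over the edge `e`. -/
def LeafOver {v : V} (e : T.Out v) (i : Fin n) : Prop := T.Over (T.leaf i).1 e.1

theorem LeafOver.over {v : V} {e : T.Out v} {i : Fin n} (h : T.LeafOver e i) :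
    T.Over (T.leaf i).1 v := Over.trans h e.2.2

theorem LeafOver.unique {v : V} {e f : T.Out v} {i : Fin n} (h : T.LeafOver e i)
    (h' : T.LeafOver f i) : e = f := Out.eq_of_over h h'

/-- Nothing but a leaf itself lies over the leaf. -/
theorem isEmpty_out_leaf (i : Fin n) : IsEmpty (T.Out (T.leaf i).1) := by
  refine ⟨fun c => ?_⟩
  obtain ⟨hroot, hcard⟩ := (T.leaf i).2
  obtain ⟨p, hadj, hp⟩ := T.exists_parent hroot
  obtain ⟨u, hu⟩ := Set.ncard_eq_one.1 hcard
  have h1 : p = u := by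
    have : p ∈ T.graph.neighborSet (T.leaf i).1 := hadj.symm
    rw [hu] at this; exact this
  have h2 : c.1 = u := by
    have : c.1 ∈ T.graph.neighborSet (T.leaf i).1 := c.2.1
    rw [hu] at this; exact this
  have h3 := (T.path_of_adj hadj hp).2
  have h4 := c.depth
  rw [h2, ← h1] at h4
  omega

theorem eq_leaf_of_over {w : V} {i : Fin n} (h : T.Over w (T.leaf i).1) : w = (T.leaf i).1 := by
  by_contra hne
  obtain ⟨c, -⟩ := h.exists_out hne
  exact (isEmpty_out_leaf i).false c

variable (T) in
theorem isNode_or_leaf (v : V) : T.IsNode v ∨ ∃ i, v = (T.leaf i).1 := by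
  by_cases h : T.IsNode v
  · exact Or.inl h
  · refine Or.inr ⟨T.leaf.symm ⟨v, not_not.1 h⟩, by simp⟩

theorem isNode_of_out {v : V} (e : T.Out v) : T.IsNode v := by
  rcases T.isNode_or_leaf v with h | ⟨i, rfl⟩
  · exact h
  · exact ((isEmpty_out_leaf i).false e).elim

/-- Every internal vertex has two edges going out. -/
theorem IsInternal.exists_ne_out [Finite V] {v : V} (h : T.IsInternal v) :
    ∃ e f : T.Out v, e ≠ f := by
  obtain ⟨p, hadj, hp⟩ := T.exists_parent h.2
  have h2 := T.not_bivalent v h.2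
  have h1 : (T.graph.neighborSet v).ncard ≠ 1 := fun h1 => h.1 ⟨h.2, h1⟩
  have hmem : p ∈ T.graph.neighborSet v := hadj.symm
  have h0 : (T.graph.neighborSet v).ncard ≠ 0 :=
    Set.ncard_ne_zero_of_mem hmem (Set.toFinite _)
  have h3 : 1 < (T.graph.neighborSet v \ {p}).ncard := by
    rw [Set.ncard_sdiff_singleton_of_mem hmem]
    omega
  obtain ⟨a, ha, b, hb, hab⟩ := (Set.one_lt_ncard (Set.toFinite _)).1 h3
  have key : ∀ c ∈ T.graph.neighborSet v \ {p}, T.graph.Adj v c ∧ T.Over c v := by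
    intro c hc
    refine T.out_iff.2 ⟨hc.1, fun hvc => hc.2 ?_⟩
    have hne : v ≠ c := T.graph.ne_of_adj hc.1
    have h4 : T.Over p c := (((T.path_of_adj hadj hp).1 c).1 hvc).resolve_left hne.symm
    by_contra hcp
    have hd1 := h4.depth_lt (Ne.symm hcp)
    have hd2 := (T.path_of_adj hadj hp).2
    have hcv : ¬ T.Over c v := fun h' => hne (hvc.antisymm h')
    have := (T.path_of_adj (SimpleGraph.Adj.symm hc.1) hcv).2
    omega
  exact ⟨⟨a, key a ha⟩, ⟨b, key b hb⟩, fun h => hab (congrArg Subtype.val h)⟩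

theorem exists_leaf_over [Finite V] {v : V} (hv : v ≠ T.root) :
    ∃ i, T.Over (T.leaf i).1 v := by
  obtain ⟨w, hw, hmax⟩ := Set.exists_max_image {w | T.Over w v} T.depth (Set.toFinite _)
    ⟨v, T.over_refl v⟩
  have hwr : w ≠ T.root := by
    rintro rfl
    exact hv (T.over_root_iff.1 hw)
  rcases T.isNode_or_leaf w with h | ⟨i, rfl⟩
  · obtain ⟨e, -⟩ := IsInternal.exists_ne_out ⟨h, hwr⟩
    have := hmax e.1 (e.2.2.trans hw)
    have := e.depth
    omega
  · exact ⟨i, hw⟩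

/-- A leaf over a given edge. -/
def rep [Finite V] {v : V} (e : T.Out v) : Fin n := (exists_leaf_over e.ne_root).choose

theorem leafOver_rep [Finite V] {v : V} (e : T.Out v) : T.LeafOver e (rep e) :=
  (exists_leaf_over e.ne_root).choose_spec

theorem rep_injective [Finite V] {v : V} : Injective (rep : T.Out v → Fin n) := fun e f h =>
  (leafOver_rep e).unique (h ▸ leafOver_rep f)

/-- Below distinct leaves, there is a vertex at which their branches separate. -/
theorem exists_sep {i j : Fin n} (hij : i ≠ j) :
    ∃ (v : V) (e f : T.Out v), e ≠ f ∧ T.LeafOver e i ∧ T.LeafOver f j := by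
  have hne : (T.leaf i).1 ≠ (T.leaf j).1 := fun h =>
    hij (T.leaf.injective (Subtype.ext h))
  have hfin : {v | T.Over (T.leaf i).1 v}.Finite := by
    refine ((T.path (T.leaf i).1).support.finite_toSet).subset fun v hv => ?_
    exact T.over_iff.1 hv
  obtain ⟨v, ⟨hi, hj⟩, hmax⟩ := Set.exists_max_image
    {v | T.Over (T.leaf i).1 v ∧ T.Over (T.leaf j).1 v} T.depth
    (hfin.subset fun v hv => hv.1) ⟨T.root, T.over_root _, T.over_root _⟩
  have hvi : (T.leaf i).1 ≠ v := by
    rintro rfl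
    exact hne (eq_leaf_of_over hj).symm
  have hvj : (T.leaf j).1 ≠ v := by
    rintro rfl
    exact hne (eq_leaf_of_over hi)
  obtain ⟨e, he⟩ := hi.exists_out hvi
  obtain ⟨f, hf⟩ := hj.exists_out hvj
  refine ⟨v, e, f, ?_, he, hf⟩
  rintro rfl
  have := hmax e.1 ⟨he, hf⟩
  have := e.depth
  omega

/-- What lies over a vertex `v` lies over any edge lower than `v` that has a leaf over it which
also lies over `v`. -/
theorem LeafOver.over_of_depth_lt {v w : V} {e : T.Out w} {i : Fin n} (h : T.LeafOver e i)
    (hv : T.Over (T.leaf i).1 v) (hd : T.depth w < T.depth v) : T.Over v e.1 :=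
  hv.over_of_depth_le h (by rw [e.depth]; omega)

theorem LeafOver.of_depth_lt {v w : V} {e : T.Out w} {i j : Fin n} (h : T.LeafOver e i)
    (hv : T.Over (T.leaf i).1 v) (hd : T.depth w < T.depth v) (hj : T.Over (T.leaf j).1 v) :
    T.LeafOver e j := hj.trans (h.over_of_depth_lt hv hd)

/-- The vertex at which the branches of two leaves separate is unique. -/
theorem sep_unique {v w : V} {e f : T.Out v} {e' f' : T.Out w} {i j : Fin n} (hef : e ≠ f)
    (hef' : e' ≠ f') (hi : T.LeafOver e i) (hj : T.LeafOver f j) (hi' : T.LeafOver e' i)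
    (hj' : T.LeafOver f' j) : v = w := by
  rcases lt_trichotomy (T.depth v) (T.depth w) with h | h | h
  · exact absurd ((hi.of_depth_lt hi'.over h hj'.over).unique hj) hef
  · exact hi.over.eq_of_depth_eq hi'.over h
  · exact absurd ((hi'.of_depth_lt hi.over h hj.over).unique hj') hef'

theorem isInternal_of_out {v : V} (e : T.Out v) (hv : v ≠ T.root) : T.IsInternal v :=
  ⟨isNode_of_out e, hv⟩

theorem depth_root : T.depth T.root = 0 := by
  have : (SimpleGraph.Walk.nil : T.graph.Walk T.root T.root) = T.path T.root :=
    T.eq_path SimpleGraph.Walk.IsPath.nil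
  rw [depth, ← this]
  rfl

theorem depth_eq_zero {v : V} : T.depth v = 0 ↔ v = T.root := by
  refine ⟨fun h => ?_, fun h => h ▸ depth_root⟩
  by_contra hne
  have := (T.over_root v).depth_lt hne
  omega

theorem isInternal_of_depth {v w : V} (e : T.Out v) (h : T.depth w < T.depth v) :
    T.IsInternal v :=
  isInternal_of_out e fun hv => by rw [hv, depth_root] at h; omega

/-- The end of an edge that carries two leaves is an internal vertex. -/
theorem isInternal_of_leafOver {v : V} {e : T.Out v} {i j : Fin n} (hij : i ≠ j)
    (hi : T.LeafOver e i) (hj : T.LeafOver e j) : T.IsInternal e.1 := by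
  refine ⟨?_, e.ne_root⟩
  rcases T.isNode_or_leaf e.1 with h | ⟨k, hk⟩
  · exact h
  · rw [LeafOver, hk] at hi hj
    have h1 := eq_leaf_of_over hi
    have h2 := eq_leaf_of_over hj
    exact absurd (T.leaf.injective (Subtype.ext (h1.trans h2.symm))) hij

/-- Every leaf lies over a root edge. -/
theorem exists_rootEdge (i : Fin n) : ∃ e : T.Out T.root, T.LeafOver e i :=
  (T.over_root (T.leaf i).1).exists_out (T.leaf i).2.1

variable (T) in
/-- The root edge below a leaf. -/
def rootEdge (i : Fin n) : T.Out T.root := (exists_rootEdge i).choose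

theorem leafOver_rootEdge (i : Fin n) : T.LeafOver (T.rootEdge i) i :=
  (exists_rootEdge i).choose_spec

theorem LeafOver.eq_rootEdge {e : T.Out T.root} {i : Fin n} (h : T.LeafOver e i) :
    e = T.rootEdge i := h.unique (leafOver_rootEdge i)

theorem rootEdge_rep [Finite V] (e : T.Out T.root) : T.rootEdge (rep e) = e :=
  (leafOver_rep e).eq_rootEdge.symm

end FTree

/-! ### Calculus of smooth maps between spaces with local coordinates -/

/-- The map `F` is smooth on a neighbourhood of `x`. (For `n = ∞`, this is stronger than
`ContDiffAt` at `x`, where the neighbourhood may depend on the order of differentiability.) -/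
def SmoothNear {V W : Type*} [NormedAddCommGroup V] [NormedSpace ℝ V] [NormedAddCommGroup W]
    [NormedSpace ℝ W] (F : V → W) (x : V) : Prop :=
  ∀ᶠ y in 𝓝 x, ContDiffAt ℝ ∞ F y

section SmoothNear

variable {V W U : Type*} [NormedAddCommGroup V] [NormedSpace ℝ V] [NormedAddCommGroup W]
    [NormedSpace ℝ W] [NormedAddCommGroup U] [NormedSpace ℝ U]

theorem smoothNear_iff {F : V → W} {x : V} :
    SmoothNear F x ↔ ∃ N ∈ 𝓝 x, ContDiffOn ℝ ∞ F N := by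
  constructor
  · intro h
    exact ⟨_, h, fun y (hy : ContDiffAt ℝ ∞ F y) => hy.contDiffWithinAt⟩
  · rintro ⟨N, hN, h⟩
    filter_upwards [eventually_mem_nhds_iff.2 hN] with y hy
    exact h.contDiffAt hy

theorem SmoothNear.contDiffAt {F : V → W} {x : V} (h : SmoothNear F x) : ContDiffAt ℝ ∞ F x :=
  Filter.Eventually.self_of_nhds h

theorem SmoothNear.continuousAt {F : V → W} {x : V} (h : SmoothNear F x) : ContinuousAt F x :=
  h.contDiffAt.continuousAt

theorem SmoothNear.comp {G : W → U} {F : V → W} {x : V} (hG : SmoothNear G (F x))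
    (hF : SmoothNear F x) : SmoothNear (G ∘ F) x := by
  filter_upwards [hF, hF.continuousAt.eventually hG] with y h1 h2
  exact h2.comp y h1

theorem _root_.ContDiff.smoothNear {F : V → W} (h : ContDiff ℝ ∞ F) (x : V) : SmoothNear F x :=
  Filter.Eventually.of_forall fun _ => h.contDiffAt

theorem SmoothNear.prodMk {F : V → W} {G : V → U} {x : V} (hF : SmoothNear F x)
    (hG : SmoothNear G x) : SmoothNear (fun y => (F y, G y)) x := by
  filter_upwards [hF, hG] with y h1 h2
  exact h1.prodMk h2

theorem smoothNear_pi {ι : Type*} [Fintype ι] {W : ι → Type*} [∀ i, NormedAddCommGroup (W i)]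
    [∀ i, NormedSpace ℝ (W i)] {F : V → ∀ i, W i} {x : V}
    (h : ∀ i, SmoothNear (fun y => F y i) x) : SmoothNear F x := by
  filter_upwards [Filter.eventually_all.2 h] with y hy
  exact contDiffAt_pi.2 hy

theorem SmoothNear.smul {f : V → ℝ} {F : V → W} {x : V} (hf : SmoothNear f x)
    (hF : SmoothNear F x) : SmoothNear (fun y => f y • F y) x := by
  filter_upwards [hf, hF] with y h1 h2
  exact h1.smul h2

theorem SmoothNear.inv {f : V → ℝ} {x : V} (hf : SmoothNear f x) (h0 : f x ≠ 0) :
    SmoothNear (fun y => (f y)⁻¹) x := by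
  filter_upwards [hf, hf.continuousAt.eventually_ne h0] with y h1 h2
  exact h1.inv h2

theorem SmoothNear.norm {E : Type*} [NormedAddCommGroup E] [InnerProductSpace ℝ E] {F : V → E}
    {x : V} (hF : SmoothNear F x) (h0 : F x ≠ 0) : SmoothNear (fun y => ‖F y‖) x := by
  filter_upwards [hF, hF.continuousAt.eventually_ne h0] with y h1 h2
  exact h1.norm ℝ h2

theorem SmoothNear.add {F G : V → W} {x : V} (hF : SmoothNear F x)
    (hG : SmoothNear G x) : SmoothNear (fun y => F y + G y) x := by
  filter_upwards [hF, hG] with y h1 h2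
  exact h1.add h2

theorem SmoothNear.sub {F G : V → W} {x : V} (hF : SmoothNear F x)
    (hG : SmoothNear G x) : SmoothNear (fun y => F y - G y) x := by
  filter_upwards [hF, hG] with y h1 h2
  exact h1.sub h2

theorem SmoothNear.mul {F G : V → ℝ} {x : V} (hF : SmoothNear F x)
    (hG : SmoothNear G x) : SmoothNear (fun y => F y * G y) x := by
  filter_upwards [hF, hG] with y h1 h2
  exact h1.mul h2

theorem SmoothNear.clm_apply {F : V → W →L[ℝ] U} {G : V → W} {x : V} (hF : SmoothNear F x)
    (hG : SmoothNear G x) : SmoothNear (fun y => F y (G y)) x := by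
  filter_upwards [hF, hG] with y h1 h2
  exact h1.clm_apply h2

end SmoothNear

namespace LocalCoords

variable {X Y Z : Type*} [TopologicalSpace X] [TopologicalSpace Y] [TopologicalSpace Z]

theorem isSmooth_iff {a : LocalCoords X} {b : LocalCoords Y} {f : X → Y} :
    IsSmooth a b f ↔ Continuous f ∧ ∀ x : X, ∀ i, x ∈ a.dom i → ∀ j, f x ∈ b.dom j →
      ∃ F : a.Model → b.Model, SmoothNear F (a.coord i x) ∧
        ∀ᶠ x' in 𝓝 x, b.coord j (f x') = F (a.coord i x') := by
  simp only [IsSmooth, smoothNear_iff]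
  refine and_congr Iff.rfl (forall_congr' fun x => forall_congr' fun i => forall_congr' fun _ =>
    forall_congr' fun j => forall_congr' fun _ => ?_)
  constructor
  · rintro ⟨N, hN, F, hF, h⟩
    exact ⟨F, ⟨N, hN, hF⟩, h⟩
  · rintro ⟨F, ⟨N, hN, hF⟩, h⟩
    exact ⟨N, hN, F, hF, h⟩

theorem IsSmooth.continuous {a : LocalCoords X} {b : LocalCoords Y} {f : X → Y}
    (h : IsSmooth a b f) : Continuous f := h.1

theorem IsSmooth.exists_smoothNear {a : LocalCoords X} {b : LocalCoords Y} {f : X → Y}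
    (h : IsSmooth a b f) {x : X} {i : a.Index} (hi : x ∈ a.dom i) {j : b.Index}
    (hj : f x ∈ b.dom j) : ∃ F : a.Model → b.Model, SmoothNear F (a.coord i x) ∧
        ∀ᶠ x' in 𝓝 x, b.coord j (f x') = F (a.coord i x') :=
  (isSmooth_iff.1 h).2 x i hi j hj

theorem IsSmooth.comp {a : LocalCoords X} {b : LocalCoords Y} {c : LocalCoords Z} {g : Y → Z}
    {f : X → Y} (hg : IsSmooth b c g) (hf : IsSmooth a b f) : IsSmooth a c (g ∘ f) := by
  refine isSmooth_iff.2 ⟨hg.1.comp hf.1, fun x i hi k hk => ?_⟩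
  obtain ⟨j, hj⟩ := b.cover (f x)
  obtain ⟨F, hF, hF'⟩ := hf.exists_smoothNear hi hj
  obtain ⟨G, hG, hG'⟩ := hg.exists_smoothNear hj hk
  rw [hF'.self_of_nhds] at hG
  refine ⟨G ∘ F, hG.comp hF, ?_⟩
  filter_upwards [hF', hf.1.continuousAt.eventually hG'] with x' h1 h2
  rw [comp_apply, h2, h1, comp_apply]

theorem isSmooth_const (a : LocalCoords X) (b : LocalCoords Y) (y : Y) :
    IsSmooth a b fun _ => y :=
  isSmooth_iff.2 ⟨continuous_const, fun _ _ _ j _ =>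
    ⟨fun _ => b.coord j y, contDiff_const.smoothNear _, Filter.Eventually.of_forall fun _ => rfl⟩⟩

/-- The coordinate changes are smooth. -/
def Compat (a : LocalCoords X) : Prop := IsSmooth a a id

theorem isSmooth_prodMk {a : LocalCoords X} {b : LocalCoords Y} {c : LocalCoords Z} {f : X → Y}
    {g : X → Z} (hf : IsSmooth a b f) (hg : IsSmooth a c g) :
    IsSmooth a (b.prod c) fun x => (f x, g x) := by
  refine isSmooth_iff.2 ⟨hf.1.prodMk hg.1, fun x i hi j hj => ?_⟩
  obtain ⟨F, hF, hF'⟩ := hf.exists_smoothNear hi hj.1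
  obtain ⟨G, hG, hG'⟩ := hg.exists_smoothNear hi hj.2
  refine ⟨fun y => (F y, G y), hF.prodMk hG, ?_⟩
  filter_upwards [hF', hG'] with x' h1 h2
  exact Prod.ext h1 h2

theorem isSmooth_pi {S : Type*} [Finite S] {Y : S → Type*} [∀ s, TopologicalSpace (Y s)]
    {a : LocalCoords X} {b : ∀ s, LocalCoords (Y s)} {f : X → ∀ s, Y s}
    (h : ∀ s, IsSmooth a (b s) fun x => f x s) : IsSmooth a (pi b) f := by
  refine isSmooth_iff.2 ⟨continuous_pi fun s => (h s).1, fun x i hi j hj => ?_⟩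
  choose F hF hF' using fun s => (h s).exists_smoothNear hi (hj s)
  refine ⟨fun y s => F s y, ?_, ?_⟩
  · let _ := Fintype.ofFinite S
    exact smoothNear_pi hF
  · filter_upwards [Filter.eventually_all.2 hF'] with x' h'
    exact funext h'

theorem Compat.fst {a : LocalCoords X} (ha : Compat a) (b : LocalCoords Y) :
    IsSmooth (a.prod b) a Prod.fst := by
  refine isSmooth_iff.2 ⟨continuous_fst, fun x i hi j hj => ?_⟩
  obtain ⟨F, hF, hF'⟩ := IsSmooth.exists_smoothNear ha hi.1 hj
  refine ⟨F ∘ Prod.fst, SmoothNear.comp hF (contDiff_fst.smoothNear _), ?_⟩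
  exact continuous_fst.continuousAt.eventually hF'

theorem Compat.snd {b : LocalCoords Y} (hb : Compat b) (a : LocalCoords X) :
    IsSmooth (a.prod b) b Prod.snd := by
  refine isSmooth_iff.2 ⟨continuous_snd, fun x i hi j hj => ?_⟩
  obtain ⟨F, hF, hF'⟩ := IsSmooth.exists_smoothNear hb hi.2 hj
  refine ⟨F ∘ Prod.snd, SmoothNear.comp hF (contDiff_snd.smoothNear _), ?_⟩
  exact continuous_snd.continuousAt.eventually hF'

theorem Compat.eval {S : Type*} [Finite S] {Y : S → Type*} [∀ s, TopologicalSpace (Y s)]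
    (a : ∀ s, LocalCoords (Y s)) (s : S) (ha : Compat (a s)) :
    IsSmooth (pi a) (a s) fun x => x s := by
  refine isSmooth_iff.2 ⟨continuous_apply s, fun x i hi j hj => ?_⟩
  obtain ⟨F, hF, hF'⟩ := IsSmooth.exists_smoothNear ha (hi s) hj
  refine ⟨F ∘ fun y => y s, ?_, ?_⟩
  · let _ := Fintype.ofFinite S
    exact SmoothNear.comp (F := fun y : ∀ s, (a s).Model => y s) hF
      ((contDiff_pi.1 contDiff_id s).smoothNear _)
  · exact (continuous_apply s).continuousAt.eventually hF'

theorem Compat.val {a : LocalCoords X} (ha : Compat a) (p : X → Prop) :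
    IsSmooth (a.sub p) a Subtype.val := by
  refine isSmooth_iff.2 ⟨continuous_subtype_val, fun x i hi j hj => ?_⟩
  obtain ⟨F, hF, hF'⟩ := IsSmooth.exists_smoothNear ha (x := x.1) hi hj
  exact ⟨F, hF, continuous_subtype_val.continuousAt.eventually hF'⟩

theorem isSmooth_sub {a : LocalCoords X} {b : LocalCoords Y} {p : Y → Prop} {f : X → {y // p y}}
    (h : IsSmooth a b fun x => (f x).1) : IsSmooth a (b.sub p) f := by
  refine isSmooth_iff.2 ⟨continuous_induced_rng.2 h.1, fun x i hi j hj => ?_⟩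
  exact h.exists_smoothNear hi hj

theorem Compat.prod {a : LocalCoords X} {b : LocalCoords Y} (ha : Compat a) (hb : Compat b) :
    Compat (a.prod b) := isSmooth_prodMk (ha.fst b) (hb.snd a)

theorem Compat.pi {S : Type*} [Finite S] {Y : S → Type*} [∀ s, TopologicalSpace (Y s)]
    {a : ∀ s, LocalCoords (Y s)} (ha : ∀ s, Compat (a s)) : Compat (pi a) :=
  isSmooth_pi fun s => Compat.eval a s (ha s)

theorem Compat.sub {a : LocalCoords X} (ha : Compat a) (p : X → Prop) : Compat (a.sub p) :=
  isSmooth_sub (ha.val p)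

theorem compat_ofMap {V : Type*} [NormedAddCommGroup V] [NormedSpace ℝ V] (f : X → V) :
    Compat (ofMap f) :=
  isSmooth_iff.2 ⟨continuous_id, fun _ _ _ _ _ =>
    ⟨id, contDiff_id.smoothNear _, Filter.Eventually.of_forall fun _ => rfl⟩⟩

theorem smoothNear_chart_comp_symm {d : ℕ} {M : Type*} [TopologicalSpace M]
    [ChartedSpace (EuclideanSpace ℝ (Fin d)) M] [IsManifold (𝓡 d) ∞ M]
    {e e' : OpenPartialHomeomorph M (EuclideanSpace ℝ (Fin d))}
    (he : e ∈ IsManifold.maximalAtlas (𝓡 d) ∞ M) (he' : e' ∈ IsManifold.maximalAtlas (𝓡 d) ∞ M)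
    {x : M} (hx : x ∈ e.source) (hx' : x ∈ e'.source) : SmoothNear (e' ∘ e.symm) (e x) := by
  have h : ∀ᶠ y in 𝓝 (e x), e.symm y ∈ e'.source := by
    refine (e.continuousAt_symm (e.map_source hx)).eventually (e'.open_source.mem_nhds ?_)
    rwa [e.left_inv hx]
  filter_upwards [h, e.open_target.mem_nhds (e.map_source hx)] with y hy hy'
  rw [← contMDiffAt_iff_contDiffAt]
  exact ((contMDiffOn_of_mem_maximalAtlas he').contMDiffAt (e'.open_source.mem_nhds hy)).comp y
    ((contMDiffOn_symm_of_mem_maximalAtlas he).contMDiffAt (e.open_target.mem_nhds hy'))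

theorem compat_ofCharts (d : ℕ) (M : Type*) [TopologicalSpace M]
    [ChartedSpace (EuclideanSpace ℝ (Fin d)) M] [IsManifold (𝓡 d) ∞ M] :
    Compat (ofCharts d M) := by
  refine isSmooth_iff.2 ⟨continuous_id, fun x i hi j hj => ⟨j.1 ∘ i.1.symm, ?_, ?_⟩⟩
  · exact smoothNear_chart_comp_symm (IsManifold.subset_maximalAtlas i.2)
      (IsManifold.subset_maximalAtlas j.2) hi hj
  · filter_upwards [i.1.open_source.mem_nhds hi] with x' hx'
    exact congrArg j.1 (i.1.left_inv hx').symm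

theorem Diffeomorphic.of_maps {a : LocalCoords X} {b : LocalCoords Y} (f : X → Y) (g : Y → X)
    (hf : IsSmooth a b f) (hg : IsSmooth b a g) (hgf : ∀ x, g (f x) = x) (hfg : ∀ y, f (g y) = y) :
    Diffeomorphic a b :=
  ⟨⟨⟨f, g, hgf, hfg⟩, hf.1, hg.1⟩, hf, hg⟩

end LocalCoords

theorem compat_coordsAtilde (S E : Type*) [Finite S] [NormedAddCommGroup E] [NormedSpace ℝ E] :
    (coordsAtilde S E).Compat :=
  (LocalCoords.Compat.pi fun _ => LocalCoords.compat_ofMap _).prod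
    (LocalCoords.Compat.pi fun _ => LocalCoords.compat_ofMap _)

theorem compat_coordsA (d : ℕ) (S M E : Type*) [Finite S] [TopologicalSpace M]
    [ChartedSpace (EuclideanSpace ℝ (Fin d)) M] [IsManifold (𝓡 d) ∞ M] [NormedAddCommGroup E]
    [NormedSpace ℝ E] : (coordsA d S M E).Compat :=
  (LocalCoords.Compat.pi fun _ => LocalCoords.compat_ofCharts d M).prod (compat_coordsAtilde S E)

/-! ### Asymptotics of directions and ratios of distances -/

open Filter Asymptotics

section Asymptotics

variable {S S' E ι : Type*} [NormedAddCommGroup E] [NormedSpace ℝ E]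

theorem neBot_comap_val {X : Type*} {l : Filter X} [l.NeBot] {p : X → Prop}
    (h : ∀ᶠ x in l, p x) : (comap (Subtype.val : {x // p x} → X) l).NeBot := by
  rw [comap_neBot_iff_frequently]
  exact (h.mono fun x hx => ⟨⟨x, hx⟩, rfl⟩ : ∀ᶠ x in l, x ∈ range Subtype.val).frequently

theorem range_iota : range (iota (S := S) (E := E)) = range invariants := by
  ext a
  constructor
  · rintro ⟨q, rfl⟩
    induction q using Quotient.inductionOn with
    | h x => exact ⟨x, rfl⟩
  · rintro ⟨x, rfl⟩
    exact ⟨(Quotient.mk _ x : ConfModSim S E), rfl⟩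

theorem invariants_mem (x : Conf S E) : invariants x ∈ CompModSim S E :=
  subset_closure ⟨(Quotient.mk _ x : ConfModSim S E), rfl⟩

/-- The points of the compactification are limits of invariants of configurations. -/
theorem exists_tendsto_of_mem {a : Atilde S E} (ha : a ∈ CompModSim S E) :
    ∃ l : Filter (Conf S E), l.NeBot ∧ Tendsto invariants l (𝓝 a) := by
  refine ⟨comap invariants (𝓝 a), ?_, tendsto_comap⟩
  rw [comap_neBot_iff_frequently, ← mem_closure_iff_frequently]
  rw [CompModSim, range_iota] at ha
  exact ha

omit [NormedSpace ℝ E] in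
theorem tendsto_atilde_iff {l : Filter ι} {f : ι → Atilde S E} {a : Atilde S E} :
    Tendsto f l (𝓝 a) ↔ (∀ p, Tendsto (fun t => (f t).1 p) l (𝓝 (a.1 p))) ∧
      ∀ q, Tendsto (fun t => (f t).2 q) l (𝓝 (a.2 q)) := by
  rw [nhds_prod_eq, tendsto_prod_iff', tendsto_pi_nhds, tendsto_pi_nhds]

omit [NormedSpace ℝ E] in
theorem sub_ne_zero_of_conf (x : Conf S E) {i j : S} (h : i ≠ j) : x.1 i - x.1 j ≠ 0 :=
  sub_ne_zero.2 (x.2.ne h)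

omit [NormedSpace ℝ E] in
theorem norm_sub_pos_of_conf (x : Conf S E) {i j : S} (h : i ≠ j) : 0 < ‖x.1 i - x.1 j‖ :=
  norm_pos_iff.2 (sub_ne_zero_of_conf x h)

theorem tendsto_ofReal_zero_iff {l : Filter ι} {r : ι → ℝ} (hr : ∀ t, 0 ≤ r t) :
    Tendsto (fun t => ENNReal.ofReal (r t)) l (𝓝 0) ↔ Tendsto r l (𝓝 0) := by
  constructor
  · intro h
    have := (ENNReal.tendsto_toReal ENNReal.zero_ne_top).comp h
    simpa [Function.comp_def, ENNReal.toReal_ofReal (hr _)] using this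
  · intro h
    simpa using ENNReal.tendsto_ofReal h

/-- A ratio of distances tends to zero iff the numerator is negligible. -/
theorem tendsto_ratio_zero_iff {l : Filter ι} {X : ι → Conf S E} (q : C₃ S) :
    Tendsto (fun t => (invariants (X t)).2 q) l (𝓝 0) ↔
      (fun t => (X t).1 q.1.1 - (X t).1 q.1.2.1) =o[l]
        fun t => (X t).1 q.1.1 - (X t).1 q.1.2.2 := by
  have h1 := tendsto_ofReal_zero_iff (l := l) (r := fun t =>
    ‖(X t).1 q.1.1 - (X t).1 q.1.2.1‖ / ‖(X t).1 q.1.1 - (X t).1 q.1.2.2‖)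
    fun t => by positivity
  refine h1.trans ?_
  rw [← isLittleO_norm_norm, isLittleO_iff_tendsto]
  intro t ht
  exact absurd ht (norm_sub_pos_of_conf _ q.2.2.1).ne'

theorem ratio_swap {a : Atilde S E} (ha : a ∈ CompModSim S E) {i j k : S}
    (h : i ≠ j ∧ i ≠ k ∧ j ≠ k) :
    a.2 ⟨(i, k, j), h.2.1, h.1, h.2.2.symm⟩ = (a.2 ⟨(i, j, k), h⟩)⁻¹ := by
  obtain ⟨l, hl, hla⟩ := exists_tendsto_of_mem ha
  have h1 := (tendsto_atilde_iff.1 hla).2 ⟨(i, k, j), h.2.1, h.1, h.2.2.symm⟩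
  have h2 := ((tendsto_atilde_iff.1 hla).2 ⟨(i, j, k), h⟩).inv
  refine tendsto_nhds_unique h1 (h2.congr fun x => ?_)
  simp only [invariants]
  rw [← ENNReal.ofReal_inv_of_pos, inv_div]
  exact div_pos (norm_sub_pos_of_conf x h.1) (norm_sub_pos_of_conf x h.2.1)

omit [NormedSpace ℝ E] in
theorem tendsto_norm_div_of_isLittleO {l : Filter ι} {u v : ι → E} (hv : ∀ t, v t ≠ 0)
    (h : (fun t => u t - v t) =o[l] v) : Tendsto (fun t => ‖u t‖ / ‖v t‖) l (𝓝 1) := by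
  have h0 : Tendsto (fun t => ‖u t - v t‖ / ‖v t‖) l (𝓝 0) :=
    (isLittleO_norm_norm.2 h).tendsto_div_nhds_zero
  rw [tendsto_iff_norm_sub_tendsto_zero]
  refine squeeze_zero (fun t => norm_nonneg _) (fun t => ?_) h0
  have hp := norm_pos_iff.2 (hv t)
  rw [Real.norm_eq_abs, div_sub_one hp.ne', abs_div, abs_norm]
  gcongr
  exact abs_norm_sub_norm_le _ _

theorem norm_inv_norm_smul_sub_le {u v : E} (hu : u ≠ 0) (hv : v ≠ 0) :
    ‖‖u‖⁻¹ • u - ‖v‖⁻¹ • v‖ ≤ 2 * (‖u - v‖ / ‖v‖) := by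
  have hu' := norm_pos_iff.2 hu
  have hv' := norm_pos_iff.2 hv
  have e : ‖u‖⁻¹ • u - ‖v‖⁻¹ • v = ‖v‖⁻¹ • (u - v) + (‖u‖⁻¹ - ‖v‖⁻¹) • u := by
    rw [smul_sub, sub_smul]; abel
  have h2 : ‖(‖u‖⁻¹ - ‖v‖⁻¹) • u‖ ≤ ‖u - v‖ / ‖v‖ := by
    have e2 : (‖u‖⁻¹ - ‖v‖⁻¹) = (‖v‖ - ‖u‖) / (‖u‖ * ‖v‖) := by field_simp
    rw [norm_smul, e2, norm_div, norm_mul, norm_norm, norm_norm, Real.norm_eq_abs]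
    rw [div_mul_eq_mul_div, mul_comm, mul_div_mul_left _ _ hu'.ne']
    gcongr
    rw [abs_sub_comm]
    exact abs_norm_sub_norm_le _ _
  rw [e]
  refine (norm_add_le _ _).trans ?_
  rw [norm_smul, norm_inv, norm_norm, inv_mul_eq_div]
  linarith

/-- The limit of a direction does not change if the vectors change by something negligible. -/
theorem tendsto_direction_of_isLittleO {l : Filter ι} {X : ι → Conf S E} {Y : ι → Conf S' E}
    (p : C₂ S) (q : C₂ S')
    (h : (fun t => ((X t).1 p.1.1 - (X t).1 p.1.2) - ((Y t).1 q.1.1 - (Y t).1 q.1.2)) =o[l]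
      fun t => (Y t).1 q.1.1 - (Y t).1 q.1.2) {u : Metric.sphere (0 : E) 1}
    (hu : Tendsto (fun t => (invariants (Y t)).1 q) l (𝓝 u)) :
    Tendsto (fun t => (invariants (X t)).1 p) l (𝓝 u) := by
  rw [tendsto_subtype_rng] at hu ⊢
  have h0 : Tendsto (fun t => ‖((X t).1 p.1.1 - (X t).1 p.1.2) - ((Y t).1 q.1.1 - (Y t).1 q.1.2)‖ /
      ‖(Y t).1 q.1.1 - (Y t).1 q.1.2‖) l (𝓝 0) :=
    (isLittleO_norm_norm.2 h).tendsto_div_nhds_zero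
  have h1 : Tendsto (fun t => ((invariants (X t)).1 p : E) - ((invariants (Y t)).1 q : E)) l
      (𝓝 0) := by
    refine squeeze_zero_norm (fun t => ?_) (by simpa using h0.const_mul 2)
    exact norm_inv_norm_smul_sub_le (sub_ne_zero_of_conf _ p.2) (sub_ne_zero_of_conf _ q.2)
  simpa using h1.add hu

/-- The limit of a ratio of distances does not change if the vectors change by something
negligible. -/
theorem tendsto_ratio_of_isLittleO {l : Filter ι} {X : ι → Conf S E} {Y : ι → Conf S' E}
    (p : C₃ S) (q : C₃ S')
    (h : (fun t => ((X t).1 p.1.1 - (X t).1 p.1.2.1) - ((Y t).1 q.1.1 - (Y t).1 q.1.2.1)) =o[l]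
      fun t => (Y t).1 q.1.1 - (Y t).1 q.1.2.1)
    (h' : (fun t => ((X t).1 p.1.1 - (X t).1 p.1.2.2) - ((Y t).1 q.1.1 - (Y t).1 q.1.2.2)) =o[l]
      fun t => (Y t).1 q.1.1 - (Y t).1 q.1.2.2) {r : ℝ≥0∞}
    (hr : Tendsto (fun t => (invariants (Y t)).2 q) l (𝓝 r)) :
    Tendsto (fun t => (invariants (X t)).2 p) l (𝓝 r) := by
  have h1 := tendsto_norm_div_of_isLittleO (fun t => sub_ne_zero_of_conf (Y t) q.2.1) h
  have h2 := tendsto_norm_div_of_isLittleO (fun t => sub_ne_zero_of_conf (Y t) q.2.2.1) h'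
  have h3 := ENNReal.tendsto_ofReal (h1.div h2 one_ne_zero)
  rw [div_one, ENNReal.ofReal_one] at h3
  have h4 := ENNReal.Tendsto.mul hr (Or.inr ENNReal.one_ne_top) h3 (Or.inl one_ne_zero)
  rw [mul_one] at h4
  refine h4.congr fun t => ?_
  have p1 := norm_sub_pos_of_conf (Y t) q.2.1
  have p2 := norm_sub_pos_of_conf (Y t) q.2.2.1
  have p3 := norm_sub_pos_of_conf (X t) p.2.1
  have p4 := norm_sub_pos_of_conf (X t) p.2.2.1
  simp only [invariants, Pi.div_apply]
  rw [← ENNReal.ofReal_mul (by positivity)]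
  congr 1
  field_simp

/-- If `i` and `j` are close to each other compared to the distance from `i` to `k`, the distances
from `k` have ratio one. -/
theorem ratio_eq_one {a : Atilde S E} (ha : a ∈ CompModSim S E) {i j k : S}
    (h : i ≠ j ∧ i ≠ k ∧ j ≠ k) (h0 : a.2 ⟨(k, j, i), h.2.2.symm, h.2.1.symm, h.1.symm⟩ = 0) :
    a.2 ⟨(i, j, k), h⟩ = 1 := by
  obtain ⟨l, hl, hla⟩ := exists_tendsto_of_mem ha
  have h1 := (tendsto_atilde_iff.1 hla).2 ⟨(i, j, k), h⟩
  have h2 := (tendsto_atilde_iff.1 hla).2 ⟨(k, j, i), h.2.2.symm, h.2.1.symm, h.1.symm⟩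
  rw [h0, tendsto_ratio_zero_iff (X := fun x => x)] at h2
  have h3 : (fun x : Conf S E => (x.1 i - x.1 j) - (x.1 i - x.1 k)) =o[l]
      fun x => x.1 i - x.1 k := by
    refine ((isLittleO_neg_right.2 h2)).congr (fun x => ?_) fun x => ?_
    · dsimp only; abel
    · dsimp only; abel
  have h4 := ENNReal.tendsto_ofReal
    (tendsto_norm_div_of_isLittleO (fun x => sub_ne_zero_of_conf x h.2.1) h3)
  rw [ENNReal.ofReal_one] at h4
  exact tendsto_nhds_unique h1 h4

/-- If `i` and `j` are close to `i₀` compared to the distance from `i₀` to `k₀`, and `k` is not,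
then `i` is close to `j` compared to the distance from `i` to `k`. -/
theorem ratio_eq_zero_of_excl {n : ℕ} {a : Atilde (Fin n) E} (ha : a ∈ CompModSim (Fin n) E)
    {i₀ k₀ i j k : Fin n} (hik₀ : i₀ ≠ k₀) (hi : i = i₀ ∨ excl a.2 i₀ i k₀)
    (hj : j = i₀ ∨ excl a.2 i₀ j k₀)
    (hk : ¬ (k = i₀ ∨ excl a.2 i₀ k k₀)) (h : i ≠ j ∧ i ≠ k ∧ j ≠ k) :
    a.2 ⟨(i, j, k), h⟩ = 0 := by
  obtain ⟨l, hl, hla⟩ := exists_tendsto_of_mem ha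
  have key : ∀ {m}, m = i₀ ∨ excl a.2 i₀ m k₀ →
      (fun x : Conf (Fin n) E => x.1 i₀ - x.1 m) =o[l] fun x => x.1 i₀ - x.1 k₀ := by
    rintro m (rfl | ⟨hm, hm0⟩)
    · simp
    · have := (tendsto_atilde_iff.1 hla).2 ⟨(i₀, m, k₀), hm⟩
      rw [hm0] at this
      exact (tendsto_ratio_zero_iff (X := fun x => x) _).1 this
  have hO : (fun x : Conf (Fin n) E => x.1 i₀ - x.1 k₀) =O[l] fun x => x.1 i₀ - x.1 k := by
    by_cases hkk : k = k₀
    · rw [hkk]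
    have hki : i₀ ≠ k := fun e => hk (Or.inl e.symm)
    have hd : i₀ ≠ k ∧ i₀ ≠ k₀ ∧ k ≠ k₀ := ⟨hki, hik₀, hkk⟩
    have h0 : a.2 ⟨(i₀, k, k₀), hd⟩ ≠ 0 := fun h0 => hk (Or.inr ⟨hd, h0⟩)
    have h1 := ratio_swap ha hd
    have h2 : a.2 ⟨(i₀, k₀, k), hd.2.1, hd.1, hd.2.2.symm⟩ ≠ ⊤ := by
      rw [h1]; exact ENNReal.inv_ne_top.2 h0
    have h3 := (tendsto_atilde_iff.1 hla).2 ⟨(i₀, k₀, k), hd.2.1, hd.1, hd.2.2.symm⟩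
    have h4 := (ENNReal.tendsto_toReal h2).comp h3
    rw [← isBigO_norm_norm]
    refine isBigO_of_div_tendsto_nhds ?_ _ (h4.congr fun x => ?_)
    · exact Eventually.of_forall fun x hx => absurd hx (norm_sub_pos_of_conf x hki).ne'
    · simp only [comp_apply, invariants, Pi.div_apply]
      rw [ENNReal.toReal_ofReal (by positivity)]
  have hi' := (key hi).trans_isBigO hO
  have hj' := (key hj).trans_isBigO hO
  have h1 : (fun x : Conf (Fin n) E => x.1 i - x.1 j) =o[l] fun x => x.1 i₀ - x.1 k :=
    (hj'.sub hi').congr_left fun x => by abel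
  have h2 : (fun x : Conf (Fin n) E => x.1 i₀ - x.1 k) =O[l] fun x => x.1 i - x.1 k := by
    have := hi'.right_isBigO_sub
    exact this.congr_right fun x => by abel
  have h3 := (tendsto_ratio_zero_iff (X := fun x => x) ⟨(i, j, k), h⟩).2 (h1.trans_isBigO h2)
  exact tendsto_nhds_unique ((tendsto_atilde_iff.1 hla).2 _) h3

/-- The invariants depend continuously on the configuration. -/
theorem continuous_invariants : Continuous (invariants : Conf S E → Atilde S E) := by
  have hc : ∀ i : S, Continuous fun x : Conf S E => x.1 i := fun i =>
    (continuous_apply i).comp continuous_subtype_val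
  refine (continuous_pi fun p => ?_).prodMk (continuous_pi fun q => ?_)
  · refine continuous_induced_rng.2 ?_
    exact ((((hc _).sub (hc _)).norm).inv₀ fun x => (norm_sub_pos_of_conf x p.2).ne').smul
      ((hc _).sub (hc _))
  · exact ENNReal.continuous_ofReal.comp ((((hc _).sub (hc _)).norm).div (((hc _).sub (hc _)).norm)
      fun x => (norm_sub_pos_of_conf x q.2.2.1).ne')

open Classical in
/-- The configuration with given invariants that has its point `i₀` at the origin, at distance one
from its point `i₁`. -/
def reconstruct (i₀ i₁ : S) (a : Atilde S E) (j : S) : E :=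
  if h₀ : i₀ = j then 0 else
    if h₁ : j = i₁ then -(a.1 ⟨(i₀, j), h₀⟩ : E) else
      if h₂ : i₀ = i₁ then 0 else
        -((a.2 ⟨(i₀, j, i₁), h₀, h₂, h₁⟩).toReal • (a.1 ⟨(i₀, j), h₀⟩ : E))

theorem reconstruct_invariants {i₀ i₁ : S} (h : i₀ ≠ i₁) (x : Conf S E) (j : S) :
    reconstruct i₀ i₁ (invariants x) j = ‖x.1 i₀ - x.1 i₁‖⁻¹ • (x.1 j - x.1 i₀) := by
  by_cases h₀ : i₀ = j
  · subst h₀; simp [reconstruct]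
  have p₀ := norm_sub_pos_of_conf x h₀
  have p₁ := norm_sub_pos_of_conf x h
  by_cases h₁ : j = i₁
  · subst h₁
    simp only [reconstruct, dif_neg h₀, dif_pos, invariants, direction]
    rw [← smul_neg, neg_sub]
  · simp only [reconstruct, dif_neg h₀, dif_neg h₁, dif_neg h, invariants, direction]
    rw [ENNReal.toReal_ofReal (by positivity), smul_smul, ← smul_neg, neg_sub]
    congr 1
    field_simp

/-- A point of the compactification at which no ratio of distances degenerates comes from a
configuration. -/
theorem reconstruct_spec {a : Atilde S E} (ha : a ∈ CompModSim S E) (h : ∀ t, a.2 t ≠ 0)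
    {i₀ i₁ : S} (h01 : i₀ ≠ i₁) :
    ∃ hx : Injective (reconstruct i₀ i₁ a), invariants ⟨reconstruct i₀ i₁ a, hx⟩ = a := by
  have htop : ∀ t, a.2 t ≠ ⊤ := by
    rintro ⟨⟨i, j, k⟩, ht⟩ h1
    have := ratio_swap ha ht
    dsimp only at ht
    rw [h1, ENNReal.inv_top] at this
    exact h _ this
  obtain ⟨l, hl, hla⟩ := exists_tendsto_of_mem ha
  have hlim := tendsto_atilde_iff.1 hla
  have hy : ∀ j, Tendsto (fun x : Conf S E => reconstruct i₀ i₁ (invariants x) j) l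
      (𝓝 (reconstruct i₀ i₁ a j)) := by
    intro j
    by_cases h₀ : i₀ = j
    · simp only [reconstruct, dif_pos h₀]; exact tendsto_const_nhds
    have hu := (continuous_subtype_val.tendsto _).comp (hlim.1 ⟨(i₀, j), h₀⟩)
    by_cases h₁ : j = i₁
    · simp only [reconstruct, dif_neg h₀, dif_pos h₁]; exact hu.neg
    · simp only [reconstruct, dif_neg h₀, dif_neg h₁, dif_neg h01]
      exact (((ENNReal.tendsto_toReal (htop _)).comp (hlim.2 ⟨(i₀, j, i₁), h₀, h01, h₁⟩)).smul
        hu).neg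
  -- Distances to `i₀` have a positive limit.
  have hpos₀ : ∀ j, i₀ ≠ j → reconstruct i₀ i₁ a j ≠ 0 := by
    intro j h₀
    have hu : (a.1 ⟨(i₀, j), h₀⟩ : E) ≠ 0 := ne_zero_of_mem_unit_sphere _
    by_cases h₁ : j = i₁
    · simp only [reconstruct, dif_neg h₀, dif_pos h₁]; exact neg_ne_zero.2 hu
    · simp only [reconstruct, dif_neg h₀, dif_neg h₁, dif_neg h01]
      exact neg_ne_zero.2 (smul_ne_zero (ENNReal.toReal_ne_zero.2 ⟨h _, htop _⟩) hu)
  have hbase : reconstruct i₀ i₁ a i₀ = 0 := by simp [reconstruct]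
  have hinj : Injective (reconstruct i₀ i₁ a) := by
    intro j k hjk
    by_contra hne
    by_cases hj : i₀ = j
    · subst hj
      exact hpos₀ k hne (by rw [← hjk, hbase])
    by_cases hk : i₀ = k
    · subst hk
      exact hpos₀ j hj (by rw [hjk, hbase])
    have ht : j ≠ k ∧ j ≠ i₀ ∧ k ≠ i₀ := ⟨hne, Ne.symm hj, Ne.symm hk⟩
    have l1 := (ENNReal.tendsto_toReal (htop ⟨(j, k, i₀), ht⟩)).comp (hlim.2 ⟨(j, k, i₀), ht⟩)
    have l2 := l1.mul (hy j).norm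
    have l3 := ((hy j).sub (hy k)).norm
    rw [hjk, sub_self, norm_zero] at l3
    refine absurd (tendsto_nhds_unique (l2.congr fun x => ?_) l3)
      (mul_ne_zero (ENNReal.toReal_ne_zero.2 ⟨h _, htop _⟩) (norm_ne_zero_iff.2 (hpos₀ j hj)))
    have p₀ := norm_sub_pos_of_conf x ht.2.1
    have p₁ := norm_sub_pos_of_conf x h01
    rw [reconstruct_invariants h01, reconstruct_invariants h01, ← smul_sub,
      sub_sub_sub_cancel_right, norm_smul, norm_smul, norm_inv, norm_norm]
    simp only [comp_apply, invariants]
    rw [ENNReal.toReal_ofReal (by positivity)]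
    field_simp
  refine ⟨hinj, ?_⟩
  have hY : ∀ x : Conf S E, Injective (reconstruct i₀ i₁ (invariants x)) := by
    intro x j k hjk
    have p₁ := norm_sub_pos_of_conf x h01
    rw [reconstruct_invariants h01, reconstruct_invariants h01] at hjk
    have := smul_right_injective E (inv_pos.2 p₁).ne' hjk
    exact x.2 (sub_left_injective this)
  have hlim2 : Tendsto (fun x : Conf S E =>
      (⟨reconstruct i₀ i₁ (invariants x), hY x⟩ : Conf S E)) l (𝓝 ⟨_, hinj⟩) := by
    rw [tendsto_subtype_rng]
    exact tendsto_pi_nhds.2 hy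
  refine tendsto_nhds_unique ((continuous_invariants.tendsto _).comp hlim2) (hla.congr fun x => ?_)
  refine invariants_eq_of_sim ⟨‖x.1 i₀ - x.1 i₁‖⁻¹, inv_pos.2 (norm_sub_pos_of_conf x h01),
    -(‖x.1 i₀ - x.1 i₁‖⁻¹ • x.1 i₀), fun i => ?_⟩
  exact (reconstruct_invariants h01 x i).trans (by rw [smul_sub, sub_eq_add_neg])

end Asymptotics

/-! ### Restricting and grafting directions and ratios along a tree -/

section Restrict

variable {S S' E : Type*} [NormedAddCommGroup E] [NormedSpace ℝ E]

/-- Directions and ratios of the points with labels in the image of an injection. -/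
def restrict (ρ : S → S') (hρ : Injective ρ) (a : Atilde S' E) : Atilde S E :=
  (fun p => a.1 ⟨(ρ p.1.1, ρ p.1.2), hρ.ne p.2⟩,
   fun t => a.2 ⟨(ρ t.1.1, ρ t.1.2.1, ρ t.1.2.2), hρ.ne t.2.1, hρ.ne t.2.2.1, hρ.ne t.2.2.2⟩)

theorem restrict_invariants (ρ : S → S') (hρ : Injective ρ) (x : Conf S' E) :
    restrict ρ hρ (invariants x) = invariants ⟨x.1 ∘ ρ, x.2.comp hρ⟩ := rfl

omit [NormedSpace ℝ E] in
theorem continuous_restrict (ρ : S → S') (hρ : Injective ρ) :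
    Continuous (restrict ρ hρ : Atilde S' E → Atilde S E) :=
  (continuous_pi fun _ => (continuous_apply _).comp continuous_fst).prodMk
    (continuous_pi fun _ => (continuous_apply _).comp continuous_snd)

theorem restrict_mem (ρ : S → S') (hρ : Injective ρ) {a : Atilde S' E}
    (ha : a ∈ CompModSim S' E) : restrict ρ hρ a ∈ CompModSim S E := by
  refine map_mem_closure (continuous_restrict ρ hρ) ha ?_
  rw [range_iota, range_iota]
  rintro _ ⟨x, rfl⟩
  exact ⟨_, (restrict_invariants ρ hρ x).symm⟩

end Restrict

section SmoothAtilde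

open LocalCoords

variable {X S S' E : Type*} [TopologicalSpace X] [NormedAddCommGroup E] [NormedSpace ℝ E]
  [Finite S] [Finite S']

theorem isSmooth_atilde {a : LocalCoords X} {f : X → Atilde S E}
    (h₁ : ∀ p, IsSmooth a (sphere E) fun x => (f x).1 p)
    (h₂ : ∀ t, IsSmooth a interval fun x => (f x).2 t) : IsSmooth a (coordsAtilde S E) f :=
  isSmooth_prodMk (isSmooth_pi h₁) (isSmooth_pi h₂)

theorem _root_.ConfSpace.LocalCoords.IsSmooth.atilde_fst {a : LocalCoords X} {f : X → Atilde S E}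
    (h : IsSmooth a (coordsAtilde S E) f) (p : C₂ S) :
    IsSmooth a (sphere E) fun x => (f x).1 p :=
  (Compat.eval (fun _ : C₂ S => sphere E) p (compat_ofMap _)).comp
    (((Compat.pi fun _ => compat_ofMap _).fst _).comp h)

theorem _root_.ConfSpace.LocalCoords.IsSmooth.atilde_snd {a : LocalCoords X} {f : X → Atilde S E}
    (h : IsSmooth a (coordsAtilde S E) f) (t : C₃ S) :
    IsSmooth a interval fun x => (f x).2 t :=
  (Compat.eval (fun _ : C₃ S => interval) t (compat_ofMap _)).comp
    (((Compat.pi fun _ => compat_ofMap _).snd _).comp h)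

theorem _root_.ConfSpace.LocalCoords.IsSmooth.restrict {a : LocalCoords X} {f : X → Atilde S' E}
    (h : IsSmooth a (coordsAtilde S' E) f) (ρ : S → S') (hρ : Injective ρ) :
    IsSmooth a (coordsAtilde S E) fun x => restrict ρ hρ (f x) :=
  isSmooth_atilde (fun _ => h.atilde_fst _) fun _ => h.atilde_snd _

end SmoothAtilde

namespace FTree

variable {V : Type*} {n : ℕ} {T : FTree V n} {E : Type*} [NormedAddCommGroup E] [NormedSpace ℝ E]

/-- The branches of two leaves `i` and `j` separate along the edges `q`. -/
def Sep₂ (p : C₂ (Fin n)) (q : Σ v, C₂ (T.Out v)) : Prop :=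
  T.LeafOver q.2.1.1 p.1.1 ∧ T.LeafOver q.2.1.2 p.1.2

/-- The branches of three leaves separate at the same vertex, along the edges `q`. -/
def Sep₃ (t : C₃ (Fin n)) (q : Σ v, C₃ (T.Out v)) : Prop :=
  T.LeafOver q.2.1.1 t.1.1 ∧ T.LeafOver q.2.1.2.1 t.1.2.1 ∧ T.LeafOver q.2.1.2.2 t.1.2.2

theorem exists_sep₂ (p : C₂ (Fin n)) : ∃ q, T.Sep₂ p q := by
  obtain ⟨v, e, f, h, h1, h2⟩ := T.exists_sep p.2
  exact ⟨⟨v, ⟨(e, f), h⟩⟩, h1, h2⟩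

theorem Sep₂.unique {p : C₂ (Fin n)} {q q' : Σ v, C₂ (T.Out v)} (h : T.Sep₂ p q)
    (h' : T.Sep₂ p q') : q = q' := by
  obtain ⟨v, ⟨⟨e, f⟩, hef⟩⟩ := q
  obtain ⟨w, ⟨⟨e', f'⟩, hef'⟩⟩ := q'
  obtain rfl := sep_unique hef hef' h.1 h.2 h'.1 h'.2
  obtain rfl : e = e' := h.1.unique h'.1
  obtain rfl : f = f' := h.2.unique h'.2
  rfl

theorem Sep₃.unique {t : C₃ (Fin n)} {q q' : Σ v, C₃ (T.Out v)} (h : T.Sep₃ t q)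
    (h' : T.Sep₃ t q') : q = q' := by
  obtain ⟨v, ⟨⟨e, f, g⟩, hef⟩⟩ := q
  obtain ⟨w, ⟨⟨e', f', g'⟩, hef'⟩⟩ := q'
  obtain rfl := sep_unique hef.1 hef'.1 h.1 h.2.1 h'.1 h'.2.1
  obtain rfl : e = e' := h.1.unique h'.1
  obtain rfl : f = f' := h.2.1.unique h'.2.1
  obtain rfl : g = g' := h.2.2.unique h'.2.2
  rfl

variable (T) in
/-- The vertex at which the branches of two leaves separate, with the two edges. -/
def sep (p : C₂ (Fin n)) : Σ v, C₂ (T.Out v) := (exists_sep₂ p).choose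

theorem sep₂_sep (p : C₂ (Fin n)) : T.Sep₂ p (T.sep p) := (exists_sep₂ p).choose_spec

theorem sep_eq {p : C₂ (Fin n)} {q : Σ v, C₂ (T.Out v)} (h : T.Sep₂ p q) : T.sep p = q :=
  (sep₂_sep p).unique h

open Classical in
/-- The directions and ratios of distances that are obtained by grafting infinitesimal
configurations along the tree: the direction of two leaves is read off at the vertex where their
branches separate; the distances from `i` to `j` and to `k` are compared at that vertex if it is the
same one for `j` and `k`, and otherwise the distance separated at the higher vertex is infinitely
smaller than the other one. -/
def glue (a : ∀ v, Atilde (T.Out v) E) : Atilde (Fin n) E :=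
  (fun p => (a (T.sep p).1).1 (T.sep p).2,
   fun t => if h : ∃ q, T.Sep₃ t q then (a h.choose.1).2 h.choose.2 else
    if T.depth (T.sep t.fst).1 = T.depth (T.sep t.snd).1 then 1 else
      if T.depth (T.sep t.snd).1 < T.depth (T.sep t.fst).1 then 0 else ⊤)

variable {a : ∀ v, Atilde (T.Out v) E}

omit [NormedSpace ℝ E] in
theorem glue_fst {v : V} {e f : T.Out v} (hef : e ≠ f) {i j : Fin n} (hij : i ≠ j)
    (hi : T.LeafOver e i) (hj : T.LeafOver f j) :
    (glue a).1 ⟨(i, j), hij⟩ = (a v).1 ⟨(e, f), hef⟩ := by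
  have h := sep_eq (p := ⟨(i, j), hij⟩) (q := ⟨v, ⟨(e, f), hef⟩⟩) ⟨hi, hj⟩
  simp only [glue]
  rw [h]

omit [NormedSpace ℝ E] in
theorem glue_snd {v : V} {e f g : T.Out v} (he : e ≠ f ∧ e ≠ g ∧ f ≠ g) {i j k : Fin n}
    (h : i ≠ j ∧ i ≠ k ∧ j ≠ k) (hi : T.LeafOver e i) (hj : T.LeafOver f j)
    (hk : T.LeafOver g k) :
    (glue a).2 ⟨(i, j, k), h⟩ = (a v).2 ⟨(e, f, g), he⟩ := by
  have h1 : T.Sep₃ ⟨(i, j, k), h⟩ ⟨v, ⟨(e, f, g), he⟩⟩ := ⟨hi, hj, hk⟩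
  have h2 : ∃ q, T.Sep₃ ⟨(i, j, k), h⟩ q := ⟨_, h1⟩
  simp only [glue, dif_pos h2]
  rw [h2.choose_spec.unique h1]

omit [NormedSpace ℝ E] in
theorem glue_eq_one {v : V} {e f : T.Out v} (hef : e ≠ f) {i j k : Fin n}
    (h : i ≠ j ∧ i ≠ k ∧ j ≠ k) (hi : T.LeafOver e i) (hj : T.LeafOver f j)
    (hk : T.LeafOver f k) : (glue a).2 ⟨(i, j, k), h⟩ = 1 := by
  have h1 : ¬ ∃ q, T.Sep₃ ⟨(i, j, k), h⟩ q := by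
    rintro ⟨⟨w, ⟨⟨e', f', g'⟩, he'⟩⟩, hi', hj', hk'⟩
    obtain rfl := sep_unique hef he'.1 hi hj hi' hj'
    exact he'.2.2 ((hj'.unique hj).trans (hk.unique hk'))
  have h2 := sep_eq (p := ⟨(i, j), h.1⟩) (q := ⟨v, ⟨(e, f), hef⟩⟩) ⟨hi, hj⟩
  have h3 := sep_eq (p := ⟨(i, k), h.2.1⟩) (q := ⟨v, ⟨(e, f), hef⟩⟩) ⟨hi, hk⟩
  simp only [glue, dif_neg h1, C₃.fst, C₃.snd, h2, h3, if_true]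

theorem not_sep₃ {v w : V} {e f : T.Out v} {e' g : T.Out w} (hef : e ≠ f) (heg : e' ≠ g)
    {i j k : Fin n} (h : i ≠ j ∧ i ≠ k ∧ j ≠ k) (hi : T.LeafOver e i) (hj : T.LeafOver f j)
    (hi' : T.LeafOver e' i) (hk : T.LeafOver g k) (hd : T.depth w ≠ T.depth v) :
    ¬ ∃ q, T.Sep₃ ⟨(i, j, k), h⟩ q := by
  rintro ⟨⟨u, ⟨⟨e₁, f₁, g₁⟩, he₁⟩⟩, hi₁, hj₁, hk₁⟩
  have h1 := sep_unique hef he₁.1 hi hj hi₁ hj₁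
  have h2 := sep_unique heg he₁.2.1 hi' hk hi₁ hk₁
  exact hd (by rw [h1, h2])

omit [NormedSpace ℝ E] in
theorem glue_eq_zero {v w : V} {e f : T.Out v} {e' g : T.Out w} (hef : e ≠ f) (heg : e' ≠ g)
    {i j k : Fin n} (h : i ≠ j ∧ i ≠ k ∧ j ≠ k) (hi : T.LeafOver e i) (hj : T.LeafOver f j)
    (hi' : T.LeafOver e' i) (hk : T.LeafOver g k) (hd : T.depth w < T.depth v) :
    (glue a).2 ⟨(i, j, k), h⟩ = 0 := by
  have h1 := not_sep₃ hef heg h hi hj hi' hk hd.ne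
  have h2 := sep_eq (p := ⟨(i, j), h.1⟩) (q := ⟨v, ⟨(e, f), hef⟩⟩) ⟨hi, hj⟩
  have h3 := sep_eq (p := ⟨(i, k), h.2.1⟩) (q := ⟨w, ⟨(e', g), heg⟩⟩) ⟨hi', hk⟩
  simp only [glue, dif_neg h1, C₃.fst, C₃.snd, h2, h3, hd.ne', hd, if_true, if_false]

omit [NormedSpace ℝ E] in
theorem glue_eq_top {v w : V} {e f : T.Out v} {e' g : T.Out w} (hef : e ≠ f) (heg : e' ≠ g)
    {i j k : Fin n} (h : i ≠ j ∧ i ≠ k ∧ j ≠ k) (hi : T.LeafOver e i) (hj : T.LeafOver f j)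
    (hi' : T.LeafOver e' i) (hk : T.LeafOver g k) (hd : T.depth v < T.depth w) :
    (glue a).2 ⟨(i, j, k), h⟩ = ⊤ := by
  have h1 := not_sep₃ hef heg h hi hj hi' hk hd.ne'
  have h2 := sep_eq (p := ⟨(i, j), h.1⟩) (q := ⟨v, ⟨(e, f), hef⟩⟩) ⟨hi, hj⟩
  have h3 := sep_eq (p := ⟨(i, k), h.2.1⟩) (q := ⟨w, ⟨(e', g), heg⟩⟩) ⟨hi', hk⟩
  simp only [glue, dif_neg h1, C₃.fst, C₃.snd, h2, h3, hd.ne, hd.not_gt, if_false]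

/-- The possible relative positions of the branches of three leaves, seen from the first one. -/
theorem triple_cases {i j k : Fin n} (h : i ≠ j ∧ i ≠ k ∧ j ≠ k) {P : Prop}
    (same : ∀ (v : V) (e f g : T.Out v), (e ≠ f ∧ e ≠ g ∧ f ≠ g) → T.LeafOver e i →
      T.LeafOver f j → T.LeafOver g k → P)
    (one : ∀ (v : V) (e f : T.Out v), e ≠ f → T.LeafOver e i → T.LeafOver f j →
      T.LeafOver f k → P)
    (lower : ∀ (v w : V) (e f : T.Out v) (e' g : T.Out w), e ≠ f → e' ≠ g → T.LeafOver e i →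
      T.LeafOver f j → T.LeafOver e' i → T.LeafOver g k → T.depth w < T.depth v → P)
    (upper : ∀ (v w : V) (e f : T.Out v) (e' g : T.Out w), e ≠ f → e' ≠ g → T.LeafOver e i →
      T.LeafOver f j → T.LeafOver e' i → T.LeafOver g k → T.depth v < T.depth w → P) : P := by
  obtain ⟨v, e, f, hef, hi, hj⟩ := T.exists_sep h.1
  obtain ⟨w, e', g, heg, hi', hk⟩ := T.exists_sep h.2.1
  rcases lt_trichotomy (T.depth v) (T.depth w) with hd | hd | hd
  · exact upper v w e f e' g hef heg hi hj hi' hk hd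
  · obtain rfl := hi.over.eq_of_depth_eq hi'.over hd
    obtain rfl : e = e' := hi.unique hi'
    by_cases hfg : f = g
    · subst hfg
      exact one v e f hef hi hj hk
    · exact same v e f g ⟨hef, heg, hfg⟩ hi hj hk
  · exact lower v w e f e' g hef heg hi hj hi' hk hd

/-- The relations that the tree imposes on the ratios of distances: the points over an internal
vertex are infinitely close to each other, compared with their distances to the other points. -/
def Nested (T : FTree V n) (r : C₃ (Fin n) → ℝ≥0∞) : Prop :=
  ∀ v, T.IsInternal v → ∀ i j k h, T.Over (T.leaf i).1 v → T.Over (T.leaf j).1 v →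
    ¬ T.Over (T.leaf k).1 v → r ⟨(i, j, k), h⟩ = 0

theorem Nested.isLittleO {b : Atilde (Fin n) E} (hb : T.Nested b.2)
    {l : Filter (Conf (Fin n) E)} (hl : Tendsto invariants l (𝓝 b)) {v : V} {e f : T.Out v}
    (hef : e ≠ f) {i i' k : Fin n} (hi : T.LeafOver e i) (hi' : T.LeafOver e i')
    (hk : T.LeafOver f k) :
    (fun x : Conf (Fin n) E => x.1 i' - x.1 i) =o[l] fun x => x.1 i' - x.1 k := by
  by_cases hii : i' = i
  · simp [hii]
  have hke : ¬ T.LeafOver e k := fun h => hef (h.unique hk)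
  have hd : i' ≠ i ∧ i' ≠ k ∧ i ≠ k :=
    ⟨hii, fun h => hke (h ▸ hi'), fun h => hke (h ▸ hi)⟩
  have h0 := hb e.1 (isInternal_of_leafOver hii hi' hi) i' i k hd hi' hi hke
  have h1 := (tendsto_atilde_iff.1 hl).2 ⟨(i', i, k), hd⟩
  rw [h0] at h1
  exact (tendsto_ratio_zero_iff (X := fun x => x) _).1 h1

/-- Replacing leaves by others over the same edges changes their difference only to smaller
order. -/
theorem Nested.isLittleO_sub {b : Atilde (Fin n) E} (hb : T.Nested b.2)
    {l : Filter (Conf (Fin n) E)} (hl : Tendsto invariants l (𝓝 b)) {v : V} {e f : T.Out v}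
    (hef : e ≠ f) {i i' j j' : Fin n} (hi : T.LeafOver e i) (hi' : T.LeafOver e i')
    (hj : T.LeafOver f j) (hj' : T.LeafOver f j') :
    (fun x : Conf (Fin n) E => (x.1 i - x.1 j) - (x.1 i' - x.1 j')) =o[l]
      fun x => x.1 i' - x.1 j' := by
  have h1 := hb.isLittleO hl hef hi hi' hj'
  have h2 := hb.isLittleO hl hef.symm hj hj' hi'
  have h3 := (isLittleO_neg_right.2 h2).congr_right (g₂ := fun x => x.1 i' - x.1 j')
    fun x => by abel
  exact (h3.sub h1).congr_left fun x => by abel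

variable [Finite V]

/-- The directions and ratios of the edges with initial vertex `v`, each represented by a leaf. -/
def resOut (v : V) (b : Atilde (Fin n) E) : Atilde (T.Out v) E := restrict rep rep_injective b

omit [NormedSpace ℝ E] in
/-- At every vertex, restriction recovers the directions and ratios that have been grafted. -/
theorem resOut_glue (v : V) : resOut v (glue a) = a v := by
  refine Prod.ext (funext fun p => ?_) (funext fun t => ?_)
  · exact glue_fst p.2 _ (leafOver_rep _) (leafOver_rep _)
  · exact glue_snd t.2 _ (leafOver_rep _) (leafOver_rep _) (leafOver_rep _)

/-- Grafting recovers a point of the compactification that satisfies the relations imposed by the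
tree. -/
theorem glue_resOut {b : Atilde (Fin n) E} (hb : b ∈ CompModSim (Fin n) E) (hT : T.Nested b.2) :
    glue (fun v : V => resOut (T := T) v b) = b := by
  obtain ⟨l, hl, hlb⟩ := exists_tendsto_of_mem hb
  have hlim := tendsto_atilde_iff.1 hlb
  refine Prod.ext (funext ?_) (funext ?_)
  · rintro ⟨⟨i, j⟩, hij⟩
    obtain ⟨v, e, f, hef, hi, hj⟩ := T.exists_sep hij
    rw [glue_fst hef hij hi hj]
    refine tendsto_nhds_unique (tendsto_direction_of_isLittleO (X := fun x => x) (Y := fun x => x)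
      ⟨(i, j), hij⟩ ⟨(rep e, rep f), rep_injective.ne hef⟩ ?_ (hlim.1 _)) (hlim.1 _)
    exact hT.isLittleO_sub hlb hef hi (leafOver_rep e) hj (leafOver_rep f)
  · rintro ⟨⟨i, j, k⟩, h⟩
    refine triple_cases (T := T) h ?_ ?_ ?_ ?_
    · intro v e f g he hi hj hk
      rw [glue_snd he h hi hj hk]
      refine tendsto_nhds_unique (tendsto_ratio_of_isLittleO (X := fun x => x) (Y := fun x => x)
        ⟨(i, j, k), h⟩ ⟨(rep e, rep f, rep g), rep_injective.ne he.1, rep_injective.ne he.2.1,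
          rep_injective.ne he.2.2⟩ ?_ ?_ (hlim.2 _)) (hlim.2 _)
      · exact hT.isLittleO_sub hlb he.1 hi (leafOver_rep e) hj (leafOver_rep f)
      · exact hT.isLittleO_sub hlb he.2.1 hi (leafOver_rep e) hk (leafOver_rep g)
    · intro v e f hef hi hj hk
      rw [glue_eq_one hef h hi hj hk, ratio_eq_one hb h]
      exact hT f.1 (isInternal_of_leafOver h.2.2 hj hk) _ _ _ _ hk hj fun h' => hef (hi.unique h')
    · intro v w e f e' g hef heg hi hj hi' hk hd
      rw [glue_eq_zero hef heg h hi hj hi' hk hd]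
      exact (hT v (isInternal_of_depth e hd) _ _ _ _ hi.over hj.over fun h' =>
        heg ((hi'.of_depth_lt hi.over hd h').unique hk)).symm
    · intro v w e f e' g hef heg hi hj hi' hk hd
      rw [glue_eq_top hef heg h hi hj hi' hk hd]
      have h0 : b.2 ⟨(i, k, j), h.2.1, h.1, h.2.2.symm⟩ = 0 :=
        hT w (isInternal_of_depth e' hd) _ _ _ _ hi'.over hk.over fun h' =>
          hef ((hi.of_depth_lt hi'.over hd h').unique hj)
      rw [ratio_swap hb ⟨h.2.1, h.1, h.2.2.symm⟩, h0, ENNReal.inv_zero]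

omit [Finite V] in
/-- A family of configurations in which the points over the edges at each vertex `v` become
separated at the scale `s v`, where higher vertices have smaller scales, converges to the point
obtained by grafting. -/
theorem tendsto_glue {ι : Type*} {l : Filter ι} {X : ι → Conf (Fin n) E} (s : V → ι → ℝ)
    (w : ∀ v, Conf (T.Out v) E) (hs : ∀ v t, 0 < s v t)
    (hlim : ∀ v (e f : T.Out v) i j, e ≠ f → T.LeafOver e i → T.LeafOver f j →
      Tendsto (fun t => (s v t)⁻¹ • ((X t).1 i - (X t).1 j)) l (𝓝 ((w v).1 e - (w v).1 f)))
    (hss : ∀ v u, T.depth u < T.depth v → Tendsto (fun t => s v t / s u t) l (𝓝 0)) :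
    Tendsto (fun t => invariants (X t)) l (𝓝 (glue fun v => invariants (w v))) := by
  refine tendsto_atilde_iff.2 ⟨?_, ?_⟩
  · rintro ⟨⟨i, j⟩, hij⟩
    obtain ⟨v, e, f, hef, hi, hj⟩ := T.exists_sep hij
    rw [glue_fst hef hij hi hj, tendsto_subtype_rng]
    have h1 := hlim v e f i j hef hi hj
    have h2 := (h1.norm.inv₀ (norm_sub_pos_of_conf (w v) hef).ne').smul h1
    refine h2.congr fun t => ?_
    have p1 := hs v t
    have p2 := norm_sub_pos_of_conf (X t) hij
    simp only [invariants, direction, norm_smul, smul_smul, norm_inv, Real.norm_of_nonneg p1.le]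
    congr 1
    field_simp
  · rintro ⟨⟨i, j, k⟩, h⟩
    have ratio : ∀ (v u : V) (e f : T.Out v) (e' g : T.Out u), e ≠ f → e' ≠ g → T.LeafOver e i →
        T.LeafOver f j → T.LeafOver e' i → T.LeafOver g k →
        Tendsto (fun t => ‖(s v t)⁻¹ • ((X t).1 i - (X t).1 j)‖ /
          ‖(s u t)⁻¹ • ((X t).1 i - (X t).1 k)‖) l
          (𝓝 (‖(w v).1 e - (w v).1 f‖ / ‖(w u).1 e' - (w u).1 g‖)) := by
      intro v u e f e' g hef heg hi hj hi' hk
      exact (hlim v e f i j hef hi hj).norm.div (hlim u e' g i k heg hi' hk).norm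
        (norm_sub_pos_of_conf (w u) heg).ne'
    have same : ∀ (v : V) (e f g : T.Out v), e ≠ f → e ≠ g → T.LeafOver e i →
        T.LeafOver f j → T.LeafOver g k →
        Tendsto (fun t => (invariants (X t)).2 ⟨(i, j, k), h⟩) l
          (𝓝 (ENNReal.ofReal (‖(w v).1 e - (w v).1 f‖ / ‖(w v).1 e - (w v).1 g‖))) := by
      intro v e f g hef heg hi hj hk
      refine (ENNReal.tendsto_ofReal (ratio v v e f e g hef heg hi hj hi hk)).congr fun t => ?_
      have p1 := hs v t
      simp only [invariants, norm_smul, norm_inv, Real.norm_of_nonneg p1.le]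
      rw [mul_div_mul_left _ _ (inv_pos.2 p1).ne']
    have lt : ∀ (v u : V) (e f : T.Out v) (e' g : T.Out u), e ≠ f → e' ≠ g → T.LeafOver e i →
        T.LeafOver f j → T.LeafOver e' i → T.LeafOver g k → T.depth u < T.depth v →
        Tendsto (fun t => ‖(X t).1 i - (X t).1 j‖ / ‖(X t).1 i - (X t).1 k‖) l (𝓝 0) := by
      intro v u e f e' g hef heg hi hj hi' hk hd
      have h1 := (hss v u hd).mul (ratio v u e f e' g hef heg hi hj hi' hk)
      rw [zero_mul] at h1
      refine h1.congr fun t => ?_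
      have p1 := hs v t
      have p2 := hs u t
      have p3 := norm_sub_pos_of_conf (X t) h.2.1
      simp only [norm_smul, norm_inv, Real.norm_of_nonneg p1.le, Real.norm_of_nonneg p2.le]
      field_simp
    refine triple_cases (T := T) h ?_ ?_ ?_ ?_
    · intro v e f g he hi hj hk
      rw [glue_snd he h hi hj hk]
      exact same v e f g he.1 he.2.1 hi hj hk
    · intro v e f hef hi hj hk
      rw [glue_eq_one hef h hi hj hk]
      have := same v e f f hef hef hi hj hk
      rwa [div_self (norm_sub_pos_of_conf (w v) hef).ne', ENNReal.ofReal_one] at this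
    · intro v u e f e' g hef heg hi hj hi' hk hd
      rw [glue_eq_zero hef heg h hi hj hi' hk hd]
      have := ENNReal.tendsto_ofReal (lt v u e f e' g hef heg hi hj hi' hk hd)
      rwa [ENNReal.ofReal_zero] at this
    · intro v u e f e' g hef heg hi hj hi' hk hd
      rw [glue_eq_top hef heg h hi hj hi' hk hd]
      have h1 : Tendsto (fun t => (s u t / s v t) * (‖(s u t)⁻¹ • ((X t).1 i - (X t).1 k)‖ /
          ‖(s v t)⁻¹ • ((X t).1 i - (X t).1 j)‖)) l (𝓝 0) := by
        have := (hss u v hd).mul ((hlim u e' g i k heg hi' hk).norm.div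
          (hlim v e f i j hef hi hj).norm (norm_sub_pos_of_conf (w v) hef).ne')
        rwa [zero_mul] at this
      have h2 := (ENNReal.tendsto_ofReal h1).inv
      rw [ENNReal.ofReal_zero, ENNReal.inv_zero] at h2
      refine h2.congr fun t => ?_
      have p1 := hs v t
      have p2 := hs u t
      have p3 := norm_sub_pos_of_conf (X t) h.2.1
      have p4 := norm_sub_pos_of_conf (X t) h.1
      simp only [norm_smul, norm_inv, Real.norm_of_nonneg p1.le, Real.norm_of_nonneg p2.le,
        invariants]
      rw [← ENNReal.ofReal_inv_of_pos (by positivity)]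
      congr 1
      field_simp

omit [Finite V] in
omit [NormedSpace ℝ E] in
/-- The parenthesis around `i` determined by `k`: the leaves over the edge towards `i` at the
vertex where `i` and `k` separate. -/
theorem excl_glue_iff (ha : ∀ v t, (a v).2 t ≠ 0) {w : V} {e' g : T.Out w} (heg : e' ≠ g)
    {i k : Fin n} (hi' : T.LeafOver e' i) (hk : T.LeafOver g k) (j : Fin n) :
    (j = i ∨ excl (glue a).2 i j k) ↔ T.LeafOver e' j := by
  constructor
  · rintro (rfl | ⟨h, h0⟩)
    · exact hi'
    refine triple_cases (T := T) h ?_ ?_ ?_ ?_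
    · intro v e f g he hi hj hk
      rw [glue_snd he h hi hj hk] at h0
      exact absurd h0 (ha _ _)
    · intro v e f hef hi hj hk
      rw [glue_eq_one hef h hi hj hk] at h0
      exact absurd h0 one_ne_zero
    · intro v u e f e₁ g₁ hef heg₁ hi hj hi₁ hk₁ hd
      obtain rfl := sep_unique heg heg₁ hi' hk hi₁ hk₁
      exact hi'.of_depth_lt hi.over hd hj.over
    · intro v w e f e' g hef heg hi hj hi' hk hd
      rw [glue_eq_top hef heg h hi hj hi' hk hd] at h0
      exact absurd h0 ENNReal.top_ne_zero
  · intro hj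
    by_cases hji : j = i
    · exact Or.inl hji
    have hik : i ≠ k := fun h => heg (hi'.unique (h ▸ hk))
    have hjk : j ≠ k := fun h => heg (hj.unique (h ▸ hk))
    refine Or.inr ⟨⟨Ne.symm hji, hik, hjk⟩, ?_⟩
    obtain ⟨v, e, f, hef, hi, hj'⟩ := T.exists_sep (Ne.symm hji)
    refine glue_eq_zero hef heg _ hi hj' hi' hk ?_
    rcases lt_trichotomy (T.depth v) (T.depth w) with hd | hd | hd
    · exact absurd ((hi.of_depth_lt hi'.over hd hj.over).unique hj') hef
    · obtain rfl := hi.over.eq_of_depth_eq hi'.over hd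
      exact absurd ((hi.unique hi').trans (hj.unique hj')) hef
    · exact hd

omit [NormedSpace ℝ E] in
/-- Grafting nondegenerate infinitesimal configurations produces the parentheses of the tree. -/
theorem parens_excl_glue (ha : ∀ v t, (a v).2 t ≠ 0) :
    parens (excl (glue a).2) = T.leafSets \ {univ} := by
  ext A
  constructor
  · rintro ⟨i, k, ⟨j, hj⟩, rfl⟩
    have hij : i ≠ j := hj.1.1
    have hik : i ≠ k := hj.1.2.1
    obtain ⟨w, e', g, heg, hi, hk⟩ := T.exists_sep hik
    have key := fun j => excl_glue_iff ha heg hi hk j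
    have hj' := (key j).1 (Or.inr hj)
    refine ⟨⟨e'.1, isInternal_of_leafOver hij hi hj', Set.ext fun m => key m⟩, fun hA => ?_⟩
    have hkA : k ∈ {j | j = i ∨ excl (glue a).2 i j k} := hA ▸ mem_univ k
    exact heg (((key k).1 hkA).unique hk)
  · rintro ⟨⟨v, hv, rfl⟩, hne⟩
    obtain ⟨p, hadj, hp⟩ := T.exists_parent hv.2
    let c : T.Out p := ⟨v, T.out_iff.2 ⟨hadj, hp⟩⟩
    obtain ⟨g, k, hcg, hk⟩ : ∃ (g : T.Out p) (k : Fin n), c ≠ g ∧ T.LeafOver g k := by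
      by_cases hpr : p = T.root
      · subst hpr
        obtain ⟨k, hk⟩ := (ne_univ_iff_exists_notMem _).1 hne
        refine ⟨T.rootEdge k, k, ?_, leafOver_rootEdge k⟩
        intro h
        have h1 : T.LeafOver c k := h ▸ leafOver_rootEdge k
        exact hk h1
      · obtain ⟨e, f, hef⟩ := (isInternal_of_out c hpr).exists_ne_out
        by_cases hce : c = e
        · exact ⟨f, rep f, hce ▸ hef, leafOver_rep f⟩
        · exact ⟨e, rep e, hce, leafOver_rep e⟩
    obtain ⟨e, f, hef⟩ := hv.exists_ne_out
    have hi : T.LeafOver c (rep e) := (leafOver_rep e).over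
    have hj : T.LeafOver c (rep f) := (leafOver_rep f).over
    have key := fun j => excl_glue_iff ha hcg hi hk j
    refine ⟨rep e, k, ⟨rep f, ((key _).2 hj).resolve_left (rep_injective.ne hef.symm)⟩, ?_⟩
    exact Set.ext fun m => (key m).symm

omit [NormedSpace ℝ E] in
/-- At a point with the parentheses of the tree, nothing degenerates at any vertex. -/
theorem resOut_ne_zero {b : Atilde (Fin n) E} (hb : parens (excl b.2) ⊆ T.leafSets) (v : V)
    (t : C₃ (T.Out v)) : (resOut v b).2 t ≠ 0 := by
  obtain ⟨⟨e, f, g⟩, ht⟩ := t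
  intro h0
  have hf : excl b.2 (rep e) (rep f) (rep g) := ⟨_, h0⟩
  obtain ⟨u, hu, hA⟩ := hb ⟨rep e, rep g, ⟨rep f, hf⟩, rfl⟩
  have key := fun m => Set.ext_iff.1 hA m
  have he' : T.Over (T.leaf (rep e)).1 u := (key _).1 (Or.inl rfl)
  have hf' : T.Over (T.leaf (rep f)).1 u := (key _).1 (Or.inr hf)
  have hd : T.depth u ≤ T.depth v := by
    by_contra hd
    exact ht.1 (((leafOver_rep e).of_depth_lt he' (not_le.1 hd) hf').unique (leafOver_rep f))
  have hg : T.Over (T.leaf (rep g)).1 u :=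
    (leafOver_rep g).over.trans ((leafOver_rep e).over.over_of_depth_le he' hd)
  rcases (key (rep g)).2 hg with h | ⟨h, -⟩
  · exact ht.2.1 (rep_injective h).symm
  · exact h.2.2 rfl

omit [Finite V] in
/-- A point whose parentheses include those of the tree satisfies the relations imposed by the
tree. -/
theorem nested_of_parens {b : Atilde (Fin n) E} (hb : b ∈ CompModSim (Fin n) E)
    (h : T.leafSets \ {univ} ⊆ parens (excl b.2)) : T.Nested b.2 := by
  intro v hv i j k hijk hi hj hk
  obtain ⟨i₀, k₀, ⟨j₀, hj₀⟩, hA⟩ := h ⟨⟨v, hv, rfl⟩, fun hu => hk (by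
    have : k ∈ {i | T.Over (T.leaf i).1 v} := hu ▸ mem_univ k
    exact this)⟩
  have key := fun m => Set.ext_iff.1 hA m
  exact ratio_eq_zero_of_excl hb hj₀.1.2.1 ((key i).1 hi) ((key j).1 hj)
    (fun h' => hk ((key k).2 h')) hijk

open LocalCoords

theorem isSmooth_glue {X : Type*} [TopologicalSpace X] {c : LocalCoords X}
    {f : X → ∀ v, Atilde (T.Out v) E}
    (hf : ∀ v, IsSmooth c (coordsAtilde (T.Out v) E) fun x => f x v) :
    IsSmooth c (coordsAtilde (Fin n) E) fun x => glue (f x) := by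
  refine isSmooth_atilde (fun p => (hf _).atilde_fst _) fun t => ?_
  by_cases h : ∃ q, T.Sep₃ t q
  · simp only [glue, dif_pos h]
    exact (hf _).atilde_snd _
  · simp only [glue, dif_neg h]
    exact isSmooth_const _ _ _

omit [NormedSpace ℝ E] [Finite V] in
theorem continuous_glue {X : Type*} [TopologicalSpace X] {f : X → ∀ v, Atilde (T.Out v) E}
    (hf : ∀ v, Continuous fun x => f x v) : Continuous fun x => glue (f x) := by
  refine Continuous.prodMk (continuous_pi fun p => ?_) (continuous_pi fun t => ?_)
  · exact (continuous_apply _).comp (continuous_fst.comp (hf _))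
  · by_cases h : ∃ q, T.Sep₃ t q
    · simp only [dif_pos h]
      exact (continuous_apply _).comp (continuous_snd.comp (hf _))
    · simp only [dif_neg h]
      exact continuous_const

end FTree

/-! ### The action of linear maps between different spaces -/

section Push

variable {S E F G : Type*} [NormedAddCommGroup E] [NormedSpace ℝ E] [NormedAddCommGroup F]
  [NormedSpace ℝ F] [NormedAddCommGroup G] [NormedSpace ℝ G]

/-- The directions and ratios `b` are the images of `a` under the linear map `g`. -/
def IsPush (g : E →L[ℝ] F) (a : Atilde S E) (b : Atilde S F) : Prop :=
  (∀ p, (b.1 p : F) = ‖g (a.1 p)‖⁻¹ • g (a.1 p)) ∧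
    ∀ t, b.2 t = a.2 t * ENNReal.ofReal (‖g (a.1 t.fst)‖ / ‖g (a.1 t.snd)‖)

theorem IsPush.ne_zero {g : E →L[ℝ] F} {a : Atilde S E} {b : Atilde S F} (h : IsPush g a b)
    (p : C₂ S) : g (a.1 p) ≠ 0 := by
  intro h0
  have h1 := h.1 p
  rw [h0, smul_zero] at h1
  exact ne_zero_of_mem_unit_sphere (b.1 p) h1

theorem IsPush.unique {g : E →L[ℝ] F} {a : Atilde S E} {b b' : Atilde S F} (h : IsPush g a b)
    (h' : IsPush g a b') : b = b' :=
  Prod.ext (funext fun p => Subtype.ext ((h.1 p).trans (h'.1 p).symm))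
    (funext fun t => (h.2 t).trans (h'.2 t).symm)

theorem isPush_actAtilde {g : E →L[ℝ] E} (hg : Injective g) (a : Atilde S E) :
    IsPush g a (actAtilde g hg a) := ⟨fun _ => rfl, fun _ => rfl⟩

theorem isPush_id (a : Atilde S E) : IsPush (ContinuousLinearMap.id ℝ E) a a := by
  constructor <;> intro <;> simp

theorem IsPush.norm_apply {h : E →L[ℝ] F} {a : Atilde S E} {b : Atilde S F} (hab : IsPush h a b)
    (g : F →L[ℝ] G) (p : C₂ S) : ‖g (b.1 p)‖ = ‖h (a.1 p)‖⁻¹ * ‖g (h (a.1 p))‖ := by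
  rw [hab.1 p, map_smul, norm_smul, norm_inv, norm_norm]

/-- If `g ∘ h` maps `a` to `c` and `h` maps `a` to `b`, then `g` maps `b` to `c`. -/
theorem IsPush.of_comp {h : E →L[ℝ] F} {g : F →L[ℝ] G} {a : Atilde S E} {b : Atilde S F}
    {c : Atilde S G} (hab : IsPush h a b) (hac : IsPush (g.comp h) a c) : IsPush g b c := by
  have hp := fun p => norm_pos_iff.2 (hab.ne_zero p)
  have hq := fun p => norm_pos_iff.2 (hac.ne_zero p)
  simp only [ContinuousLinearMap.comp_apply] at hq
  refine ⟨fun p => ?_, fun t => ?_⟩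
  · have h1 := hp p
    rw [hac.1 p, hab.norm_apply, hab.1 p, map_smul, smul_smul, ContinuousLinearMap.comp_apply]
    congr 1
    field_simp
  · have h1 := hp t.fst
    have h2 := hp t.snd
    have h3 := hq t.fst
    have h4 := hq t.snd
    rw [hac.2 t, hab.2 t, hab.norm_apply, hab.norm_apply, mul_assoc,
      ← ENNReal.ofReal_mul (by positivity), ContinuousLinearMap.comp_apply,
      ContinuousLinearMap.comp_apply]
    congr 2
    field_simp

theorem IsPush.of_leftInverse {g : E →L[ℝ] F} {L : F →L[ℝ] E}
    (hL : L.comp g = ContinuousLinearMap.id ℝ E) {a : Atilde S E} {b : Atilde S F}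
    (h : IsPush g a b) : IsPush L b a :=
  h.of_comp (hL ▸ isPush_id a)

/-- The image of directions and ratios under an injective linear map. -/
def push (g : E →L[ℝ] F) (hg : Injective g) (a : Atilde S E) : Atilde S F :=
  (fun p => ⟨‖g (a.1 p)‖⁻¹ • g (a.1 p), by
      have h1 : (a.1 p : E) ≠ 0 := ne_zero_of_mem_unit_sphere _
      have h2 : ‖g (a.1 p)‖ ≠ 0 := norm_ne_zero_iff.2 ((map_ne_zero_iff g hg).2 h1)
      simp [norm_smul, h2]⟩,
   fun t => a.2 t * ENNReal.ofReal (‖g (a.1 t.fst)‖ / ‖g (a.1 t.snd)‖))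

theorem isPush_push {g : E →L[ℝ] F} (hg : Injective g) (a : Atilde S E) :
    IsPush g a (push g hg a) := ⟨fun _ => rfl, fun _ => rfl⟩

theorem push_invariants {g : E →L[ℝ] F} (hg : Injective g) (x : Conf S E) :
    push g hg (invariants x) = invariants ⟨g ∘ x.1, hg.comp x.2⟩ := by
  refine Prod.ext (funext fun p => Subtype.ext ?_) (funext fun t => ?_)
  · have h1 := norm_sub_pos_of_conf x p.2
    simp only [push, invariants, direction, map_smul, norm_smul, norm_inv, norm_norm,
      smul_smul, comp_apply, ← map_sub]
    congr 1
    field_simp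
  · have h1 := norm_sub_pos_of_conf x t.2.1
    have h2 := norm_sub_pos_of_conf x t.2.2.1
    simp only [push, invariants, direction, map_smul, norm_smul, norm_inv, norm_norm,
      comp_apply, ← map_sub, C₃.fst, C₃.snd]
    rw [← ENNReal.ofReal_mul (by positivity)]
    congr 1
    field_simp

/-- The coordinates of directions and ratios. -/
def coordAt (a : Atilde S E) : (C₂ S → E) × (C₃ S → ℝ) :=
  (fun p => a.1 p, fun t => ((1 + a.2 t)⁻¹).toReal)

theorem isEmbedding_intervalCoord : IsEmbedding fun r : ℝ≥0∞ => ((1 + r)⁻¹).toReal := by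
  have h1 : ∀ r : ℝ≥0∞, (1 + r)⁻¹ ≠ ⊤ := fun r => ENNReal.inv_ne_top.2 (by simp)
  refine (Continuous.isClosedEmbedding ?_ ?_).isEmbedding
  · have hc : Continuous fun r : ℝ≥0∞ => (1 + r)⁻¹ := by fun_prop
    exact continuous_iff_continuousAt.2 fun r =>
      (ENNReal.tendsto_toReal (h1 r)).comp (hc.tendsto r)
  · intro r s hrs
    have := (ENNReal.toReal_eq_toReal_iff' (h1 r) (h1 s)).1 hrs
    exact (ENNReal.add_right_inj ENNReal.one_ne_top).1 (inv_injective this)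

omit [NormedSpace ℝ E] in
theorem isInducing_coordAt : IsInducing (coordAt : Atilde S E → _) := by
  have h1 : IsInducing (Pi.map fun _ : C₂ S => (Subtype.val : Metric.sphere (0 : E) 1 → E)) :=
    IsInducing.piMap fun _ => IsInducing.subtypeVal
  have h2 : IsInducing (Pi.map fun _ : C₃ S => fun r : ℝ≥0∞ => ((1 + r)⁻¹).toReal) :=
    IsInducing.piMap fun _ => isEmbedding_intervalCoord.isInducing
  exact h1.prodMap h2

omit [NormedSpace ℝ E] in
theorem continuous_coordAt : Continuous (coordAt : Atilde S E → _) := isInducing_coordAt.continuous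

/-- The action of a linear map in coordinates. If `c = 1 / (1 + r)` is the coordinate of a ratio
`r`, that of `r * (x / y)` is `c * y / (c * y + (1 - c) * x)`, which is smooth also where `r` is
infinite. -/
def pushCoord (z : (E →L[ℝ] F) × ((C₂ S → E) × (C₃ S → ℝ))) : (C₂ S → F) × (C₃ S → ℝ) :=
  (fun p => ‖z.1 (z.2.1 p)‖⁻¹ • z.1 (z.2.1 p),
   fun t => z.2.2 t * ‖z.1 (z.2.1 t.snd)‖ *
    (z.2.2 t * ‖z.1 (z.2.1 t.snd)‖ + (1 - z.2.2 t) * ‖z.1 (z.2.1 t.fst)‖)⁻¹)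

theorem intervalCoord_mem (r : ℝ≥0∞) :
    0 ≤ ((1 + r)⁻¹).toReal ∧ ((1 + r)⁻¹).toReal ≤ 1 := by
  refine ⟨ENNReal.toReal_nonneg, ?_⟩
  rw [← ENNReal.toReal_one]
  refine ENNReal.toReal_mono ENNReal.one_ne_top (ENNReal.inv_le_one.2 le_self_add)

theorem convexComb_pos {c x y : ℝ} (hc : 0 ≤ c ∧ c ≤ 1) (hx : 0 < x) (hy : 0 < y) :
    0 < c * x + (1 - c) * y := by
  rcases hc.1.eq_or_lt with h | h
  · rw [← h]; simpa using hy
  · have := mul_nonneg (sub_nonneg.2 hc.2) hy.le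
    have := mul_pos h hx
    linarith

theorem IsPush.coordAt_eq {g : E →L[ℝ] F} {a : Atilde S E} {b : Atilde S F} (h : IsPush g a b) :
    coordAt b = pushCoord (g, coordAt a) := by
  refine Prod.ext (funext fun p => h.1 p) (funext fun t => ?_)
  have h1 := norm_pos_iff.2 (h.ne_zero t.fst)
  have h2 := norm_pos_iff.2 (h.ne_zero t.snd)
  simp only [coordAt, pushCoord]
  rw [h.2 t]
  have hpos := div_pos h1 h2
  rcases eq_or_ne (a.2 t) ⊤ with htop | htop
  · rw [htop, ENNReal.top_mul (by simpa using hpos)]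
    simp
  · lift a.2 t to NNReal using htop with r hr
    rw [← ENNReal.ofReal_coe_nnreal, ← ENNReal.ofReal_mul r.coe_nonneg, ← ENNReal.ofReal_one,
      ← ENNReal.ofReal_add zero_le_one r.coe_nonneg,
      ← ENNReal.ofReal_add zero_le_one (by positivity), ENNReal.toReal_inv,
      ENNReal.toReal_inv, ENNReal.toReal_ofReal (by positivity),
      ENNReal.toReal_ofReal (by positivity)]
    have hr0 : (0 : ℝ) ≤ r := r.coe_nonneg
    generalize (r : ℝ) = ρ at hr0 ⊢
    have h4 : 1 - (1 + ρ)⁻¹ = ρ * (1 + ρ)⁻¹ := by field_simp; ring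
    rw [h4]
    field_simp

end Push

section PushSmooth

variable {S E F : Type*} [Finite S] [NormedAddCommGroup E] [InnerProductSpace ℝ E]
  [NormedAddCommGroup F] [InnerProductSpace ℝ F]

omit [Finite S] in
theorem smoothNear_pushCoord [Fintype (C₂ S)] [Fintype (C₃ S)] {g : E →L[ℝ] F} {a : Atilde S E}
    (h : ∀ p, g (a.1 p) ≠ 0) :
    SmoothNear (pushCoord : (E →L[ℝ] F) × ((C₂ S → E) × (C₃ S → ℝ)) → _) (g, coordAt a) := by
  have hev : ∀ p : C₂ S, SmoothNear
      (fun z : (E →L[ℝ] F) × ((C₂ S → E) × (C₃ S → ℝ)) => z.1 (z.2.1 p)) (g, coordAt a) := by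
    intro p
    refine SmoothNear.clm_apply (contDiff_fst.smoothNear _) (ContDiff.smoothNear ?_ _)
    exact (contDiff_pi.1 contDiff_id p).comp (contDiff_fst.comp contDiff_snd)
  have hc : ∀ t : C₃ S, SmoothNear
      (fun z : (E →L[ℝ] F) × ((C₂ S → E) × (C₃ S → ℝ)) => z.2.2 t) (g, coordAt a) := fun t =>
    ContDiff.smoothNear ((contDiff_pi.1 contDiff_id t).comp (contDiff_snd.comp contDiff_snd)) _
  have hn := fun p => (hev p).norm (h p)
  refine SmoothNear.prodMk (smoothNear_pi fun p => ?_) (smoothNear_pi fun t => ?_)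
  · exact ((hn p).inv (norm_ne_zero_iff.2 (h p))).smul (hev p)
  · refine ((hc t).mul (hn _)).mul (SmoothNear.inv (((hc t).mul (hn _)).add
      (((contDiff_const.smoothNear _).sub (hc t)).mul (hn _))) ?_)
    exact (convexComb_pos (intervalCoord_mem _) (norm_pos_iff.2 (h _))
      (norm_pos_iff.2 (h _))).ne'

/-- The action is jointly continuous in the linear map and the directions and ratios. -/
theorem continuousAt_push {X : Type*} [TopologicalSpace X] {x₀ : X} {g : X → E →L[ℝ] F}
    {a : X → Atilde S E} {b : X → Atilde S F} (hg : ContinuousAt g x₀) (ha : ContinuousAt a x₀)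
    (h : ∀ᶠ x in 𝓝 x₀, IsPush (g x) (a x) (b x)) : ContinuousAt b x₀ := by
  let _ := Fintype.ofFinite (C₂ S)
  let _ := Fintype.ofFinite (C₃ S)
  rw [isInducing_coordAt.continuousAt_iff]
  have h1 := (smoothNear_pushCoord (h.self_of_nhds).ne_zero).continuousAt
  have h2 : ContinuousAt (fun x => (g x, coordAt (a x))) x₀ :=
    hg.prodMk (continuous_coordAt.continuousAt.comp ha)
  refine (ContinuousAt.comp (f := fun x => (g x, coordAt (a x))) h1 h2).congr ?_
  filter_upwards [h] with x hx
  exact hx.coordAt_eq.symm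

end PushSmooth

/-! ### Infinitesimal configurations in an embedded manifold -/

section Immersion

variable {d : ℕ} {M : Type*} [TopologicalSpace M] [ChartedSpace (EuclideanSpace ℝ (Fin d)) M]

/-- The derivative of a map at a point, in terms of a chart. -/
def chartDeriv {E : Type*} [NormedAddCommGroup E] [NormedSpace ℝ E] (ε : M → E)
    (i : atlas (EuclideanSpace ℝ (Fin d)) M) (x : M) : EuclideanSpace ℝ (Fin d) →L[ℝ] E :=
  fderiv ℝ (ε ∘ i.1.symm) (i.1 x)

/-- In all charts, the map is smooth with injective derivative. -/
def IsChartImmersion {E : Type*} [NormedAddCommGroup E] [NormedSpace ℝ E] (d : ℕ) {M : Type*}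
    [TopologicalSpace M] [ChartedSpace (EuclideanSpace ℝ (Fin d)) M] (ε : M → E) : Prop :=
  ∀ (i : atlas (EuclideanSpace ℝ (Fin d)) M) (x : M), x ∈ i.1.source →
    SmoothNear (ε ∘ i.1.symm) (i.1 x) ∧ Injective (chartDeriv ε i x)

theorem isChartImmersion_of_isSmoothEmbedding [IsManifold (𝓡 d) ∞ M] {m : ℕ}
    {ε : M → EuclideanSpace ℝ (Fin m)} (hε : Manifold.IsSmoothEmbedding (𝓡 d) (𝓡 m) ∞ ε) :
    IsChartImmersion d ε := by
  intro i x hx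
  have hi : i.1 ∈ IsManifold.maximalAtlas (𝓡 d) ∞ M := IsManifold.subset_maximalAtlas i.2
  have hsm : SmoothNear (ε ∘ i.1.symm) (i.1 x) := by
    filter_upwards [i.1.open_target.mem_nhds (i.1.map_source hx)] with y hy
    rw [← contMDiffAt_iff_contDiffAt]
    exact hε.contMDiff.contMDiffAt.comp y
      ((contMDiffOn_symm_of_mem_maximalAtlas hi).contMDiffAt (i.1.open_target.mem_nhds hy))
  refine ⟨hsm, ?_⟩
  have h := hε.isImmersion.isImmersionAt x
  set φ := h.domChart
  set ψ := h.codChart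
  have hφ : φ ∈ IsManifold.maximalAtlas (𝓡 d) ∞ M := h.domChart_mem_maximalAtlas
  have hψ := h.codChart_mem_maximalAtlas
  have hxφ : x ∈ φ.source := h.mem_domChart_source
  have hxψ : ε x ∈ ψ.source := h.mem_codChart_source
  let B : EuclideanSpace ℝ (Fin m) → EuclideanSpace ℝ (Fin d) := fun y => (h.equiv.symm (ψ y)).1
  have hB : DifferentiableAt ℝ B (ε x) := by
    have h1 : ContDiffAt ℝ ∞ ψ (ε x) := by
      rw [← contMDiffAt_iff_contDiffAt]
      exact (contMDiffOn_of_mem_maximalAtlas hψ).contMDiffAt (ψ.open_source.mem_nhds hxψ)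
    have h2 : DifferentiableAt ℝ ψ (ε x) := h1.differentiableAt (by simp)
    exact (h.equiv.symm.differentiableAt.comp _ h2).fst
  have hA : DifferentiableAt ℝ (ε ∘ i.1.symm) (i.1 x) :=
    hsm.contDiffAt.differentiableAt (by simp)
  have e0 : (ε ∘ i.1.symm) (i.1 x) = ε x := congrArg ε (i.1.left_inv hx)
  -- In the charts of the immersion, a left inverse of `ε` is a coordinate projection.
  have hev : (fun y => B ((ε ∘ i.1.symm) y)) =ᶠ[𝓝 (i.1 x)] φ ∘ i.1.symm := by
    have h1 : ∀ᶠ y in 𝓝 (i.1 x), i.1.symm y ∈ φ.source := by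
      refine (i.1.continuousAt_symm (i.1.map_source hx)).eventually (φ.open_source.mem_nhds ?_)
      rwa [i.1.left_inv hx]
    filter_upwards [h1] with y hy
    have h2 := h.writtenInCharts (show φ (i.1.symm y) ∈ (φ.extend (𝓡 d)).target by
      simpa using φ.map_source hy)
    have h3 : ψ (ε (i.1.symm y)) = h.equiv (φ (i.1.symm y), 0) := by
      simpa [φ.left_inv hy, φ, ψ] using h2
    simp only [B, comp_apply, h3, ContinuousLinearEquiv.symm_apply_apply]
  have hid : (fun y => (i.1 ∘ φ.symm) ((φ ∘ i.1.symm) y)) =ᶠ[𝓝 (i.1 x)] fun y => y := by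
    have h1 : ∀ᶠ y in 𝓝 (i.1 x), i.1.symm y ∈ φ.source := by
      refine (i.1.continuousAt_symm (i.1.map_source hx)).eventually (φ.open_source.mem_nhds ?_)
      rwa [i.1.left_inv hx]
    filter_upwards [h1, i.1.open_target.mem_nhds (i.1.map_source hx)] with y hy hy'
    simp only [comp_apply, φ.left_inv hy, i.1.right_inv hy']
  have d1 : HasFDerivAt (ε ∘ i.1.symm) (chartDeriv ε i x) (i.1 x) := hA.hasFDerivAt
  have d2 := ((LocalCoords.smoothNear_chart_comp_symm hi hφ hx hxφ).contDiffAt.differentiableAt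
    (by simp)).hasFDerivAt
  have d3 := ((LocalCoords.smoothNear_chart_comp_symm hφ hi hxφ hx).contDiffAt.differentiableAt
    (by simp)).hasFDerivAt
  have e1 : (φ ∘ i.1.symm) (i.1 x) = φ x := congrArg φ (i.1.left_inv hx)
  rw [← e0] at hB
  have k1 := (hB.hasFDerivAt.comp (i.1 x) d1).unique (d2.congr_of_eventuallyEq hev)
  rw [← e1] at d3
  have k2 := (d3.comp (i.1 x) d2).unique ((hasFDerivAt_id _).congr_of_eventuallyEq hid)
  rw [← k1] at k2
  exact LeftInverse.injective (g := fun w => fderiv ℝ (i.1 ∘ φ.symm) ((φ ∘ i.1.symm) (i.1 x))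
    (fderiv ℝ B ((ε ∘ i.1.symm) (i.1 x)) w)) fun v => DFunLike.congr_fun k2 v

variable {E : Type*} [NormedAddCommGroup E]

theorem IsChartImmersion.smoothNear [NormedSpace ℝ E] {ε : M → E} (hε : IsChartImmersion d ε)
    {i : atlas (EuclideanSpace ℝ (Fin d)) M} {x : M} (hx : x ∈ i.1.source) :
    SmoothNear (ε ∘ i.1.symm) (i.1 x) := (hε i x hx).1

theorem IsChartImmersion.injective [NormedSpace ℝ E] {ε : M → E} (hε : IsChartImmersion d ε)
    {i : atlas (EuclideanSpace ℝ (Fin d)) M} {x : M} (hx : x ∈ i.1.source) :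
    Injective (chartDeriv ε i x) := (hε i x hx).2

theorem SmoothNear.fderiv {V W : Type*} [NormedAddCommGroup V] [NormedSpace ℝ V]
    [NormedAddCommGroup W] [NormedSpace ℝ W] {F : V → W} {x : V} (h : SmoothNear F x) :
    SmoothNear (fderiv ℝ F) x := by
  filter_upwards [h] with y hy
  exact hy.fderiv_right (by simp)

theorem IsChartImmersion.continuousAt_chartDeriv [NormedSpace ℝ E] {ε : M → E}
    (hε : IsChartImmersion d ε) {i : atlas (EuclideanSpace ℝ (Fin d)) M} {x : M}
    (hx : x ∈ i.1.source) : ContinuousAt (chartDeriv ε i) x :=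
  ContinuousAt.comp (g := _root_.fderiv ℝ (ε ∘ i.1.symm)) (hε.smoothNear hx).fderiv.continuousAt
    (i.1.continuousAt hx)

/-- The derivatives of an immersion have left inverses that depend smoothly on the point. -/
theorem IsChartImmersion.exists_leftInverse [NormedSpace ℝ E] [FiniteDimensional ℝ E] {ε : M → E}
    (hε : IsChartImmersion d ε) {i : atlas (EuclideanSpace ℝ (Fin d)) M} {x : M}
    (hx : x ∈ i.1.source) :
    ∃ L : EuclideanSpace ℝ (Fin d) → E →L[ℝ] EuclideanSpace ℝ (Fin d), SmoothNear L (i.1 x) ∧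
      ∀ᶠ y in 𝓝 (i.1 x), (L y).comp (_root_.fderiv ℝ (ε ∘ i.1.symm) y) =
        ContinuousLinearMap.id ℝ _ := by
  set D := _root_.fderiv ℝ (ε ∘ i.1.symm) with hD
  have hDs : SmoothNear D (i.1 x) := (hε.smoothNear hx).fderiv
  obtain ⟨P, hP⟩ := LinearMap.exists_leftInverse_of_injective
    (D (i.1 x) : EuclideanSpace ℝ (Fin d) →ₗ[ℝ] E) (LinearMap.ker_eq_bot.2 (hε.injective hx))
  let P' : E →L[ℝ] EuclideanSpace ℝ (Fin d) := LinearMap.toContinuousLinearMap P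
  -- Near `x`, the composition of `D y` with a left inverse `P'` of `D x` is still invertible.
  let Q : EuclideanSpace ℝ (Fin d) →
      EuclideanSpace ℝ (Fin d) →L[ℝ] EuclideanSpace ℝ (Fin d) := fun y => P'.comp (D y)
  have hQ : SmoothNear Q (i.1 x) := by
    filter_upwards [hDs] with y hy
    exact contDiffAt_const.clm_comp hy
  have hQ0 : Q (i.1 x) = 1 := ContinuousLinearMap.ext fun v => LinearMap.congr_fun hP v
  have hunit : ∀ᶠ y in 𝓝 (i.1 x), IsUnit (Q y) := by
    refine hQ.continuousAt.eventually (Units.isOpen.mem_nhds ?_)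
    rw [hQ0]; exact isUnit_one
  refine ⟨fun y => (Ring.inverse (Q y)).comp P', ?_, ?_⟩
  · filter_upwards [hQ, hunit] with y h1 h2
    obtain ⟨u, hu⟩ := h2
    have h3 := contDiffAt_ringInverse (n := ∞) ℝ u
    rw [hu] at h3
    exact (h3.comp y h1).clm_comp contDiffAt_const
  · filter_upwards [hunit] with y hy
    exact Ring.inverse_mul_cancel _ hy

theorem tangentCoordChange_eq [IsManifold (𝓡 d) ∞ M]
    (i j : atlas (EuclideanSpace ℝ (Fin d)) M) (x : M) :
    (tangentBundleCore (𝓡 d) M).coordChange i j x =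
      _root_.fderiv ℝ (j.1 ∘ i.1.symm) (i.1 x) := by
  rw [tangentBundleCore_coordChange, ← fderivWithin_univ]
  simp [Function.comp_def]

theorem IsChartImmersion.chartDeriv_comp [IsManifold (𝓡 d) ∞ M] [NormedSpace ℝ E] {ε : M → E}
    (hε : IsChartImmersion d ε) (i j : atlas (EuclideanSpace ℝ (Fin d)) M) {x : M}
    (hi : x ∈ i.1.source) (hj : x ∈ j.1.source) :
    (chartDeriv ε j x).comp ((tangentBundleCore (𝓡 d) M).coordChange i j x) =
      chartDeriv ε i x := by
  have hi' : i.1 ∈ IsManifold.maximalAtlas (𝓡 d) ∞ M := IsManifold.subset_maximalAtlas i.2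
  have hj' : j.1 ∈ IsManifold.maximalAtlas (𝓡 d) ∞ M := IsManifold.subset_maximalAtlas j.2
  rw [tangentCoordChange_eq]
  have e1 : (j.1 ∘ i.1.symm) (i.1 x) = j.1 x := congrArg j.1 (i.1.left_inv hi)
  have d1 := ((LocalCoords.smoothNear_chart_comp_symm hi' hj' hi hj).contDiffAt.differentiableAt
    (by simp)).hasFDerivAt
  have d2 := ((hε.smoothNear hj).contDiffAt.differentiableAt (by simp)).hasFDerivAt
  have d3 := ((hε.smoothNear hi).contDiffAt.differentiableAt (by simp)).hasFDerivAt
  rw [← e1] at d2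
  have hev : (ε ∘ i.1.symm) =ᶠ[𝓝 (i.1 x)] (ε ∘ j.1.symm) ∘ (j.1 ∘ i.1.symm) := by
    have h1 : ∀ᶠ y in 𝓝 (i.1 x), i.1.symm y ∈ j.1.source := by
      refine (i.1.continuousAt_symm (i.1.map_source hi)).eventually (j.1.open_source.mem_nhds ?_)
      rwa [i.1.left_inv hi]
    filter_upwards [h1] with y hy
    simp only [comp_apply, j.1.left_inv hy]
  have := (d2.comp (i.1 x) d1).unique (d3.congr_of_eventuallyEq hev.symm)
  rw [e1] at this
  exact this

end Immersion

open LocalCoords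

section Bundle

variable {d : ℕ} {S M : Type*} [TopologicalSpace M] [ChartedSpace (EuclideanSpace ℝ (Fin d)) M]
  [IsManifold (𝓡 d) ∞ M] {E : Type*} [NormedAddCommGroup E]

/-- The coordinate of an infinitesimal configuration in the fiber, with respect to a chart. -/
def fiberCoord (i : atlas (EuclideanSpace ℝ (Fin d)) M) (q : InfConf d S M) :
    CompModSim S (EuclideanSpace ℝ (Fin d)) := ((infConfCore d S M).localTriv i q).2

/-- The directions and ratios in the ambient space of an infinitesimal configuration in an
immersed manifold. -/
def ambient [NormedSpace ℝ E] {ε : M → E} (hε : IsChartImmersion d ε) (q : InfConf d S M) :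
    Atilde S E :=
  push (chartDeriv ε (achart _ q.proj) q.proj) (hε.injective (mem_chart_source _ q.proj))
    (fiberCoord (achart _ q.proj) q).1

theorem fiberCoord_coordChange (i j : atlas (EuclideanSpace ℝ (Fin d)) M) (q : InfConf d S M)
    (hi : q.proj ∈ i.1.source) (hj : q.proj ∈ j.1.source) :
    fiberCoord j q =
      actComp ((tangentBundleCore (𝓡 d) M).coordChange i j q.proj) (fiberCoord i q) :=
  ((infConfCore d S M).coordChange_comp (achart _ q.proj) i j q.proj
    ⟨⟨mem_chart_source _ q.proj, hi⟩, hj⟩ q.2).symm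

/-- The ambient directions and ratios can be computed in any chart, since coordinate changes are
compatible with the derivatives of the immersion. -/
theorem isPush_ambient [NormedSpace ℝ E] {ε : M → E} (hε : IsChartImmersion d ε)
    (i : atlas (EuclideanSpace ℝ (Fin d)) M) {q : InfConf d S M} (hi : q.proj ∈ i.1.source) :
    IsPush (chartDeriv ε i q.proj) (fiberCoord i q).1 (ambient hε q) := by
  have hj := mem_chart_source (EuclideanSpace ℝ (Fin d)) q.proj
  have hinj := injective_tangentCoordChange d M (achart _ q.proj) i ⟨hj, hi⟩
  have h1 := isPush_actAtilde hinj (fiberCoord (achart _ q.proj) q).1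
  rw [← actComp_of_injective hinj, ← fiberCoord_coordChange _ i q hj hi] at h1
  refine h1.of_comp ?_
  rw [hε.chartDeriv_comp _ i hj hi]
  exact isPush_push _ _

/-- An infinitesimal configuration is determined by its point and its ambient directions and
ratios. -/
theorem ambient_injective [NormedSpace ℝ E] [FiniteDimensional ℝ E] {ε : M → E}
    (hε : IsChartImmersion d ε) {q q' : InfConf d S M} (hp : q.proj = q'.proj)
    (h : ambient hε q = ambient hε q') : q = q' := by
  obtain ⟨p, b⟩ := q
  obtain ⟨p', b'⟩ := q'
  obtain rfl : p = p' := hp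
  have hj := mem_chart_source (EuclideanSpace ℝ (Fin d)) p
  obtain ⟨L, -, hL⟩ := hε.exists_leftInverse (i := achart _ p) hj
  have hL' := hL.self_of_nhds
  have h1 := (isPush_ambient hε (achart _ p) (q := ⟨p, b⟩) hj).of_leftInverse hL'
  have h2 := (isPush_ambient hε (achart _ p) (q := ⟨p, b'⟩) hj).of_leftInverse hL'
  rw [h] at h1
  have h3 : fiberCoord (achart _ p) (⟨p, b⟩ : InfConf d S M) =
      fiberCoord (achart _ p) (⟨p, b'⟩ : InfConf d S M) := Subtype.ext (h1.unique h2)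
  have h4 : ∀ c : (infConfCore d S M).Fiber p,
      fiberCoord (achart _ p) (⟨p, c⟩ : InfConf d S M) = c := fun c =>
    (infConfCore d S M).coordChange_self (achart _ p) p hj c
  rw [h4, h4] at h3
  exact congrArg _ h3

theorem continuousAt_fiberCoord (i : atlas (EuclideanSpace ℝ (Fin d)) M) {q : InfConf d S M}
    (hi : q.proj ∈ i.1.source) : ContinuousAt (fiberCoord (S := S) i) q := by
  have := ((infConfCore d S M).localTriv i).continuousAt (x := q) hi
  exact continuous_snd.continuousAt.comp this

theorem continuous_infConf_proj : Continuous fun q : InfConf d S M => q.proj :=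
  (infConfCore d S M).continuous_proj

theorem continuousAt_infConf {X : Type*} [TopologicalSpace X] {f : X → InfConf d S M} {x₀ : X}
    (h1 : ContinuousAt (fun x => (f x).proj) x₀)
    (h2 : ContinuousAt (fun x => (fiberCoord (achart _ (f x₀).proj) (f x)).1) x₀) :
    ContinuousAt f x₀ := by
  rw [FiberBundle.continuousAt_totalSpace]
  refine ⟨h1, ?_⟩
  rw [IsInducing.subtypeVal.continuousAt_iff]
  exact h2

variable [Finite S]

theorem isSmooth_infConf_proj : IsSmooth (coordsInfConf d S M) (ofCharts d M) fun q => q.proj := by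
  refine isSmooth_iff.2 ⟨continuous_infConf_proj, fun q i hi j hj => ?_⟩
  obtain ⟨F, hF, hF'⟩ := IsSmooth.exists_smoothNear (compat_ofCharts d M) (x := q.proj)
    (i := i.1) hi.1 hj
  refine ⟨F ∘ Prod.fst, SmoothNear.comp hF (contDiff_fst.smoothNear _), ?_⟩
  exact continuous_infConf_proj.continuousAt.eventually hF'

end Bundle

section BundleSmooth

variable {d : ℕ} {S M : Type*} [TopologicalSpace M] [ChartedSpace (EuclideanSpace ℝ (Fin d)) M]
  [IsManifold (𝓡 d) ∞ M] {E : Type*} [NormedAddCommGroup E] [InnerProductSpace ℝ E] [Finite S]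

theorem isSmooth_ambient {ε : M → E} (hε : IsChartImmersion d ε) :
    IsSmooth (coordsInfConf d S M) (coordsAtilde S E) (ambient hε) := by
  have hev : ∀ (i : atlas (EuclideanSpace ℝ (Fin d)) M) (q : InfConf d S M),
      q.proj ∈ i.1.source → ∀ᶠ q' : InfConf d S M in 𝓝 q, q'.proj ∈ i.1.source := fun i q hi =>
    continuous_infConf_proj.continuousAt.eventually (i.1.open_source.mem_nhds hi)
  refine isSmooth_iff.2 ⟨continuous_iff_continuousAt.2 fun q => ?_, fun q i hi j hj => ?_⟩
  · have hj := mem_chart_source (EuclideanSpace ℝ (Fin d)) q.proj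
    refine continuousAt_push (g := fun q' : InfConf d S M => chartDeriv ε (achart _ q.proj) q'.proj)
      (a := fun q' => (fiberCoord (achart _ q.proj) q').1) ?_ ?_ ?_
    · exact ContinuousAt.comp (g := chartDeriv ε (achart _ q.proj))
        (hε.continuousAt_chartDeriv hj) continuous_infConf_proj.continuousAt
    · exact continuous_subtype_val.continuousAt.comp (continuousAt_fiberCoord _ hj)
    · filter_upwards [hev (achart _ q.proj) q hj] with q' hq'
      exact isPush_ambient hε _ hq'
  · let _ := Fintype.ofFinite (C₂ S)
    let _ := Fintype.ofFinite (C₃ S)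
    have hD := (hε.smoothNear hi.1).fderiv
    have hpush := isPush_ambient hε i.1 hi.1
    have hK := smoothNear_pushCoord hpush.ne_zero
    let z₀ : EuclideanSpace ℝ (Fin d) × ((C₂ S → EuclideanSpace ℝ (Fin d)) × (C₃ S → ℝ)) :=
      (i.1.1 q.proj, coordAt (fiberCoord i.1 q).1)
    have hH : SmoothNear (fun z => pushCoord (_root_.fderiv ℝ (ε ∘ i.1.1.symm) z.1, z.2)) z₀ := by
      have h1 : SmoothNear (fun z : EuclideanSpace ℝ (Fin d) ×
          ((C₂ S → EuclideanSpace ℝ (Fin d)) × (C₃ S → ℝ)) =>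
          _root_.fderiv ℝ (ε ∘ i.1.1.symm) z.1) z₀ :=
        SmoothNear.comp (x := z₀) (F := Prod.fst) hD (contDiff_fst.smoothNear _)
      exact SmoothNear.comp (x := z₀) (F := fun z => (_root_.fderiv ℝ (ε ∘ i.1.1.symm) z.1, z.2))
        hK (h1.prodMk (contDiff_snd.smoothNear _))
    refine ⟨fun z : EuclideanSpace ℝ (Fin d) ×
        ((C₂ S → EuclideanSpace ℝ (Fin d)) × (C₃ S → ℝ)) =>
      pushCoord (_root_.fderiv ℝ (ε ∘ i.1.1.symm) z.1, z.2), hH, ?_⟩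
    · filter_upwards [hev i.1 q hi.1] with q' hq'
      exact (isPush_ambient hε i.1 hq').coordAt_eq

/-- A map to the bundle of infinitesimal configurations is smooth if its base point and its
ambient directions and ratios are. -/
theorem isSmooth_infConf [FiniteDimensional ℝ E] {ε : M → E} (hε : IsChartImmersion d ε)
    {X : Type*} [TopologicalSpace X] {c : LocalCoords X} {f : X → InfConf d S M}
    (h₁ : IsSmooth c (ofCharts d M) fun x => (f x).proj)
    (h₂ : IsSmooth c (coordsAtilde S E) fun x => ambient hε (f x)) :
    IsSmooth c (coordsInfConf d S M) f := by
  have hev : ∀ (i : atlas (EuclideanSpace ℝ (Fin d)) M) (x : X),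
      (f x).proj ∈ i.1.source → ∀ᶠ x' in 𝓝 x, (f x').proj ∈ i.1.source := fun i x hi =>
    h₁.continuous.continuousAt.eventually (i.1.open_source.mem_nhds hi)
  have hpush : ∀ (i : atlas (EuclideanSpace ℝ (Fin d)) M) (x : X), (f x).proj ∈ i.1.source →
      ∃ L : EuclideanSpace ℝ (Fin d) → E →L[ℝ] EuclideanSpace ℝ (Fin d),
        SmoothNear L (i.1 (f x).proj) ∧ ∀ᶠ x' in 𝓝 x,
          IsPush (L (i.1 (f x').proj)) (ambient hε (f x')) (fiberCoord i (f x')).1 := by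
    intro i x hi
    obtain ⟨L, hL, hL'⟩ := hε.exists_leftInverse hi
    refine ⟨L, hL, ?_⟩
    have hc : ContinuousAt (fun x' => i.1 (f x').proj) x :=
      ContinuousAt.comp (g := i.1) (i.1.continuousAt hi) h₁.continuous.continuousAt
    filter_upwards [hev i x hi, hc.eventually hL'] with x' h1 h2
    exact (isPush_ambient hε i h1).of_leftInverse h2
  refine isSmooth_iff.2 ⟨continuous_iff_continuousAt.2 fun x => ?_, fun x k hk i hi => ?_⟩
  · have hj := mem_chart_source (EuclideanSpace ℝ (Fin d)) (f x).proj
    obtain ⟨L, hL, hL'⟩ := hpush (achart _ (f x).proj) x hj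
    refine continuousAt_infConf h₁.continuous.continuousAt ?_
    refine continuousAt_push (ContinuousAt.comp
      (f := fun x' => (achart _ (f x).proj).1 (f x').proj) hL.continuousAt ?_)
      h₂.continuous.continuousAt hL'
    exact ContinuousAt.comp (g := (achart _ (f x).proj).1)
      ((achart _ (f x).proj).1.continuousAt hj) h₁.continuous.continuousAt
  · let _ := Fintype.ofFinite (C₂ S)
    let _ := Fintype.ofFinite (C₃ S)
    obtain ⟨L, hL, hL'⟩ := hpush i.1 x hi.1
    obtain ⟨F, hF, hF'⟩ := h₁.exists_smoothNear hk (j := i.1) hi.1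
    obtain ⟨j, hj⟩ := (coordsAtilde S E).cover (ambient hε (f x))
    obtain ⟨G, hG, hG'⟩ := h₂.exists_smoothNear hk hj
    let G' : c.Model → (C₂ S → E) × (C₃ S → ℝ) := G
    have hG1 : SmoothNear G' (c.coord k x) := hG
    have hG2 : ∀ᶠ x' in 𝓝 x, coordAt (ambient hε (f x')) = G' (c.coord k x') := hG'
    let F' : c.Model → EuclideanSpace ℝ (Fin d) := F
    have hF1 : SmoothNear F' (c.coord k x) := hF
    have hF2 : ∀ᶠ x' in 𝓝 x, i.1.1 (f x').proj = F' (c.coord k x') := hF'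
    have hK := smoothNear_pushCoord (hL'.self_of_nhds).ne_zero
    rw [hG2.self_of_nhds, hF2.self_of_nhds] at hK
    rw [hF2.self_of_nhds] at hL
    have hH : SmoothNear (fun y => pushCoord (L (F' y), G' y)) (c.coord k x) :=
      SmoothNear.comp (F := fun y => (L (F' y), G' y)) hK
        (SmoothNear.prodMk (SmoothNear.comp hL hF1) hG1)
    refine ⟨fun y => (F' y, pushCoord (L (F' y), G' y)), hF1.prodMk hH, ?_⟩
    filter_upwards [hF2, hG2, hL'] with x' h1 h2 h3
    refine Prod.ext h1 ?_
    have h4 := h3.coordAt_eq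
    rw [h1, h2] at h4
    exact h4

end BundleSmooth

/-! ### Limits at which all points coincide -/

theorem exists_tendsto_alpha {S M E : Type*} [TopologicalSpace M] [NormedAddCommGroup E]
    [NormedSpace ℝ E] {ε : M → E} {hε : Injective ε} {ξ : A S M E}
    (hξ : ξ ∈ CompConf S ε hε) :
    ∃ l : Filter (Conf S M), l.NeBot ∧ Tendsto (alpha ε hε) l (𝓝 ξ) := by
  refine ⟨comap (alpha ε hε) (𝓝 ξ), ?_, tendsto_comap⟩
  rw [comap_neBot_iff_frequently, ← mem_closure_iff_frequently]
  exact hξ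

section Coincident

variable {d : ℕ} {S M : Type*} [TopologicalSpace M] [ChartedSpace (EuclideanSpace ℝ (Fin d)) M]
  [IsManifold (𝓡 d) ∞ M] {E : Type*} [NormedAddCommGroup E] [InnerProductSpace ℝ E] [Finite S]

/-- A limit of configurations at which all points coincide comes from an infinitesimal
configuration: the embedding is approximated by its derivative. -/
theorem exists_ambient_eq [FiniteDimensional ℝ E] {ε : M → E} (hε : Injective ε)
    (him : IsChartImmersion d ε) {ξ : A S M E} (hξ : ξ ∈ CompConf S ε hε) {p : M}
    (hp : ∀ s, ξ.1 s = p) : ∃ q : InfConf d S M, q.proj = p ∧ ambient him q = ξ.2 := by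
  obtain ⟨l, hl, hlξ⟩ := exists_tendsto_alpha hξ
  let i : atlas (EuclideanSpace ℝ (Fin d)) M := achart (EuclideanSpace ℝ (Fin d)) p
  have hj : p ∈ i.1.source := mem_chart_source (EuclideanSpace ℝ (Fin d)) p
  have hsub : ∀ᶠ x : Conf S M in l, ∀ s, x.1 s ∈ i.1.source := by
    refine eventually_all.2 fun s => ?_
    have h1 : Tendsto (fun x : Conf S M => x.1 s) l (𝓝 (ξ.1 s)) :=
      ((continuous_apply s).comp continuous_fst).continuousAt.tendsto.comp hlξ
    rw [hp s] at h1
    exact h1.eventually (i.1.open_source.mem_nhds hj)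
  let W := {x : Conf S M // ∀ s, x.1 s ∈ i.1.source}
  let l₁ : Filter W := comap Subtype.val l
  have hl₁ : l₁.NeBot := neBot_comap_val hsub
  -- Along an ultrafilter, the directions and ratios in the chart converge by compactness.
  let U : Ultrafilter W := Ultrafilter.of l₁
  have hU : (U : Filter W) ≤ l₁ := Ultrafilter.of_le l₁
  have hUξ : Tendsto (fun x : W => alpha ε hε x.1) U (𝓝 ξ) :=
    hlξ.comp (tendsto_comap.mono_left hU)
  -- The configurations in the chart, and the limit of their directions and ratios.
  let y : W → Conf S (EuclideanSpace ℝ (Fin d)) := fun x =>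
    ⟨fun s => i.1 (x.1.1 s), fun s t hst => x.1.2 (i.1.injOn (x.2 s) (x.2 t) hst)⟩
  obtain ⟨b, -, hb⟩ := isCompact_univ.ultrafilter_le_nhds (U.map fun x => invariants (y x))
    (by simp)
  have hb' : Tendsto (fun x => invariants (y x)) U (𝓝 b) := hb
  have hbmem : b ∈ CompModSim S (EuclideanSpace ℝ (Fin d)) :=
    isClosed_closure.mem_of_tendsto hb' (Eventually.of_forall fun x => invariants_mem _)
  have hDinj := him.injective (i := i) hj
  have hpush : Tendsto (fun x => invariants ⟨chartDeriv ε i p ∘ (y x).1, hDinj.comp (y x).2⟩) U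
      (𝓝 (push (chartDeriv ε i p) hDinj b)) := by
    have hc : ContinuousAt (push (S := S) (chartDeriv ε i p) hDinj) b :=
      continuousAt_push (g := fun _ => chartDeriv ε i p) (a := fun a => a) continuousAt_const
        continuousAt_id (Eventually.of_forall fun a => isPush_push _ _)
    exact (hc.tendsto.comp hb').congr fun x => push_invariants hDinj (y x)
  have hy : ∀ s, Tendsto (fun x : W => i.1 (x.1.1 s)) U (𝓝 (i.1 p)) := by
    intro s
    have h1 : Tendsto (fun x : W => x.1.1 s) U (𝓝 (ξ.1 s)) :=
      ((continuous_apply s).comp continuous_fst).continuousAt.tendsto.comp hUξ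
    rw [hp s] at h1
    exact (i.1.continuousAt hj).tendsto.comp h1
  have hstrict : HasStrictFDerivAt (ε ∘ i.1.symm) (chartDeriv ε i p) (i.1 p) :=
    (him.smoothNear (i := i) hj).contDiffAt.hasStrictFDerivAt (by simp)
  obtain ⟨L, -, hL⟩ := him.exists_leftInverse (i := i) hj
  have hL' := hL.self_of_nhds
  have key : ∀ s t : S, (fun x : W => (ε (x.1.1 s) - ε (x.1.1 t)) -
      (chartDeriv ε i p (i.1 (x.1.1 s)) - chartDeriv ε i p (i.1 (x.1.1 t)))) =o[U]
      fun x => chartDeriv ε i p (i.1 (x.1.1 s)) - chartDeriv ε i p (i.1 (x.1.1 t)) := by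
    intro s t
    have h1 := hstrict.isLittleO.comp_tendsto ((hy s).prodMk_nhds (hy t))
    have h2 : (fun x : W => i.1 (x.1.1 s) - i.1 (x.1.1 t)) =O[U]
        fun x => chartDeriv ε i p (i.1 (x.1.1 s)) - chartDeriv ε i p (i.1 (x.1.1 t)) := by
      refine ((L (i.1 p)).isBigO_comp (fun x : W => chartDeriv ε i p (i.1 (x.1.1 s)) -
        chartDeriv ε i p (i.1 (x.1.1 t))) U).congr_left fun x => ?_
      rw [← map_sub]
      exact DFunLike.congr_fun hL' _
    refine (h1.trans_isBigO h2).congr_left fun x => ?_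
    simp only [comp_apply, map_sub, i.1.left_inv (x.2 s), i.1.left_inv (x.2 t)]
  have hlim : Tendsto (fun x : W => invariants ⟨ε ∘ x.1.1, hε.comp x.1.2⟩) U
      (𝓝 (push (chartDeriv ε i p) hDinj b)) := by
    rw [tendsto_atilde_iff] at hpush ⊢
    exact ⟨fun q => tendsto_direction_of_isLittleO q q (key _ _) (hpush.1 q),
      fun t => tendsto_ratio_of_isLittleO t t (key _ _) (key _ _) (hpush.2 t)⟩
  have hfin : push (chartDeriv ε i p) hDinj b = ξ.2 :=
    tendsto_nhds_unique hlim ((continuous_snd.tendsto _).comp hUξ)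
  refine ⟨⟨p, ⟨b, hbmem⟩⟩, rfl, ?_⟩
  have h4 : fiberCoord i (⟨p, ⟨b, hbmem⟩⟩ : InfConf d S M) = ⟨b, hbmem⟩ :=
    (infConfCore d S M).coordChange_self i p hj ⟨b, hbmem⟩
  have h5 := isPush_ambient him i (q := ⟨p, ⟨b, hbmem⟩⟩) hj
  rw [h4] at h5
  rw [← hfin]
  exact h5.unique (isPush_push _ _)

end Coincident

/-! ### Configurations modulo similarity as a submanifold of directions and ratios -/

section Similarity

variable {S E : Type*} [NormedAddCommGroup E]

theorem subsingleton_confModSim [NormedSpace ℝ E] [Subsingleton S] :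
    Subsingleton (ConfModSim S E) := by
  refine ⟨fun q q' => ?_⟩
  induction q using Quotient.inductionOn with
  | h x =>
    induction q' using Quotient.inductionOn with
    | h y =>
      refine Quotient.sound ?_
      rcases isEmpty_or_nonempty S with h | ⟨⟨s⟩⟩
      · exact ⟨1, one_pos, 0, fun i => h.elim i⟩
      · refine ⟨1, one_pos, y.1 s - x.1 s, fun i => ?_⟩
        rw [Subsingleton.elim i s]
        simp

theorem subsingleton_atilde [NormedSpace ℝ E] [Subsingleton S] : Subsingleton (Atilde S E) :=
  ⟨fun _ _ => Prod.ext (funext fun p => absurd (Subsingleton.elim _ _) p.2)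
    (funext fun t => absurd (Subsingleton.elim _ _) t.2.1)⟩

theorem invariants_snd_ne_zero [NormedSpace ℝ E] (x : Conf S E) (t : C₃ S) :
    (invariants x).2 t ≠ 0 := by
  have := div_pos (norm_sub_pos_of_conf x t.2.1) (norm_sub_pos_of_conf x t.2.2.1)
  simpa [invariants] using this

theorem iota_snd_ne_zero [NormedSpace ℝ E] (q : ConfModSim S E) (t : C₃ S) :
    (iota q).2 t ≠ 0 := by
  induction q using Quotient.inductionOn with
  | h x => exact invariants_snd_ne_zero x t

theorem iota_snd_ne_top [NormedSpace ℝ E] (q : ConfModSim S E) (t : C₃ S) :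
    (iota q).2 t ≠ ⊤ := by
  induction q using Quotient.inductionOn with
  | h x => exact ENNReal.ofReal_ne_top

theorem iota_mem [NormedSpace ℝ E] (q : ConfModSim S E) : iota q ∈ CompModSim S E :=
  subset_closure (mem_range_self q)

/-- A nondegenerate point of the compactification comes from a configuration modulo similarity. -/
theorem mem_range_iota [NormedSpace ℝ E] {a : Atilde S E} (ha : a ∈ CompModSim S E)
    (h : ∀ t, a.2 t ≠ 0) : a ∈ range (iota (S := S) (E := E)) := by
  rcases subsingleton_or_nontrivial S with hS | hS
  · obtain ⟨b, hb⟩ : (range (iota (S := S) (E := E))).Nonempty :=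
      closure_nonempty_iff.1 ⟨a, ha⟩
    have := subsingleton_atilde (S := S) (E := E)
    rwa [Subsingleton.elim a b]
  · obtain ⟨i₀, i₁, h01⟩ := exists_pair_ne S
    obtain ⟨hx, e⟩ := reconstruct_spec ha h h01
    rw [range_iota]
    exact ⟨_, e⟩

theorem reconstruct_iota [NormedSpace ℝ E] {i₀ i₁ : S} (h01 : i₀ ≠ i₁) (q : ConfModSim S E) :
    ∃ hx : Injective (reconstruct i₀ i₁ (iota q)),
      q = (Quotient.mk (simSetoid S E) ⟨reconstruct i₀ i₁ (iota q), hx⟩ : ConfModSim S E) := by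
  obtain ⟨hx, -⟩ := reconstruct_spec (iota_mem q) (iota_snd_ne_zero q) h01
  refine ⟨hx, ?_⟩
  induction q using Quotient.inductionOn with
  | h x =>
    refine Quotient.sound ⟨‖x.1 i₀ - x.1 i₁‖⁻¹, inv_pos.2 (norm_sub_pos_of_conf x h01),
      -(‖x.1 i₀ - x.1 i₁‖⁻¹ • x.1 i₀), fun i => ?_⟩
    exact (reconstruct_invariants h01 x i).trans (by rw [smul_sub, sub_eq_add_neg])

theorem iota_injective [NormedSpace ℝ E] : Injective (iota (S := S) (E := E)) := by
  rcases subsingleton_or_nontrivial S with hS | hS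
  · have := subsingleton_confModSim (S := S) (E := E)
    exact injective_of_subsingleton _
  · obtain ⟨i₀, i₁, h01⟩ := exists_pair_ne S
    intro q q' h
    obtain ⟨hx, e⟩ := reconstruct_iota h01 q
    obtain ⟨hx', e'⟩ := reconstruct_iota h01 q'
    rw [e, e']
    congr 2
    rw [h]

variable [InnerProductSpace ℝ E] [Finite S]

/-- The normalization of a family of vectors: its barycenter is moved to the origin, and the sum of
the squared norms is scaled to one. -/
def normalizeVec (y : S → E) : S → E :=
  letI := Fintype.ofFinite S
  let c : E := (Fintype.card S : ℝ)⁻¹ • ∑ j, y j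
  fun i => (√(∑ j, ‖y j - c‖ ^ 2))⁻¹ • (y i - c)

omit [InnerProductSpace ℝ E] [Finite S] in
theorem sum_sq_pos [Fintype S] [Nontrivial S] {y : S → E} (hy : Injective y) (c : E) :
    0 < ∑ j, ‖y j - c‖ ^ 2 := by
  obtain ⟨i, j, hij⟩ := exists_pair_ne S
  refine Finset.sum_pos' (fun j _ => by positivity) ?_
  by_cases h : y i = c
  · refine ⟨j, Finset.mem_univ _, ?_⟩
    have : y j - c ≠ 0 := sub_ne_zero.2 fun h' => hij (hy (h.trans h'.symm))
    have := norm_pos_iff.2 this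
    positivity
  · refine ⟨i, Finset.mem_univ _, ?_⟩
    have := norm_pos_iff.2 (sub_ne_zero.2 h)
    positivity

theorem smoothNear_normalizeVec [Fintype S] [Nontrivial S] {y : S → E} (hy : Injective y) :
    SmoothNear (normalizeVec : (S → E) → S → E) y := by
  obtain rfl : ‹Fintype S› = Fintype.ofFinite S := Subsingleton.elim _ _
  let _ := Fintype.ofFinite S
  have hc : ContDiff ℝ ∞ fun y : S → E => (Fintype.card S : ℝ)⁻¹ • ∑ j, y j := by fun_prop
  have hs : ContDiff ℝ ∞ fun y : S → E =>
      ∑ j, ‖y j - (Fintype.card S : ℝ)⁻¹ • ∑ j, y j‖ ^ 2 :=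
    ContDiff.sum fun j _ => ContDiff.norm_sq ℝ ((contDiff_apply ℝ E j).sub hc)
  have h0 : ∀ᶠ z in 𝓝 y, ∑ j, ‖z j - (Fintype.card S : ℝ)⁻¹ • ∑ j, z j‖ ^ 2 ≠ 0 :=
    hs.continuous.continuousAt.eventually_ne (sum_sq_pos hy _).ne'
  refine smoothNear_pi fun i => ?_
  filter_upwards [h0] with z hz
  refine ContDiffAt.smul (ContDiffAt.inv (hs.contDiffAt.sqrt hz) ?_)
    ((contDiff_apply ℝ E i).sub hc).contDiffAt
  exact Real.sqrt_ne_zero'.2 (lt_of_le_of_ne (Finset.sum_nonneg fun j _ => by positivity) hz.symm)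

theorem exists_normalize_eq [Nontrivial S] (x : Conf S E) :
    ∃ t : ℝ, 0 < t ∧ ∃ b : E, ∀ i, normalize x i = t • x.1 i + b := by
  let _ := Fintype.ofFinite S
  let c : E := (Fintype.card S : ℝ)⁻¹ • ∑ j, x.1 j
  refine ⟨(√(∑ j, ‖x.1 j - c‖ ^ 2))⁻¹, inv_pos.2 (Real.sqrt_pos.2 (sum_sq_pos x.2 c)),
    -((√(∑ j, ‖x.1 j - c‖ ^ 2))⁻¹ • c), fun i => ?_⟩
  rw [← sub_eq_add_neg, ← smul_sub]
  rfl

theorem normalize_injective [Nontrivial S] (x : Conf S E) : Injective (normalize x) := by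
  obtain ⟨t, ht, b, h⟩ := exists_normalize_eq x
  intro i j hij
  rw [h, h] at hij
  exact x.2 (smul_right_injective E ht.ne' (add_right_cancel hij))

theorem invariants_normalize [Nontrivial S] (x : Conf S E) :
    invariants ⟨normalize x, normalize_injective x⟩ = invariants x :=
  (invariants_eq_of_sim (exists_normalize_eq x)).symm

omit [Finite S] in
theorem continuous_iota : Continuous (iota (S := S) (E := E)) :=
  continuous_quot_lift _ continuous_invariants

theorem compat_coordsConfModSim : (coordsConfModSim S E).Compat := by
  let _ := Fintype.ofFinite S
  exact compat_ofMap _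

/-- Directions and ratios are smooth: they can be computed from the normalized configuration, whose
points are distinct. -/
theorem isSmooth_iota : IsSmooth (coordsConfModSim S E) (coordsAtilde S E) iota := by
  let _ := Fintype.ofFinite S
  refine isSmooth_atilde (fun p => ?_) fun t => ?_
  · have : Nontrivial S := ⟨_, _, p.2⟩
    refine isSmooth_iff.2 ⟨(continuous_apply p).comp (continuous_fst.comp continuous_iota),
      fun q _ _ _ _ => ⟨fun z : S → E => ‖z p.1.1 - z p.1.2‖⁻¹ • (z p.1.1 - z p.1.2), ?_, ?_⟩⟩
    · induction q using Quotient.inductionOn with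
      | h x =>
        have h0 : normalize x p.1.1 - normalize x p.1.2 ≠ 0 :=
          sub_ne_zero.2 ((normalize_injective x).ne p.2)
        have h1 : SmoothNear (fun z : S → E => z p.1.1 - z p.1.2) (normalize x) :=
          ((contDiff_apply ℝ E _).sub (contDiff_apply ℝ E _)).smoothNear _
        exact ((h1.norm h0).inv (norm_ne_zero_iff.2 h0)).smul h1
    · refine Eventually.of_forall fun q => ?_
      induction q using Quotient.inductionOn with
      | h x =>
        exact congrArg (fun a : Atilde S E => (a.1 p : E)) (invariants_normalize x).symm
  · have : Nontrivial S := ⟨_, _, t.2.1⟩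
    refine isSmooth_iff.2 ⟨(continuous_apply t).comp (continuous_snd.comp continuous_iota),
      fun q _ _ _ _ => ⟨fun z : S → E => ‖z t.1.1 - z t.1.2.2‖ *
        (‖z t.1.1 - z t.1.2.2‖ + ‖z t.1.1 - z t.1.2.1‖)⁻¹, ?_, ?_⟩⟩
    · induction q using Quotient.inductionOn with
      | h x =>
        have h0 : ∀ i j, i ≠ j → normalize x i - normalize x j ≠ 0 := fun i j hij =>
          sub_ne_zero.2 ((normalize_injective x).ne hij)
        have h1 : ∀ i j, SmoothNear (fun z : S → E => z i - z j) (normalize x) := fun i j =>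
          ((contDiff_apply ℝ E i).sub (contDiff_apply ℝ E j)).smoothNear _
        have h2 := (h1 _ _).norm (h0 _ _ t.2.1)
        have h3 := (h1 _ _).norm (h0 _ _ t.2.2.1)
        refine h3.mul ((h3.add h2).inv ?_)
        have := norm_pos_iff.2 (h0 _ _ t.2.1)
        have := norm_pos_iff.2 (h0 _ _ t.2.2.1)
        positivity
    · refine Eventually.of_forall fun q => ?_
      induction q using Quotient.inductionOn with
      | h x =>
        refine (congrArg (fun a : Atilde S E => ((1 + a.2 t)⁻¹).toReal)
          (invariants_normalize x).symm).trans ?_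
        have h2 := norm_sub_pos_of_conf ⟨normalize x, normalize_injective x⟩ t.2.1
        have h3 := norm_sub_pos_of_conf ⟨normalize x, normalize_injective x⟩ t.2.2.1
        simp only [invariants] at h2 h3 ⊢
        rw [← ENNReal.ofReal_one, ← ENNReal.ofReal_add zero_le_one (by positivity),
          ENNReal.toReal_inv, ENNReal.toReal_ofReal (by positivity)]
        change _ = ‖normalize x t.1.1 - normalize x t.1.2.2‖ *
        (‖normalize x t.1.1 - normalize x t.1.2.2‖ + ‖normalize x t.1.1 - normalize x t.1.2.1‖)⁻¹
        field_simp

open Classical in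
/-- The reconstruction of a configuration from its directions and ratios, in coordinates. The
coordinate of a ratio `r` is `z = 1 / (1 + r)`, so that `r = z⁻¹ - 1`. -/
def reconstructCoord (i₀ i₁ : S) (z : (C₂ S → E) × (C₃ S → ℝ)) (j : S) : E :=
  if h₀ : i₀ = j then 0 else
    if h₁ : j = i₁ then -(z.1 ⟨(i₀, j), h₀⟩) else
      if h₂ : i₀ = i₁ then 0 else
        -(((z.2 ⟨(i₀, j, i₁), h₀, h₂, h₁⟩)⁻¹ - 1) • (z.1 ⟨(i₀, j), h₀⟩))

omit [Finite S] in
theorem reconstructCoord_coordAt (i₀ i₁ : S) {a : Atilde S E} (ha : ∀ t, a.2 t ≠ ⊤) :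
    reconstructCoord i₀ i₁ (coordAt a) = reconstruct i₀ i₁ a := by
  funext j
  simp only [reconstructCoord, reconstruct, coordAt]
  split_ifs with h₀ h₁ h₂
  · rfl
  · rfl
  · rfl
  · rw [ENNReal.toReal_inv, inv_inv, ENNReal.toReal_add ENNReal.one_ne_top (ha _)]
    simp

omit [Finite S] in
theorem smoothNear_reconstructCoord [Fintype S] [Fintype (C₂ S)] [Fintype (C₃ S)] (i₀ i₁ : S)
    {a : Atilde S E} (ha : ∀ t, a.2 t ≠ ⊤) :
    SmoothNear (reconstructCoord i₀ i₁ : (C₂ S → E) × (C₃ S → ℝ) → S → E) (coordAt a) := by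
  have hu : ∀ p : C₂ S, SmoothNear (fun z : (C₂ S → E) × (C₃ S → ℝ) => z.1 p) (coordAt a) :=
    fun p => ((contDiff_apply ℝ E p).comp contDiff_fst).smoothNear _
  have hd : ∀ t : C₃ S, SmoothNear (fun z : (C₂ S → E) × (C₃ S → ℝ) => z.2 t) (coordAt a) :=
    fun t => ((contDiff_apply ℝ ℝ t).comp contDiff_snd).smoothNear _
  have hneg : ∀ {F : (C₂ S → E) × (C₃ S → ℝ) → E}, SmoothNear F (coordAt a) →
      SmoothNear (fun z => -F z) (coordAt a) := fun h => by
    filter_upwards [h] with z hz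
    exact hz.neg
  refine smoothNear_pi fun j => ?_
  simp only [reconstructCoord]
  split_ifs with h₀ h₁ h₂
  · exact contDiff_const.smoothNear _
  · exact hneg (hu _)
  · exact contDiff_const.smoothNear _
  · refine hneg (SmoothNear.smul (((hd _).inv ?_).sub (contDiff_const.smoothNear _)) (hu _))
    have h1 : (1 + a.2 ⟨(i₀, j, i₁), h₀, h₂, h₁⟩) ≠ ⊤ :=
      ENNReal.add_ne_top.2 ⟨ENNReal.one_ne_top, ha _⟩
    exact ENNReal.toReal_ne_zero.2 ⟨ENNReal.inv_ne_zero.2 h1, ENNReal.inv_ne_top.2 (by simp)⟩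

/-- A map to configurations modulo similarity is smooth if the directions and ratios are. -/
theorem isSmooth_confModSim {X : Type*} [TopologicalSpace X] {c : LocalCoords X}
    {f : X → ConfModSim S E} (h : IsSmooth c (coordsAtilde S E) fun x => iota (f x)) :
    IsSmooth c (coordsConfModSim S E) f := by
  rcases subsingleton_or_nontrivial S with hS | hS
  · have := subsingleton_confModSim (S := S) (E := E)
    rcases isEmpty_or_nonempty X with hX | ⟨⟨x₀⟩⟩
    · exact isSmooth_iff.2 ⟨continuous_iff_continuousAt.2 fun x => hX.elim x, fun x => hX.elim x⟩
    · rw [show f = fun _ => f x₀ from funext fun _ => Subsingleton.elim _ _]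
      exact isSmooth_const _ _ _
  · obtain ⟨i₀, i₁, h01⟩ := exists_pair_ne S
    let _ := Fintype.ofFinite S
    let _ := Fintype.ofFinite (C₂ S)
    let _ := Fintype.ofFinite (C₃ S)
    have hR := fun x => reconstructCoord_coordAt i₀ i₁ (iota_snd_ne_top (f x))
    choose hinj hf using fun x => reconstruct_iota h01 (f x)
    have hs := fun x => smoothNear_reconstructCoord i₀ i₁ (iota_snd_ne_top (f x))
    refine isSmooth_iff.2 ⟨?_, fun x k hk _ _ => ?_⟩
    · have hc : Continuous fun x =>
          (⟨reconstruct i₀ i₁ (iota (f x)), hinj x⟩ : Conf S E) := by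
        refine continuous_induced_rng.2 (continuous_iff_continuousAt.2 fun x => ?_)
        refine (ContinuousAt.comp (f := fun x => coordAt (iota (f x))) (hs x).continuousAt
          (continuous_coordAt.comp h.continuous).continuousAt).congr ?_
        exact Eventually.of_forall fun x' => hR x'
      rw [funext hf]
      exact continuous_quotient_mk'.comp hc
    · obtain ⟨j, hj⟩ := (coordsAtilde S E).cover (iota (f x))
      obtain ⟨G, hG, hG'⟩ := h.exists_smoothNear hk hj
      let G' : c.Model → (C₂ S → E) × (C₃ S → ℝ) := G
      have hG1 : SmoothNear G' (c.coord k x) := hG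
      have hG2 : ∀ᶠ x' in 𝓝 x, coordAt (iota (f x')) = G' (c.coord k x') := hG'
      have h1 := hs x
      rw [hG2.self_of_nhds] at h1
      have h2 : Injective (reconstructCoord i₀ i₁ (G' (c.coord k x))) := by
        rw [← hG2.self_of_nhds, hR]
        exact hinj x
      refine ⟨fun y => normalizeVec (reconstructCoord i₀ i₁ (G' y)),
        SmoothNear.comp (F := fun y => reconstructCoord i₀ i₁ (G' y))
          (smoothNear_normalizeVec h2) (SmoothNear.comp h1 hG1), ?_⟩
      filter_upwards [hG2] with x' hx'
      rw [← hx', hR]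
      exact congrArg (Quotient.lift normalize fun _ _ h => normalize_eq_of_sim h) (hf x')

end Similarity

/-! ### Inflating infinitesimal configurations -/

namespace FTree

variable {V : Type*} {n : ℕ} {T : FTree V n} {E : Type*} [NormedAddCommGroup E] [NormedSpace ℝ E]

open Classical in
/-- The vector that a family of vectors indexed by the edges at `v` assigns to a leaf: the one of
the edge at `v` below the leaf if there is one, and `0` otherwise. -/
def branchVec {v : V} (w : T.Out v → E) (i : Fin n) : E :=
  if h : ∃ e, T.LeafOver e i then w h.choose else 0

omit [NormedSpace ℝ E] in
theorem LeafOver.branchVec_eq {v : V} {e : T.Out v} {i : Fin n} (h : T.LeafOver e i)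
    (w : T.Out v → E) : branchVec w i = w e := by
  have h' : ∃ e, T.LeafOver e i := ⟨e, h⟩
  rw [branchVec, dif_pos h', h'.choose_spec.unique h]

omit [NormedSpace ℝ E] in
theorem branchVec_eq_zero {v : V} {i : Fin n} (h : ¬ ∃ e : T.Out v, T.LeafOver e i)
    (w : T.Out v → E) : branchVec w i = 0 := dif_neg h

omit [NormedSpace ℝ E] in
theorem branchVec_eq_of_depth_lt {u v : V} {i j : Fin n} (hi : T.Over (T.leaf i).1 v)
    (hj : T.Over (T.leaf j).1 v) (hd : T.depth u < T.depth v) (w : T.Out u → E) :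
    branchVec w i = branchVec w j := by
  by_cases h : ∃ e : T.Out u, T.LeafOver e i
  · obtain ⟨e, he⟩ := h
    rw [he.branchVec_eq, (he.of_depth_lt hi hd hj).branchVec_eq]
  · have h' : ¬ ∃ e : T.Out u, T.LeafOver e j := fun ⟨e, he⟩ => h ⟨e, he.of_depth_lt hj hd hi⟩
    rw [branchVec_eq_zero h, branchVec_eq_zero h']

variable [Finite V]

/-- The sum of the vectors along the branch of a leaf, scaled by powers of `t` that increase with
the height. -/
def inflate (w : ∀ v, T.Out v → E) (t : ℝ) (i : Fin n) : E :=
  letI := Fintype.ofFinite V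
  ∑ v, t ^ T.depth v • branchVec (w v) i

theorem tendsto_inflate_sub (w : ∀ v, T.Out v → E) {v : V} {e f : T.Out v} {i j : Fin n}
    (hi : T.LeafOver e i) (hj : T.LeafOver f j) :
    Tendsto (fun t => (t ^ T.depth v)⁻¹ • (inflate w t i - inflate w t j)) (𝓝[>] 0)
      (𝓝 (w v e - w v f)) := by
  classical
  let _ := Fintype.ofFinite V
  have key : ∀ u : V, Tendsto (fun t : ℝ => ((t ^ T.depth v)⁻¹ * t ^ T.depth u) •
      (branchVec (w u) i - branchVec (w u) j)) (𝓝[>] 0)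
      (𝓝 (if u = v then w v e - w v f else 0)) := by
    intro u
    split_ifs with huv
    · subst huv
      rw [hi.branchVec_eq, hj.branchVec_eq]
      refine (tendsto_const_nhds).congr' ?_
      filter_upwards [self_mem_nhdsWithin] with t ht
      rw [inv_mul_cancel₀ (pow_pos ht _).ne', one_smul]
    · rcases lt_trichotomy (T.depth u) (T.depth v) with hd | hd | hd
      · rw [branchVec_eq_of_depth_lt hi.over hj.over hd]
        simp
      · have h1 : ¬ ∃ e : T.Out u, T.LeafOver e i := fun ⟨e', he'⟩ =>
          huv (he'.over.eq_of_depth_eq hi.over hd)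
        have h2 : ¬ ∃ e : T.Out u, T.LeafOver e j := fun ⟨e', he'⟩ =>
          huv (he'.over.eq_of_depth_eq hj.over hd)
        rw [branchVec_eq_zero h1, branchVec_eq_zero h2]
        simp
      · have h1 : Tendsto (fun t : ℝ => t ^ (T.depth u - T.depth v)) (𝓝[>] 0) (𝓝 0) := by
          have := (continuous_pow (M := ℝ) (T.depth u - T.depth v)).tendsto 0
          rw [zero_pow (by omega)] at this
          exact this.mono_left nhdsWithin_le_nhds
        have h2 := h1.smul_const (branchVec (w u) i - branchVec (w u) j)
        rw [zero_smul] at h2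
        refine h2.congr' ?_
        filter_upwards [self_mem_nhdsWithin] with t ht
        have ht' : (0 : ℝ) < t := ht
        rw [pow_sub₀ t ht'.ne' hd.le, mul_comm]
  have := tendsto_finsetSum Finset.univ fun u _ => key u
  rw [Finset.sum_ite_eq' Finset.univ v, if_pos (Finset.mem_univ _)] at this
  refine this.congr fun t => ?_
  simp only [inflate, ← Finset.sum_sub_distrib, Finset.smul_sum, ← smul_sub, smul_smul]

theorem tendsto_inflate_zero (w : ∀ v, T.Out v → E) (h0 : w T.root = 0) (i : Fin n) :
    Tendsto (fun t => inflate w t i) (𝓝[>] 0) (𝓝 0) := by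
  let _ := Fintype.ofFinite V
  have key : ∀ u : V, Tendsto (fun t : ℝ => t ^ T.depth u • branchVec (w u) i) (𝓝[>] 0)
      (𝓝 0) := by
    intro u
    by_cases hu : u = T.root
    · subst hu
      have : branchVec (w T.root) i = 0 := by
        rw [(leafOver_rootEdge i).branchVec_eq, h0]; rfl
      simp [this]
    · have h1 : Tendsto (fun t : ℝ => t ^ T.depth u) (𝓝[>] 0) (𝓝 0) := by
        have := (continuous_pow (M := ℝ) (T.depth u)).tendsto 0
        rw [zero_pow (fun h => hu (depth_eq_zero.1 h))] at this
        exact this.mono_left nhdsWithin_le_nhds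
      simpa using h1.smul_const (branchVec (w u) i)
  simpa [inflate] using tendsto_finsetSum Finset.univ fun u _ => key u

omit [Finite V] in
/-- A family of points whose differences, scaled by powers of `t`, converge to those of
configurations at the vertices consists of configurations for small `t`, and converges to the point
obtained by grafting. -/
theorem exists_tendsto_glue (x : ℝ → Fin n → E) (w : ∀ v, Conf (T.Out v) E)
    (hlim : ∀ v (e f : T.Out v) i j, e ≠ f → T.LeafOver e i → T.LeafOver f j →
      Tendsto (fun t => (t ^ T.depth v)⁻¹ • (x t i - x t j)) (𝓝[>] 0)
        (𝓝 ((w v).1 e - (w v).1 f))) :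
    (∀ᶠ t in 𝓝[>] 0, 0 < t ∧ Injective (x t)) ∧
      Tendsto (fun t : {t : ℝ // 0 < t ∧ Injective (x t)} => invariants ⟨x t.1, t.2.2⟩)
        (comap Subtype.val (𝓝[>] 0)) (𝓝 (glue fun v => invariants (w v))) := by
  constructor
  · have h1 : ∀ p : C₂ (Fin n), ∀ᶠ t in 𝓝[>] (0 : ℝ), x t p.1.1 ≠ x t p.1.2 := by
      rintro ⟨⟨i, j⟩, hij⟩
      obtain ⟨v, e, f, hef, hi, hj⟩ := T.exists_sep hij
      filter_upwards [(hlim v e f i j hef hi hj).eventually_ne (sub_ne_zero_of_conf (w v) hef)]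
        with t ht h
      have h' : x t i = x t j := h
      exact ht (by rw [h', sub_self, smul_zero])
    filter_upwards [self_mem_nhdsWithin, eventually_all.2 h1] with t ht h2
    exact ⟨ht, fun i j hij => by_contra fun hne => h2 ⟨(i, j), hne⟩ hij⟩
  · refine tendsto_glue (fun v t => t.1 ^ T.depth v) w (fun v t => pow_pos t.2.1 _) ?_ ?_
    · intro v e f i j hef hi hj
      exact (hlim v e f i j hef hi hj).comp tendsto_comap
    · intro v u hd
      have h1 : Tendsto (fun t : ℝ => t ^ (T.depth v - T.depth u)) (𝓝[>] 0) (𝓝 0) := by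
        have := (continuous_pow (M := ℝ) (T.depth v - T.depth u)).tendsto 0
        rw [zero_pow (by omega)] at this
        exact this.mono_left nhdsWithin_le_nhds
      refine (h1.comp (tendsto_comap (f := Subtype.val))).congr fun t => ?_
      rw [comp_apply, pow_sub₀ _ t.2.1.ne' hd.le]
      rfl

theorem glue_mem (w : ∀ v, Conf (T.Out v) E) :
    glue (fun v => invariants (w v)) ∈ CompModSim (Fin n) E := by
  obtain ⟨h1, h2⟩ := exists_tendsto_glue (T := T) (fun t => inflate (fun v => (w v).1) t) w
    fun v e f i j _ hi hj => tendsto_inflate_sub (fun v => (w v).1) hi hj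
  have hne := neBot_comap_val h1
  exact isClosed_closure.mem_of_tendsto h2 (Eventually.of_forall fun t => invariants_mem _)

/-! ### The open stratum of configurations modulo similarity -/

/-- The configuration without points. -/
def emptyConf {S : Type*} (h : IsEmpty S) : Conf S E := ⟨fun s => h.elim s, fun s => h.elim s⟩

omit [Finite V] in
theorem isEmpty_out_of_not_isNode {v : V} (h : ¬ T.IsNode v) : IsEmpty (T.Out v) :=
  ⟨fun e => h (isNode_of_out e)⟩

open Classical in
/-- The directions and ratios of configurations modulo similarity at the nodes. -/
def nodeFamily (q : ∀ v : {v : V // T.IsNode v}, ConfModSim (T.Out v.1) E) (v : V) :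
    Atilde (T.Out v) E :=
  if h : T.IsNode v then iota (q ⟨v, h⟩) else
    invariants (emptyConf (isEmpty_out_of_not_isNode h))

omit [Finite V] in
theorem nodeFamily_eq (q : ∀ v : {v : V // T.IsNode v}, ConfModSim (T.Out v.1) E) :
    ∃ w : ∀ v, Conf (T.Out v) E, nodeFamily q = fun v => invariants (w v) := by
  have : ∀ v, ∃ w : Conf (T.Out v) E, nodeFamily q v = invariants w := by
    intro v
    by_cases h : T.IsNode v
    · obtain ⟨x, hx⟩ := Quotient.exists_rep (q ⟨v, h⟩)
      refine ⟨x, ?_⟩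
      rw [nodeFamily, dif_pos h, ← hx]
      rfl
    · exact ⟨_, dif_neg h⟩
  choose w hw using this
  exact ⟨w, funext hw⟩

theorem glue_nodeFamily_mem (q : ∀ v : {v : V // T.IsNode v}, ConfModSim (T.Out v.1) E) :
    glue (nodeFamily q) ∈ CompModSim (Fin n) E := by
  obtain ⟨w, hw⟩ := nodeFamily_eq q
  rw [hw]
  exact glue_mem w

theorem glue_nodeFamily_mem_simStratum
    (q : ∀ v : {v : V // T.IsNode v}, ConfModSim (T.Out v.1) E) :
    (⟨_, glue_nodeFamily_mem q⟩ : CompModSim (Fin n) E) ∈ simStratum T E := by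
  obtain ⟨w, hw⟩ := nodeFamily_eq q
  refine (parens_excl_glue fun v t => ?_).symm
  rw [hw]
  exact invariants_snd_ne_zero _ _

theorem exists_iota_eq {y : CompModSim (Fin n) E} (hy : y ∈ simStratum T E) (v : V) :
    ∃ q : ConfModSim (T.Out v) E, iota q = resOut v y.1 := by
  have h : parens (excl y.1.2) ⊆ T.leafSets := fun A hA =>
    ((Set.ext_iff.1 (show T.leafSets \ {univ} = parens (excl y.1.2) from hy) A).2 hA).1
  exact mem_range_iota (restrict_mem _ _ y.2) (resOut_ne_zero h v)

end FTree

open FTree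

/-- The stratum of a tree in the space of configurations modulo similarity is the product of the
spaces of configurations modulo similarity at its nodes. -/
theorem diffeomorphic_simStratum {V : Type*} [Finite V] {n : ℕ} (T : FTree V n) (E : Type*)
    [NormedAddCommGroup E] [InnerProductSpace ℝ E] :
    Diffeomorphic (coordsSimStratum T E)
      (LocalCoords.pi fun v : {v : V // T.IsNode v} => coordsConfModSim (T.Out v.1) E) := by
  choose f hf using fun (y : simStratum T E) (v : {v : V // T.IsNode v}) =>
    exists_iota_eq y.2 v.1
  have hval : IsSmooth (coordsSimStratum T E) (coordsAtilde (Fin n) E)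
      fun y => y.1.1 :=
    ((compat_coordsAtilde (Fin n) E).val _).comp
      (((compat_coordsAtilde (Fin n) E).sub (· ∈ CompModSim (Fin n) E)).val _)
  refine Diffeomorphic.of_maps f
    (fun q => ⟨⟨_, glue_nodeFamily_mem q⟩, glue_nodeFamily_mem_simStratum q⟩) ?_ ?_ ?_ ?_
  · refine isSmooth_pi fun v => isSmooth_confModSim ?_
    simp only [hf]
    exact hval.restrict _ _
  · refine isSmooth_sub (isSmooth_sub (isSmooth_glue fun v => ?_))
    by_cases h : T.IsNode v
    · simp only [nodeFamily, dif_pos h]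
      exact isSmooth_iota.comp (Compat.eval (fun v : {v : V // T.IsNode v} =>
        coordsConfModSim (T.Out v.1) E) ⟨v, h⟩ compat_coordsConfModSim)
    · simp only [nodeFamily, dif_neg h]
      exact isSmooth_const _ _ _
  · intro y
    refine Subtype.ext (Subtype.ext ?_)
    have h1 : nodeFamily (f y) = fun v : V => resOut v y.1.1 := by
      funext v
      by_cases h : T.IsNode v
      · rw [nodeFamily, dif_pos h, hf]
      · have := isEmpty_out_of_not_isNode h
        have := subsingleton_atilde (S := T.Out v) (E := E)
        exact Subsingleton.elim _ _
    change glue (nodeFamily (f y)) = y.1.1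
    rw [h1]
    refine glue_resOut y.1.2 (nested_of_parens y.1.2 ?_)
    exact (show T.leafSets \ {univ} = parens (excl y.1.1.2) from y.2).subset
  · intro q
    funext v
    refine iota_injective ?_
    rw [hf, resOut_glue, nodeFamily, dif_pos v.2]

/-! ### Families indexed by the vertices of a tree -/

namespace FTree

variable {V : Type*} {n : ℕ} {T : FTree V n}

/-- Every vertex is the root, an internal vertex over a root edge, or a vertex without edges. -/
theorem vertex_cases {P : V → Prop} (root : P T.root)
    (int : ∀ (e : T.Out T.root) (v : T.InternalOver e), P v.1)
    (leaf : ∀ v, IsEmpty (T.Out v) → P v) (v : V) : P v := by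
  by_cases hv : v = T.root
  · exact hv ▸ root
  by_cases h : T.IsNode v
  · obtain ⟨e, he⟩ := (T.over_root v).exists_out hv
    exact int e ⟨v, ⟨h, hv⟩, he⟩
  · exact leaf v (isEmpty_out_of_not_isNode h)

theorem isEmpty_out_of_not_over {v : V} (hv : v ≠ T.root)
    (h : ¬ ∃ e : T.Out T.root, T.IsInternal v ∧ T.Over v e.1) : IsEmpty (T.Out v) :=
  isEmpty_out_of_not_isNode fun hn => h <| by
    obtain ⟨e, he⟩ := (T.over_root v).exists_out hv
    exact ⟨e, ⟨hn, hv⟩, he⟩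

open Classical in
/-- A family indexed by the vertices, composed of a value at the root, values at the internal
vertices over each root edge, and default values at the leaves. -/
def vertexFamily {C : V → Type*} (c : ∀ v, IsEmpty (T.Out v) → C v) (r : C T.root)
    (b : ∀ (e : T.Out T.root) (v : T.InternalOver e), C v.1) (v : V) : C v :=
  if hv : v = T.root then hv.symm ▸ r else
    if h : ∃ e : T.Out T.root, T.IsInternal v ∧ T.Over v e.1 then
      b h.choose ⟨v, h.choose_spec⟩ else c v (isEmpty_out_of_not_over hv h)

section

variable {C : V → Type*} {c : ∀ v, IsEmpty (T.Out v) → C v} {r : C T.root}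
  {b : ∀ (e : T.Out T.root) (v : T.InternalOver e), C v.1}

theorem vertexFamily_root : vertexFamily c r b T.root = r := dif_pos rfl

theorem vertexFamily_internal {e : T.Out T.root} (v : T.InternalOver e) :
    vertexFamily c r b v.1 = b e v := by
  have h : ∃ e : T.Out T.root, T.IsInternal v.1 ∧ T.Over v.1 e.1 := ⟨e, v.2⟩
  have key : ∀ e' (h' : T.IsInternal v.1 ∧ T.Over v.1 (e' : T.Out T.root).1), e' = e →
      b e' ⟨v.1, h'⟩ = b e v := by
    rintro _ _ rfl
    rfl
  rw [vertexFamily, dif_neg v.2.1.2, dif_pos h]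
  exact key _ _ (Out.eq_of_over h.choose_spec.2 v.2.2)

end

/-- All leaves lie over one internal vertex exactly if there are at least two leaves and a single
root edge. -/
theorem univ_mem_leafSets [Finite V] :
    univ ∈ T.leafSets ↔ 2 ≤ n ∧ ∀ i j, T.rootEdge i = T.rootEdge j := by
  constructor
  · rintro ⟨v, hv, h⟩
    have hall : ∀ i, T.Over (T.leaf i).1 v := fun i => by
      have : i ∈ {i | T.Over (T.leaf i).1 v} := h ▸ mem_univ i
      exact this
    obtain ⟨e, f, hef⟩ := hv.exists_ne_out
    obtain ⟨c, hc⟩ := (T.over_root v).exists_out hv.2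
    have hroot : ∀ i, c = T.rootEdge i := fun i =>
      LeafOver.eq_rootEdge (show T.LeafOver c i from (hall i).trans hc)
    refine ⟨?_, fun i j => (hroot i).symm.trans (hroot j)⟩
    have : Nontrivial (Fin n) := ⟨rep e, rep f, rep_injective.ne hef⟩
    exact Fin.nontrivial_iff_two_le.1 this
  · rintro ⟨hn, h⟩
    have : Nontrivial (Fin n) := Fin.nontrivial_iff_two_le.2 hn
    obtain ⟨i, j, hij⟩ := exists_pair_ne (Fin n)
    have hall : ∀ k, T.LeafOver (T.rootEdge i) k := fun k => h k i ▸ leafOver_rootEdge k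
    exact ⟨(T.rootEdge i).1, isInternal_of_leafOver hij (hall i) (hall j),
      (eq_univ_of_forall hall).symm⟩

section Family

variable {E : Type*} [NormedAddCommGroup E] [NormedSpace ℝ E]

/-- Directions and ratios at all vertices, given at the root and at the internal vertices. -/
def atildeFamily (ξ : Atilde (T.Out T.root) E)
    (b : ∀ (e : T.Out T.root) (v : T.InternalOver e), Atilde (T.Out v.1) E) :
    ∀ v, Atilde (T.Out v) E :=
  vertexFamily (fun _ h => invariants (emptyConf h)) ξ b

theorem atildeFamily_eq {ξ : Atilde (T.Out T.root) E}
    {b : ∀ (e : T.Out T.root) (v : T.InternalOver e), Atilde (T.Out v.1) E}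
    {a : ∀ v, Atilde (T.Out v) E} (h : ξ = a T.root) (h' : ∀ e v, b e v = a v.1) :
    atildeFamily ξ b = a := by
  funext v
  refine vertex_cases (T := T) (P := fun v => atildeFamily ξ b v = a v)
    (vertexFamily_root.trans h) (fun e v => (vertexFamily_internal v).trans (h' e v))
    (fun v hv => ?_) v
  have := subsingleton_atilde (S := T.Out v) (E := E)
  exact Subsingleton.elim _ _

variable {X : Type*} [TopologicalSpace X] {ξ : X → Atilde (T.Out T.root) E}
  {b : X → ∀ (e : T.Out T.root) (v : T.InternalOver e), Atilde (T.Out v.1) E}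

theorem continuous_atildeFamily (hξ : Continuous ξ) (hb : ∀ e v, Continuous fun x => b x e v)
    (v : V) : Continuous fun x => atildeFamily (ξ x) (b x) v := by
  refine vertex_cases (T := T) (P := fun v => Continuous fun x => atildeFamily (ξ x) (b x) v)
    ?_ (fun e v => ?_) (fun v hv => ?_) v
  · simpa only [atildeFamily, vertexFamily_root] using hξ
  · simpa only [atildeFamily, vertexFamily_internal] using hb e v
  · have := subsingleton_atilde (S := T.Out v) (E := E)
    exact continuous_of_const fun _ _ => Subsingleton.elim _ _

theorem isSmooth_atildeFamily [Finite V] {c : LocalCoords X}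
    (hξ : IsSmooth c (coordsAtilde (T.Out T.root) E) ξ)
    (hb : ∀ e v, IsSmooth c (coordsAtilde (T.Out v.1) E) fun x => b x e v) (v : V) :
    IsSmooth c (coordsAtilde (T.Out v) E) fun x => atildeFamily (ξ x) (b x) v := by
  refine vertex_cases (T := T) (P := fun v => IsSmooth c (coordsAtilde (T.Out v) E)
    fun x => atildeFamily (ξ x) (b x) v) ?_ (fun e v => ?_) (fun v hv => ?_) v
  · simpa only [atildeFamily, vertexFamily_root] using hξ
  · simpa only [atildeFamily, vertexFamily_internal] using hb e v
  · have := subsingleton_atilde (S := T.Out v) (E := E)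
    have h : (fun x => atildeFamily (ξ x) (b x) v) = fun _ => invariants (emptyConf hv) :=
      funext fun _ => Subsingleton.elim _ _
    rw [h]
    exact isSmooth_const _ _ _

end Family

/-! ### Grafted configurations in an immersed manifold -/

section Graft

variable [Finite V] {d : ℕ} {M : Type*} [TopologicalSpace M]
  [ChartedSpace (EuclideanSpace ℝ (Fin d)) M] {E : Type*} [NormedAddCommGroup E] [NormedSpace ℝ E]
  {ε : M → E}

/-- The image of an inflated configuration under a map that is strictly differentiable at its
center has the same limits as its image under the derivative. -/
theorem tendsto_map_inflate_sub {F : EuclideanSpace ℝ (Fin d) → E}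
    {D : EuclideanSpace ℝ (Fin d) →L[ℝ] E} {p : EuclideanSpace ℝ (Fin d)}
    (hF : HasStrictFDerivAt F D p) (w : ∀ v, T.Out v → EuclideanSpace ℝ (Fin d))
    (h0 : w T.root = 0) {v : V} {e f : T.Out v} {i j : Fin n} (hi : T.LeafOver e i)
    (hj : T.LeafOver f j) :
    Tendsto (fun t => (t ^ T.depth v)⁻¹ • (F (p + inflate w t i) - F (p + inflate w t j)))
      (𝓝[>] 0) (𝓝 (D (w v e) - D (w v f))) := by
  have hp : ∀ i, Tendsto (fun t => p + inflate w t i) (𝓝[>] 0) (𝓝 p) := fun i => by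
    simpa only [add_zero] using (tendsto_inflate_zero w h0 i).const_add p
  have h1 := tendsto_inflate_sub w hi hj
  have h2 := hF.isLittleO.comp_tendsto ((hp i).prodMk_nhds (hp j))
  have h3 := ((isBigO_refl (fun t : ℝ => (t ^ T.depth v)⁻¹) (𝓝[>] 0)).smul_isLittleO h2)
  have h4 : Tendsto (fun t : ℝ => (t ^ T.depth v)⁻¹ • (F (p + inflate w t i) -
      F (p + inflate w t j) - D (inflate w t i - inflate w t j))) (𝓝[>] 0) (𝓝 0) := by
    rw [← isLittleO_one_iff ℝ]
    refine (h3.congr (fun t => ?_) fun t => ?_).trans_isBigO (h1.isBigO_one ℝ) <;>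
      simp only [comp_apply, add_sub_add_left_eq_sub]
  have h5 := h4.add ((D.continuous.tendsto _).comp h1)
  rw [zero_add, map_sub] at h5
  refine h5.congr fun t => ?_
  rw [comp_apply, map_smul, ← smul_add, sub_add_cancel]

/-- Configurations at the root and in charts at the internal vertices are grafted to a point of
the stratum of the tree: inflating them in the charts exhibits it as a limit of configurations. -/
theorem exists_mem_stratum (hε : Injective ε) (him : IsChartImmersion d ε)
    (y : Conf (T.Out T.root) M) (c : T.Out T.root → atlas (EuclideanSpace ℝ (Fin d)) M)
    (hc : ∀ e, y.1 e ∈ (c e).1.source)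
    (w : ∀ (e : T.Out T.root) (v : T.InternalOver e),
      Conf (T.Out v.1) (EuclideanSpace ℝ (Fin d))) :
    ∃ h : ((fun i => y.1 (T.rootEdge i)),
        glue (atildeFamily (alpha ε hε y).2 fun e v =>
          push (chartDeriv ε (c e) (y.1 e)) (him.injective (hc e)) (invariants (w e v)))) ∈
        CompConf (Fin n) ε hε, ⟨_, h⟩ ∈ stratum T ε hε := by
  let g : ∀ e, EuclideanSpace ℝ (Fin d) →L[ℝ] E := fun e => chartDeriv ε (c e) (y.1 e)
  have hg : ∀ e, Injective (g e) := fun e => him.injective (hc e)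
  let W : ∀ v, Conf (T.Out v) E := vertexFamily (fun _ h => emptyConf h)
    ⟨ε ∘ y.1, hε.comp y.2⟩ fun e v => ⟨g e ∘ (w e v).1, (hg e).comp (w e v).2⟩
  let w' : ∀ v, T.Out v → EuclideanSpace ℝ (Fin d) := vertexFamily (fun _ _ => 0) 0
    fun e v => (w e v).1
  have hW : atildeFamily (alpha ε hε y).2 (fun e v =>
      push (g e) (hg e) (invariants (w e v))) = fun v => invariants (W v) := by
    refine atildeFamily_eq ?_ fun e v => ?_
    · simp only [W, vertexFamily_root]
      rfl
    · simp only [W, vertexFamily_internal]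
      exact push_invariants _ _
  have h0 : w' T.root = 0 := vertexFamily_root
  -- The configurations at the internal vertices, inflated around the points of `y` in the charts.
  let z : ℝ → Fin n → M := fun t i => (c (T.rootEdge i)).1.symm
    ((c (T.rootEdge i)).1 (y.1 (T.rootEdge i)) + inflate w' t i)
  have hz : ∀ i, Tendsto (fun t => z t i) (𝓝[>] 0) (𝓝 (y.1 (T.rootEdge i))) := by
    intro i
    have h1 : Tendsto (fun t => (c (T.rootEdge i)).1 (y.1 (T.rootEdge i)) + inflate w' t i)
        (𝓝[>] 0) (𝓝 ((c (T.rootEdge i)).1 (y.1 (T.rootEdge i)))) := by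
      simpa using (tendsto_inflate_zero w' h0 i).const_add _
    have h2 := (c (T.rootEdge i)).1.tendsto_symm (hc _)
    exact h2.comp h1
  have hεc : ∀ e, ContinuousAt ε (y.1 e) := by
    intro e
    have h1 := (him.smoothNear (hc e)).continuousAt.comp ((c e).1.continuousAt (hc e))
    refine h1.congr ?_
    filter_upwards [(c e).1.open_source.mem_nhds (hc e)] with x hx
    simp [(c e).1.left_inv hx]
  obtain ⟨h1, h2⟩ := exists_tendsto_glue (T := T) (fun t i => ε (z t i)) W <| by
    refine fun v => vertex_cases (T := T) (P := fun v => ∀ (e f : T.Out v) i j, e ≠ f →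
      T.LeafOver e i → T.LeafOver f j →
      Tendsto (fun t => (t ^ T.depth v)⁻¹ • (ε (z t i) - ε (z t j))) (𝓝[>] 0)
        (𝓝 ((W v).1 e - (W v).1 f))) ?_ ?_ ?_ v
    · intro e f i j _ hi hj
      simp only [depth_root, pow_zero, inv_one, one_smul, W, vertexFamily_root]
      rw [hi.eq_rootEdge, hj.eq_rootEdge]
      exact ((hεc _).tendsto.comp (hz i)).sub ((hεc _).tendsto.comp (hz j))
    · intro e₀ v e f i j _ hi hj
      have hi' : e₀ = T.rootEdge i := LeafOver.eq_rootEdge (hi.over.trans v.2.2)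
      have hj' : e₀ = T.rootEdge j := LeafOver.eq_rootEdge (hj.over.trans v.2.2)
      have hstrict : HasStrictFDerivAt (ε ∘ (c e₀).1.symm) (g e₀) ((c e₀).1 (y.1 e₀)) :=
        (him.smoothNear (hc e₀)).contDiffAt.hasStrictFDerivAt (by simp)
      have h1 := tendsto_map_inflate_sub hstrict w' h0 hi hj
      simp only [W, w', vertexFamily_internal] at h1 ⊢
      simp only [z, ← hi', ← hj']
      exact h1
    · exact fun v hv e => hv.elim e
  have hne := neBot_comap_val h1
  rw [hW]
  refine ⟨?_, ?_⟩
  · refine mem_closure_of_tendsto ((tendsto_pi_nhds.2 fun i =>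
      (hz i).comp tendsto_comap).prodMk_nhds h2) (Eventually.of_forall fun t => ?_)
    exact ⟨⟨z t.1, fun i j hij => t.2.2 (congrArg ε hij)⟩, rfl⟩
  · have h3 := parens_excl_glue (T := T) (a := fun v => invariants (W v))
      fun v t => invariants_snd_ne_zero _ _
    change T.leafSets = parens (excl (glue fun v => invariants (W v)).2) ∪
      {A | A = univ ∧ 2 ≤ n ∧ ∀ i j, y.1 (T.rootEdge i) = y.1 (T.rootEdge j)}
    rw [h3]
    -- The set of all labels is never a parenthesis; it is accounted for by the coinciding points.
    ext A
    simp only [mem_union, Set.mem_sdiff, mem_singleton_iff, mem_ofPred_eq, y.2.eq_iff]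
    rw [← univ_mem_leafSets]
    by_cases hA : A = univ
    · simp [hA]
    · simp [hA]

end Graft

end FTree

/-! ### The closed stratum -/

section Relations

variable {S S' M E : Type*} [TopologicalSpace M] [NormedAddCommGroup E] [NormedSpace ℝ E]
  {ε : M → E} {hε : Injective ε}

theorem snd_mem_compModSim {ξ : A S M E} (h : ξ ∈ CompConf S ε hε) : ξ.2 ∈ CompModSim S E := by
  refine map_mem_closure continuous_snd h ?_
  rintro _ ⟨x, rfl⟩
  exact ⟨Quotient.mk _ ⟨ε ∘ x.1, hε.comp x.2⟩, rfl⟩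

theorem restrict_mem_compConf (ρ : S → S') (hρ : Injective ρ) {ξ : A S' M E}
    (h : ξ ∈ CompConf S' ε hε) :
    (fun s => ξ.1 (ρ s), restrict ρ hρ ξ.2) ∈ CompConf S ε hε := by
  refine map_mem_closure (f := fun ξ : A S' M E => (fun s => ξ.1 (ρ s), restrict ρ hρ ξ.2))
    ?_ h ?_
  · exact (continuous_pi fun s => (continuous_apply _).comp continuous_fst).prodMk
      ((continuous_restrict ρ hρ).comp continuous_snd)
  · rintro _ ⟨x, rfl⟩
    exact ⟨⟨x.1 ∘ ρ, x.2.comp hρ⟩, rfl⟩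

/-- Points at an infinitely smaller distance than others coincide. -/
theorem eq_of_excl {n : ℕ} (hc : Continuous ε) {ξ : A (Fin n) M E}
    (h : ξ ∈ CompConf (Fin n) ε hε) {i j k : Fin n} (hijk : excl ξ.2.2 i j k) :
    ξ.1 i = ξ.1 j := by
  obtain ⟨l, hl, hlξ⟩ := exists_tendsto_alpha h
  obtain ⟨ht, h0⟩ := hijk
  have hx : ∀ i, Tendsto (fun x : Conf (Fin n) M => ε (x.1 i)) l (𝓝 (ε (ξ.1 i))) := fun i =>
    (hc.tendsto _).comp (tendsto_pi_nhds.1 hlξ.fst_nhds i)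
  have h1 := (tendsto_atilde_iff.1 hlξ.snd_nhds).2 ⟨(i, j, k), ht⟩
  rw [h0] at h1
  have h2 := (tendsto_ratio_zero_iff (X := fun x : Conf (Fin n) M =>
    (⟨ε ∘ x.1, hε.comp x.2⟩ : Conf (Fin n) E)) _).1 h1
  have h3 := h2.trans_isBigO (((hx i).sub (hx k)).isBigO_one ℝ)
  rw [isLittleO_one_iff] at h3
  exact hε (sub_eq_zero.1 (tendsto_nhds_unique ((hx i).sub (hx j)) h3))

end Relations

namespace FTree

variable {V : Type*} {n : ℕ} {T : FTree V n}

section Closed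

variable {M E : Type*} [TopologicalSpace M] [NormedAddCommGroup E] [NormedSpace ℝ E]
  {ε : M → E} {hε : Injective ε}

/-- The ratios in the closed stratum satisfy the relations imposed by the tree. -/
theorem nested_of_mem_closure {x : CompConf (Fin n) ε hε}
    (hx : x ∈ closure (stratum T ε hε)) : T.Nested x.1.2.2 := by
  have hcl : IsClosed {x : CompConf (Fin n) ε hε | T.Nested x.1.2.2} := by
    simp only [Nested, ofPred_forall]
    refine isClosed_iInter fun v => isClosed_iInter fun _ => isClosed_iInter fun i =>
      isClosed_iInter fun j => isClosed_iInter fun k => isClosed_iInter fun h =>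
      isClosed_iInter fun _ => isClosed_iInter fun _ => isClosed_iInter fun _ => ?_
    exact isClosed_eq ((continuous_apply _).comp
      (continuous_snd.comp (continuous_snd.comp continuous_subtype_val))) continuous_const
  refine closure_minimal (fun x hx => ?_) hcl hx
  refine nested_of_parens (snd_mem_compModSim x.2) fun A hA => ?_
  rcases (show T.leafSets = _ from hx).subset hA.1 with h | h
  · exact h
  · exact absurd h.1 hA.2

/-- In the closed stratum, the points over an internal vertex coincide. -/
theorem eq_of_mem_closure (hc : Continuous ε) {x : CompConf (Fin n) ε hε}
    (hx : x ∈ closure (stratum T ε hε)) {v : V} (hv : T.IsInternal v) {i j : Fin n}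
    (hi : T.Over (T.leaf i).1 v) (hj : T.Over (T.leaf j).1 v) : x.1.1 i = x.1.1 j := by
  have hcl : IsClosed {x : CompConf (Fin n) ε hε | ε (x.1.1 i) = ε (x.1.1 j)} :=
    isClosed_eq (hc.comp ((continuous_apply _).comp (continuous_fst.comp continuous_subtype_val)))
      (hc.comp ((continuous_apply _).comp (continuous_fst.comp continuous_subtype_val)))
  refine hε (closure_minimal (fun x hx => congrArg ε ?_) hcl hx)
  rcases (show T.leafSets = _ from hx).subset ⟨v, hv, rfl⟩ with ⟨i₀, k₀, -, hA⟩ | h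
  · have key : ∀ m, T.Over (T.leaf m).1 v → x.1.1 i₀ = x.1.1 m := fun m hm => by
      rcases (Set.ext_iff.1 hA m).1 hm with rfl | h
      · rfl
      · exact eq_of_excl hc x.2 h
    exact (key i hi).symm.trans (key j hj)
  · exact h.2.2 i j

/-- In the closed stratum, the points over a root edge coincide. -/
theorem eq_of_leafOver (hc : Continuous ε) {x : CompConf (Fin n) ε hε}
    (hx : x ∈ closure (stratum T ε hε)) {e : T.Out T.root} {i j : Fin n} (hi : T.LeafOver e i)
    (hj : T.LeafOver e j) : x.1.1 i = x.1.1 j := by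
  by_cases hij : i = j
  · rw [hij]
  · exact eq_of_mem_closure hc hx (isInternal_of_leafOver hij hi hj) hi hj

end Closed

variable [Finite V] {d : ℕ} {M E : Type*} [TopologicalSpace M]
  [ChartedSpace (EuclideanSpace ℝ (Fin d)) M] [IsManifold (𝓡 d) ∞ M]
  [NormedAddCommGroup E] [InnerProductSpace ℝ E] {ε : M → E} {hε : Injective ε}

/-- The infinitesimal configuration at an internal vertex of a point of the closed stratum. -/
theorem exists_infConf [FiniteDimensional ℝ E] (hc : Continuous ε) (him : IsChartImmersion d ε)
    (x : ClosedStratum T ε hε) (e : T.Out T.root) (v : T.InternalOver e) :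
    ∃ q : InfConf d (T.Out v.1) M, q.proj = x.1.1.1 (rep e) ∧
      ambient him q = resOut v.1 x.1.1.2 :=
  exists_ambient_eq hε him (restrict_mem_compConf rep rep_injective x.1.2) fun s =>
    eq_of_leafOver hc x.2 ((leafOver_rep s).over.trans v.2.2) (leafOver_rep e)

variable (T) in
/-- Grafting the infinitesimal configurations at the internal vertices to the configuration at the
root. -/
def graft (him : IsChartImmersion d ε) (p : ModelStratum T d ε hε) : A (Fin n) M E :=
  (fun i => p.1.1.1.1 (T.rootEdge i),
    glue (atildeFamily p.1.1.1.2 fun e v => ambient him ((p.1.2 e).1.2 v)))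

/-- The grafted points are limits of points of the stratum: approximate the configuration at the
root and the infinitesimal configurations, in charts, by nondegenerate ones. -/
theorem graft_mem_closure (him : IsChartImmersion d ε) (p : ModelStratum T d ε hε) :
    graft T him p ∈ closure (Subtype.val '' stratum T ε hε) := by
  let c : T.Out T.root → atlas (EuclideanSpace ℝ (Fin d)) M := fun e => achart _ (p.1.1.1.1 e)
  have hp : ∀ e, p.1.1.1.1 e ∈ (c e).1.source := fun e => mem_chart_source _ _
  -- In charts around the points at the root, the model is contained in `U`, and grafting is the
  -- restriction of the continuous map `G`.
  let B := ∀ (e : T.Out T.root) (v : T.InternalOver e),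
    Atilde (T.Out v.1) (EuclideanSpace ℝ (Fin d))
  let U : Set (A (T.Out T.root) M E × B) := {z | ∀ e, z.1.1 e ∈ (c e).1.source}
  have hU : IsOpen U := by
    simp only [U, ofPred_forall]
    exact isOpen_iInter_of_finite fun e => (c e).1.open_source.preimage
      ((continuous_apply e).comp (continuous_fst.comp continuous_fst))
  let G : U → A (Fin n) M E := fun z => (fun i => z.1.1.1 (T.rootEdge i),
    glue (atildeFamily z.1.1.2 fun e v =>
      push (chartDeriv ε (c e) (z.1.1.1 e)) (him.injective (z.2 e)) (z.1.2 e v)))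
  have hG : Continuous G := by
    have h1 : ∀ e, Continuous fun z : U => z.1.1.1 e := fun e =>
      (continuous_apply e).comp (continuous_fst.comp (continuous_fst.comp continuous_subtype_val))
    refine (continuous_pi fun i => h1 _).prodMk ?_
    refine continuous_glue (continuous_atildeFamily
      (continuous_snd.comp (continuous_fst.comp continuous_subtype_val)) fun e v => ?_)
    refine continuous_iff_continuousAt.2 fun z => continuousAt_push
      (g := fun z : U => chartDeriv ε (c e) (z.1.1.1 e)) (a := fun z : U => z.1.2 e v) ?_ ?_
      (Eventually.of_forall fun z => isPush_push _ _)
    · exact ContinuousAt.comp (g := chartDeriv ε (c e)) (him.continuousAt_chartDeriv (z.2 e))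
        (h1 e).continuousAt
    · exact ((continuous_apply v).comp ((continuous_apply e).comp
        (continuous_snd.comp continuous_subtype_val))).continuousAt
  let s : Set (A (T.Out T.root) M E × B) := range (alpha ε hε) ×ˢ
    univ.pi fun e => univ.pi fun v => range invariants
  let P : U := ⟨(p.1.1.1, fun e v => (fiberCoord (c e) ((p.1.2 e).1.2 v)).1), hp⟩
  have hPs : P.1 ∈ closure s := by
    simp only [s, closure_prod_eq, closure_pi_set]
    refine ⟨p.1.1.2, fun e _ v _ => ?_⟩
    change _ ∈ closure (range invariants)
    rw [← range_iota]
    exact (fiberCoord (c e) ((p.1.2 e).1.2 v)).2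
  have hPs' : P ∈ closure (Subtype.val ⁻¹' s) := by
    rw [← hU.isOpenMap_subtype_val.preimage_closure_eq_closure_preimage continuous_subtype_val]
    exact hPs
  have hGP : G P = graft T him p := by
    refine Prod.ext rfl (congrArg glue (congrArg (atildeFamily p.1.1.1.2)
      (funext fun e => funext fun v => ?_)))
    have hproj : ((p.1.2 e).1.2 v).proj = p.1.1.1.1 e := ((p.1.2 e).2 v).trans (p.2 e).symm
    have h1 := isPush_ambient him (c e) (q := (p.1.2 e).1.2 v) (hproj ▸ hp e)
    rw [hproj] at h1
    exact (isPush_push _ _).unique h1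
  rw [← hGP]
  refine map_mem_closure hG hPs' ?_
  rintro ⟨⟨_, b⟩, hz⟩ ⟨⟨y, rfl⟩, hb⟩
  choose w hw using fun e v => hb e (mem_univ e) v (mem_univ v)
  obtain ⟨h1, h2⟩ := exists_mem_stratum hε him y c hz w
  simp only [hw] at h1 h2
  exact ⟨_, h2, rfl⟩

theorem graft_mem_compConf (him : IsChartImmersion d ε) (p : ModelStratum T d ε hε) :
    graft T him p ∈ CompConf (Fin n) ε hε :=
  closure_minimal (by rintro _ ⟨x, -, rfl⟩; exact x.2) isClosed_closure (graft_mem_closure him p)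

end FTree

/-- The closed stratum of a tree is the pull-back of the compactified configuration space at the
root and the bundles of infinitesimal configurations at the internal vertices. -/
theorem diffeomorphic_closedStratum {V : Type*} [Finite V] {n : ℕ} (T : FTree V n) {d : ℕ}
    {M E : Type*} [TopologicalSpace M] [ChartedSpace (EuclideanSpace ℝ (Fin d)) M]
    [IsManifold (𝓡 d) ∞ M] [NormedAddCommGroup E] [InnerProductSpace ℝ E]
    [FiniteDimensional ℝ E] {ε : M → E} (hε : Injective ε) (hc : Continuous ε)
    (him : IsChartImmersion d ε) :
    Diffeomorphic (coordsClosedStratum T d ε hε) (coordsModelStratum T d ε hε) := by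
  choose q hqp hqa using exists_infConf (T := T) (hε := hε) hc him
  have hA := (compat_coordsA d (Fin n) M E)
  have hval : IsSmooth (coordsClosedStratum T d ε hε) (coordsA d (Fin n) M E)
      fun x => x.1.1 := (hA.val _).comp ((hA.sub _).val _)
  have hpt : ∀ i, IsSmooth (coordsClosedStratum T d ε hε) (ofCharts d M) fun x => x.1.1.1 i :=
    fun i => (Compat.eval (fun _ : Fin n => ofCharts d M) i (compat_ofCharts d M)).comp
      (((Compat.pi fun _ => compat_ofCharts d M).fst _).comp hval)
  have hat : IsSmooth (coordsClosedStratum T d ε hε) (coordsAtilde (Fin n) E)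
      fun x => x.1.1.2 := ((compat_coordsAtilde (Fin n) E).snd _).comp hval
  let f : ClosedStratum T ε hε → ModelStratum T d ε hε := fun x =>
    ⟨(⟨(fun e => x.1.1.1 (rep e), resOut T.root x.1.1.2),
        restrict_mem_compConf rep rep_injective x.1.2⟩,
      fun e => ⟨(x.1.1.1 (rep e), q x e), hqp x e⟩), fun e => rfl⟩
  let g : ModelStratum T d ε hε → ClosedStratum T ε hε := fun p =>
    ⟨⟨graft T him p, graft_mem_compConf him p⟩, closure_subtype.2 (graft_mem_closure him p)⟩
  refine Diffeomorphic.of_maps f g ?_ ?_ ?_ ?_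
  · refine isSmooth_sub (isSmooth_prodMk (isSmooth_sub (isSmooth_prodMk
      (isSmooth_pi fun e => hpt _) (hat.restrict _ _))) (isSmooth_pi fun e =>
      isSmooth_sub (isSmooth_prodMk (hpt _) (isSmooth_pi fun v => isSmooth_infConf him ?_ ?_))))
    · simp only [hqp]
      exact hpt _
    · simp only [hqa]
      exact hat.restrict _ _
  · have hI : ∀ S [Finite S], (coordsInfConf d S M).Compat := fun S _ =>
      isSmooth_infConf him isSmooth_infConf_proj (isSmooth_ambient him)
    have hE : ∀ e, (coordsInfConfEdge T d M e).Compat := fun e =>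
      ((compat_ofCharts d M).prod (Compat.pi fun v => hI _)).sub _
    have hR := compat_coordsA d (T.Out T.root) M E
    have hm : IsSmooth (coordsModelStratum T d ε hε) _ Subtype.val :=
      ((hR.sub _).prod (Compat.pi hE)).val _
    have h1 : IsSmooth (coordsModelStratum T d ε hε) (coordsA d (T.Out T.root) M E)
        fun p => p.1.1.1 := (hR.val _).comp (((hR.sub _).fst _).comp hm)
    have h2 : ∀ e, IsSmooth (coordsModelStratum T d ε hε) (ofCharts d M)
        fun p => p.1.1.1.1 e := fun e =>
      (Compat.eval (fun _ : T.Out T.root => ofCharts d M) e (compat_ofCharts d M)).comp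
        (((Compat.pi fun _ => compat_ofCharts d M).fst _).comp h1)
    have h3 : IsSmooth (coordsModelStratum T d ε hε) (coordsAtilde (T.Out T.root) E)
        fun p => p.1.1.1.2 := ((compat_coordsAtilde _ E).snd _).comp h1
    have h4 : ∀ e (v : T.InternalOver e), IsSmooth (coordsModelStratum T d ε hε)
        (coordsInfConf d (T.Out v.1) M) fun p => (p.1.2 e).1.2 v := fun e v =>
      (Compat.eval (fun v : T.InternalOver e => coordsInfConf d (T.Out v.1) M) v (hI _)).comp
        (((Compat.pi fun v : T.InternalOver e => hI (T.Out v.1)).snd _).comp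
          ((((compat_ofCharts d M).prod (Compat.pi fun v : T.InternalOver e =>
            hI (T.Out v.1))).val _).comp
            ((Compat.eval (fun e => coordsInfConfEdge T d M e) e (hE e)).comp
              (((Compat.pi hE).snd _).comp hm))))
    exact isSmooth_sub (isSmooth_sub (isSmooth_prodMk (isSmooth_pi fun i => h2 _)
      (isSmooth_glue fun v => isSmooth_atildeFamily h3
        (fun e v => (isSmooth_ambient him).comp (h4 e v)) v)))
  · intro x
    refine Subtype.ext (Subtype.ext (Prod.ext (funext fun i => ?_) ?_))
    · exact eq_of_leafOver hc x.2 (leafOver_rep _) (leafOver_rootEdge i)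
    · have h1 : atildeFamily (resOut T.root x.1.1.2) (fun e v => ambient him (q x e v)) =
          fun v => resOut v x.1.1.2 := atildeFamily_eq rfl fun e v => hqa x e v
      change glue (atildeFamily (resOut T.root x.1.1.2) fun e v => ambient him (q x e v)) = _
      rw [h1]
      exact glue_resOut (snd_mem_compModSim x.1.2) (nested_of_mem_closure x.2)
  · intro p
    have hroot : ∀ e, p.1.1.1.1 (T.rootEdge (rep e)) = p.1.1.1.1 e := fun e => by
      rw [rootEdge_rep]
    refine Subtype.ext (Prod.ext (Subtype.ext (Prod.ext (funext hroot) ?_)) (funext fun e =>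
      Subtype.ext (Prod.ext ((hroot e).trans (p.2 e)) (funext fun v =>
        ambient_injective him ?_ ?_))))
    · exact (resOut_glue _).trans vertexFamily_root
    · exact (hqp _ _ _).trans ((hroot e).trans ((p.2 e).trans ((p.1.2 e).2 v).symm))
    · exact (hqa _ _ _).trans ((resOut_glue _).trans (vertexFamily_internal v))

end ConfSpace

end

theorem mainTheorem10 {V : Type*} [Finite V] {n : ℕ} (T : ConfSpace.FTree V n) :
    (∀ {d m : ℕ} {M : Type*} [TopologicalSpace M] [ChartedSpace (EuclideanSpace ℝ (Fin d)) M]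
      [IsManifold (𝓡 d) ∞ M] (ε : M → EuclideanSpace ℝ (Fin m))
      (hε : Manifold.IsSmoothEmbedding (𝓡 d) (𝓡 m) ∞ ε),
      ConfSpace.LocalCoords.Diffeomorphic
        (ConfSpace.coordsClosedStratum T d ε hε.isEmbedding.injective)
        (ConfSpace.coordsModelStratum T d ε hε.isEmbedding.injective)) ∧
    (∀ d : ℕ,
      ConfSpace.LocalCoords.Diffeomorphic
        (ConfSpace.coordsSimStratum T (EuclideanSpace ℝ (Fin d)))
        (ConfSpace.LocalCoords.pi fun v : {v : V // T.IsNode v} =>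
          ConfSpace.coordsConfModSim (T.Out v.1) (EuclideanSpace ℝ (Fin d)))) := by
  refine ⟨?_, fun d => ConfSpace.diffeomorphic_simStratum T _⟩
  intro d m M _ _ _ ε hε
  exact ConfSpace.diffeomorphic_closedStratum T hε.isEmbedding.injective hε.isEmbedding.continuous
    (ConfSpace.isChartImmersion_of_isSmoothEmbedding hε)
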